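/- **Flux.** Let $0<u^*<u_{\max}$, let $f_1\in C^2([0,u^*])$ and let $f_2\in C^2((u^*,u_{\max}])$ extend continuously to $u^*$. Assume $f_1(0)=f_2(u_{\max})=0$; $f_1'>0$, $f_1''\le 0$ on $(0,u^*)$; $f_2'<0$, $f_2''\le0$ on $(u^*,u_{\max})$; and $f(u^*-):=f_1(u^*)>f_2(u^*)=:f(u^*+)$. Put $f=f_1$ on $[0,u^*]$ and $f=f_2$ on $(u^*,u_{\max}]$. The multivalued flux is $\tilde f(u)=\{f(u)\}$ for $u\ne u^*$ and $\tilde f(u^*)=[f(u^*+),f(u^*-)]$. Let $f^{-1}(u^*+)\in[0,u^*)$ be the density with $f_1(f^{-1}(u^*+))=f(u^*+)$. For $u\le f^{-1}(u^*+)$ let $\eta(u)\in[u^*,u_{\max}]$ be the density with $f_2(\eta(u))=f_1(u)$; for $u>u^*$ let $\eta(u)\in[0,u^*]$ be the density with $f_1(\eta(u))=f_2(u)$. The demand is $D(u)=f(u)$ for $u<u^*$ and $D(u)=f(u^*-)$ for $u\ge u^*$. The supply is $S(u)=f(u^*-)$ for $u<u^*$, $S(u)=f(u)$ for $u>u^*$,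 and $S(u^*)=f(u^*-)$ or $S(u^*)=f(u^*+)$ according as the traffic ahead of the outgoing road is free flowing or congested; which of the two holds is part of the data. **Junction Riemann problem.** Two incoming roads $(-\infty,0)$ and one outgoing road $(0,\infty)$ meet at $x=0$. Given are $q\in(0,1)$, constant initial data $u^{\rm in}_{1,0},u^{\rm in}_{2,0},u^{\rm out}_{1,0}\in[0,u_{\max}]$, and the state (free flowing or congested) of the traffic ahead. A *junction solution* consists of measurable densities $u$ and fluxes $v$ on the three roads for $t>0$ such that: * $u,v$ depend only on $x/t$, $u(\cdot,t)$ has bounded variation on each road for every $t>0$, and $v\in\tilde f(u)$ a.e.; * on each road, for every $k\in[0,u_{\max}]\setminus\{u^*\}$, the entropy inequality $|u-k|_t+\big(\operatorname{sgn}(u-k)(v-f(k))\big)_x\le0$ holds in the sense of distributions for $t>0$; * the sum over the three roads of $\iint (u\,\partial_t\phi+v\,\partial_x\phi)\,dx\,dt+\int u_0\,\phi(x,0)\,dx$ (with $u_0$ the datum of the road) is zero for all compactly supported $C^1$ test functions on the closed roads times $[0,\infty)$ whose values and $x$-derivatives agree at $x=0$; * if $u^{\rm out}_{1,0}=u^*$,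 then on the outgoing road $v(x,t)\to S(u^*)$ as $x\to\infty$, for every $t>0$; * the limits $f^{\rm in}_i=v^{\rm in}_i(0-,t)$ and $f^{\rm out}_1=v^{\rm out}_1(0+,t)$ exist, and $f^{\rm out}_1=f^{\rm in}_1+f^{\rm in}_2$. It is an *admissible weak solution* if $f_1^{\rm in}+f_2^{\rm in}$ is maximal among all junction solutions with the same data and, among those attaining the maximum, $(f^{\rm in}_1,f^{\rm in}_2)$ has the smallest distance to the line $z_2=\frac{1-q}{q}z_1$. **Convex hull wave.** Let $v_L\in\tilde f(u_L)$ and $v_R\in\tilde f(u_R)$. Let $\Gamma$ be the part of the graph of $\tilde f$ over the densities between $u_L$ and $u_R$, with only the flux value $v_L$ kept over $u_L$ and only $v_R$ kept over $u_R$. The wave from $(u_L,v_L)$ to $(u_R,v_R)$ takes at speed $\xi=x/t$ a value $(u,v)\in\Gamma$ that lies on the supporting line of slope $\xi$ of the convex hull of $\Gamma$, from below if $u_L\le u_R$ and from above if $u_R\le u_L$. **Theorem.** An admissible weak solution exists, and any two coincide ($u$ and $v$) almost everywhere. Moreover, it has the following properties. 1. Let $f_{\max}=\min\{D(u^{\rm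 in}_{1,0})+D(u^{\rm in}_{2,0}),\,S(u^{\rm out}_{1,0})\}$, $P=(qf_{\max},(1-q)f_{\max})$ and $\Omega=\{z\in[0,D(u^{\rm in}_{1,0})]\times[0,D(u^{\rm in}_{2,0})]: z_1+z_2\le f_{\max}\}$. Then $f^{\rm in}_1+f^{\rm in}_2=f^{\rm out}_1=f_{\max}$. If $P\in\Omega$, then $(f^{\rm in}_1,f^{\rm in}_2)=P$; otherwise $(f^{\rm in}_1,f^{\rm in}_2)$ is a point of $\Omega\cap\{z_1+z_2=f_{\max}\}$ closest to the line $z_2=\frac{1-q}{q}z_1$. 2. The traces $u^{\rm in}_i=u^{\rm in}_i(0-,t)$ and $u^{\rm out}_1=u^{\rm out}_1(0+,t)$ exist, do not depend on $t$, and satisfy $$u_i^{\rm in}\in\begin{cases}\{u_{i,0}^{\rm in}\}\cup(\eta(u_{i,0}^{\rm in}),u_{\max}],&u_{i,0}^{\rm in}\in[0,f^{-1}(u^*+)],\\ \{u_{i,0}^{\rm in}\}\cup[u^*,u_{\max}],&u_{i,0}^{\rm in}\in(f^{-1}(u^*+),u^*),\\ [u^*,u_{\max}],&u_{i,0}^{\rm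 in}\in[u^*,u_{\max}],\end{cases}$$ $$u_1^{\rm out}\in\begin{cases}[0,u^*],&u_{1,0}^{\rm out}\in[0,u^*),\\ [0,u^*],&u_{1,0}^{\rm out}=u^*\text{ and free flowing},\\ \{u^*\}\cup[0,f^{-1}(u^*+)),&u_{1,0}^{\rm out}=u^*\text{ and congested},\\ \{u_{1,0}^{\rm out}\}\cup[0,\eta(u_{1,0}^{\rm out})),&u_{1,0}^{\rm out}\in(u^*,u_{\max}].\end{cases}$$ 3. On incoming road $i$ the solution is a.e. the convex hull wave from $(u^{\rm in}_{i,0},v_0)$, for some $v_0\in\tilde f(u^{\rm in}_{i,0})$, to $(u^{\rm in}_i,f^{\rm in}_i)$. This wave takes only the value $(u^{\rm in}_i,f^{\rm in}_i)$ at speeds $\xi\ge0$, so it moves with negative speed. On the outgoing road the solution is a.e. the convex hull wave from $(u^{\rm out}_1,f^{\rm out}_1)$ to $(u^{\rm out}_{1,0},v_1)$, where $v_1=f(u^{\rm out}_{1,0})$ if $u^{\rm out}_{1,0}\ne u^*$ and $v_1=S(u^*)$ otherwise. This wave takes only the value $(u^{\rm out}_1,f^{\rm out}_1)$ at speeds $\xi\le0$,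 so it moves with positive speed. -/

import Mathlib

open Set Filter Topology MeasureTheory

noncomputable section

namespace JunctionFlux

/-- A flux on `[0, umax]` with one decreasing jump at `ustar`: it equals `f1` on `[0, ustar]` and
`f2` on `(ustar, umax]`; the one-sided values at the jump are `f(ustar-) = f1 ustar` and
`f(ustar+) = f2 ustar`. Both branches are concave; strictly concave and affine branches
are allowed. -/
structure DiscFlux where
  umax : ℝ
  ustar : ℝ
  f1 : ℝ → ℝ
  f2 : ℝ → ℝ
  ustar_pos : 0 < ustar
  ustar_lt : ustar < umax
  f1_smooth : ContDiffOn ℝ 2 f1 (Icc 0 ustar)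
  f2_smooth : ContDiffOn ℝ 2 f2 (Ioc ustar umax)
  f2_cont : ContinuousOn f2 (Icc ustar umax)
  f1_zero : f1 0 = 0
  f2_umax : f2 umax = 0
  jump : f2 ustar < f1 ustar
  f1_deriv : ∀ u ∈ Ioo 0 ustar, 0 < deriv f1 u
  f2_deriv : ∀ u ∈ Ioo ustar umax, deriv f2 u < 0
  f1_deriv2 : ∀ u ∈ Ioo 0 ustar, deriv (deriv f1) u ≤ 0
  f2_deriv2 : ∀ u ∈ Ioo ustar umax, deriv (deriv f2) u ≤ 0

/-- State of the traffic ahead of the outgoing road; it is only relevant for the density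
`ustar`. -/
inductive TrafficState where
  | free
  | congested

namespace DiscFlux

variable (F : DiscFlux)

/-- The flux function, with the convention `f(ustar) = f(ustar-)`. -/
def f (u : ℝ) : ℝ := if u ≤ F.ustar then F.f1 u else F.f2 u

/-- The graph of the multivalued flux: all `(u, v)` with `u ∈ [0, umax]`, and `v = f(u)` for
`u ≠ ustar`, `v ∈ [f(ustar+), f(ustar-)]` for `u = ustar`. -/
def graph : Set (ℝ × ℝ) :=
  {p | p.1 ∈ Icc 0 F.umax ∧ (p.1 ≠ F.ustar → p.2 = F.f p.1) ∧
    (p.1 = F.ustar → p.2 ∈ Icc (F.f2 F.ustar) (F.f1 F.ustar))}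

/-- The flux value selected at `ustar` by the state of the traffic ahead. -/
def critFlux : TrafficState → ℝ
  | .free => F.f1 F.ustar
  | .congested => F.f2 F.ustar

/-- Demand. -/
def demand (u : ℝ) : ℝ := if u < F.ustar then F.f u else F.f1 F.ustar

/-- Supply. -/
def supply (s : TrafficState) (u : ℝ) : ℝ :=
  if u < F.ustar then F.f1 F.ustar else if u = F.ustar then F.critFlux s else F.f u

/-- The flux value attached to the datum of the outgoing road. -/
def datumFlux (s : TrafficState) (u : ℝ) : ℝ := if u = F.ustar then F.critFlux s else F.f u

/-- The density `f⁻¹(ustar+)` of the increasing branch at which the flux is `f(ustar+)`. -/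
def low : ℝ := Function.invFunOn F.f1 (Icc 0 F.ustar) (F.f2 F.ustar)

/-- The companion density `η(u)`: the density on the other branch with the same flux if there is
one, and `ustar` for `u` strictly between `f⁻¹(ustar+)` and `ustar`. -/
def eta (u : ℝ) : ℝ :=
  if u ≤ F.low then Function.invFunOn F.f2 (Icc F.ustar F.umax) (F.f1 u)
  else if u < F.ustar then F.ustar
  else Function.invFunOn F.f1 (Icc 0 F.ustar) (F.f2 u)

open Classical in
/-- Possible junction densities on an incoming road with initial density `u`. -/
def inSet (u : ℝ) : Set ℝ :=
  if u ≤ F.low then {u} ∪ Ioc (F.eta u) F.umax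
  else if u < F.ustar then {u} ∪ Icc F.ustar F.umax
  else Icc F.ustar F.umax

/-- Possible junction densities on an outgoing road with initial density `ustar`. -/
def outSetCrit : TrafficState → Set ℝ
  | .free => Icc 0 F.ustar
  | .congested => {F.ustar} ∪ Ico 0 F.low

open Classical in
/-- Possible junction densities on the outgoing road with initial density `u`. -/
def outSet (s : TrafficState) (u : ℝ) : Set ℝ :=
  if u < F.ustar then Icc 0 F.ustar
  else if u = F.ustar then F.outSetCrit s
  else {u} ∪ Ico 0 (F.eta u)

/-- The part of the graph lying over the densities between two states `L = (u_L, v_L)` and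
`R = (u_R, v_R)`; over the end densities only the prescribed flux values are kept. -/
def waveGraph (L R : ℝ × ℝ) : Set (ℝ × ℝ) :=
  {p | p ∈ F.graph ∧ p.1 ∈ uIcc L.1 R.1 ∧ (p.1 = L.1 → p = L) ∧ (p.1 = R.1 → p = R)}

/-- Convex hull construction: the Riemann solution with left state `L` and right state `R` takes
at speed `ξ = x / t` a value `p = (u, v)` at which the graph meets the supporting line of slope
`ξ` of the convex hull of its part between the two states: the supporting line below the hull if
`u_L ≤ u_R` (lower boundary of the hull), the one above it if `u_R ≤ u_L` (upper boundary). -/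
def IsHullValue (L R : ℝ × ℝ) (ξ : ℝ) (p : ℝ × ℝ) : Prop :=
  p ∈ F.waveGraph L R ∧
  (L.1 ≤ R.1 → ∀ g ∈ convexHull ℝ (F.waveGraph L R), p.2 - ξ * p.1 ≤ g.2 - ξ * g.1) ∧
  (R.1 ≤ L.1 → ∀ g ∈ convexHull ℝ (F.waveGraph L R), g.2 - ξ * g.1 ≤ p.2 - ξ * p.1)

/-- Conditions on the density `u(x, t)` and the flux `v(x, t)` on a road occupying the half-line
`I`, apart from the conservation law itself: self-similarity, spatial bounded variation of `u`,
`v` is a selection of the multivalued flux at `u`, and Kruzhkov's entropy inequalities. -/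
structure RoadAdmissible (I : Set ℝ) (u v : ℝ → ℝ → ℝ) : Prop where
  u_meas : AEStronglyMeasurable (fun p : ℝ × ℝ => u p.1 p.2) (volume.restrict (I ×ˢ Ioi (0 : ℝ)))
  v_meas : AEStronglyMeasurable (fun p : ℝ × ℝ => v p.1 p.2) (volume.restrict (I ×ˢ Ioi (0 : ℝ)))
  selfSimilar : ∀ x ∈ I, ∀ t > 0, ∀ c > 0,
    u (c * x) (c * t) = u x t ∧ v (c * x) (c * t) = v x t
  bv : ∀ t > 0, BoundedVariationOn (fun x => u x t) I
  selection : ∀ᵐ p ∂(volume.restrict (I ×ˢ Ioi (0 : ℝ))), (u p.1 p.2, v p.1 p.2) ∈ F.graph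
  entropy : ∀ k ∈ Icc 0 F.umax, k ≠ F.ustar → ∀ φ : ℝ × ℝ → ℝ, ContDiff ℝ 1 φ →
    HasCompactSupport φ → tsupport φ ⊆ I ×ˢ Ioi (0 : ℝ) → (∀ p, 0 ≤ φ p) →
    0 ≤ ∫ p in I ×ˢ Ioi (0 : ℝ),
      (|u p.1 p.2 - k| * deriv (fun t => φ (p.1, t)) p.2
        + Real.sign (u p.1 p.2 - k) * (v p.1 p.2 - F.f k) * deriv (fun x => φ (x, p.2)) p.1)

end DiscFlux

/-- Densities and fluxes, as functions of `(x, t)`, on the two incoming roads `(-∞, 0)` and on the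
outgoing road `(0, ∞)`; the junction is at `x = 0`. -/
structure NetworkFunction where
  uin : Fin 2 → ℝ → ℝ → ℝ
  vin : Fin 2 → ℝ → ℝ → ℝ
  uout : ℝ → ℝ → ℝ
  vout : ℝ → ℝ → ℝ

/-- The contribution of one road, occupying `I`, to the weak formulation with constant initial
datum `u0`, for the test function `φ`. -/
def roadWeakTerm (I : Set ℝ) (u v : ℝ → ℝ → ℝ) (u0 : ℝ) (φ : ℝ × ℝ → ℝ) : ℝ :=
  (∫ p in I ×ˢ Ioi (0 : ℝ),
    (u p.1 p.2 * deriv (fun t => φ (p.1, t)) p.2 + v p.1 p.2 * deriv (fun x => φ (x, p.2)) p.1))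
  + ∫ x in I, u0 * φ (x, 0)

/-- Weak solution at the junction: the sum of the road contributions vanishes for all collections
of `C¹` test functions with compact support that match to first order at the junction. -/
def IsWeakSolution (uin0 : Fin 2 → ℝ) (uout0 : ℝ) (w : NetworkFunction) : Prop :=
  ∀ (φ : Fin 2 → ℝ × ℝ → ℝ) (ψ : ℝ × ℝ → ℝ),
    (∀ i, ContDiff ℝ 1 (φ i) ∧ HasCompactSupport (φ i)) → ContDiff ℝ 1 ψ → HasCompactSupport ψ →
    (∀ i t, φ i (0, t) = ψ (0, t) ∧
      deriv (fun x => φ i (x, t)) 0 = deriv (fun x => ψ (x, t)) 0) →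
    (∑ i, roadWeakTerm (Iio 0) (w.uin i) (w.vin i) (uin0 i) (φ i))
      + roadWeakTerm (Ioi 0) w.uout w.vout uout0 ψ = 0

/-- `z i` is the flux through the junction end of the `i`-th incoming road. -/
def HasInflow (w : NetworkFunction) (z : Fin 2 → ℝ) : Prop :=
  ∀ i, ∀ t > 0, Tendsto (fun x => w.vin i x t) (𝓝[<] 0) (𝓝 (z i))

/-- `y` is the flux through the junction end of the outgoing road. -/
def HasOutflow (w : NetworkFunction) (y : ℝ) : Prop :=
  ∀ t > 0, Tendsto (fun x => w.vout x t) (𝓝[>] 0) (𝓝 y)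

/-- Self-similar entropy weak solutions of the junction Riemann problem for which all vehicles
that arrive at the junction enter the outgoing road. If the outgoing datum is `ustar`, the state of
the traffic ahead prescribes the flux far downstream. -/
structure IsJunctionSolution (F : DiscFlux) (uin0 : Fin 2 → ℝ) (uout0 : ℝ) (s : TrafficState)
    (w : NetworkFunction) : Prop where
  incoming : ∀ i, F.RoadAdmissible (Iio 0) (w.uin i) (w.vin i)
  outgoing : F.RoadAdmissible (Ioi 0) w.uout w.vout
  weak : IsWeakSolution uin0 uout0 w
  ahead : uout0 = F.ustar → ∀ t > 0, Tendsto (fun x => w.vout x t) atTop (𝓝 (F.critFlux s))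
  balance : ∃ z : Fin 2 → ℝ, HasInflow w z ∧ HasOutflow w (∑ i, z i)

/-- Euclidean distance of `(z 0, z 1)` from the priority line `z₂ = ((1 - q) / q) z₁`. -/
def priorityDist (q : ℝ) (z : Fin 2 → ℝ) : ℝ :=
  |(1 - q) * z 0 - q * z 1| / √(q ^ 2 + (1 - q) ^ 2)

/-- Admissible weak solutions: the total inflow is maximal among all junction solutions with the
same data, and among those with maximal total inflow the inflows are closest to the priority
line. -/
def IsAdmissible (F : DiscFlux) (q : ℝ) (uin0 : Fin 2 → ℝ) (uout0 : ℝ) (s : TrafficState)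
    (w : NetworkFunction) : Prop :=
  IsJunctionSolution F uin0 uout0 s w ∧ ∃ z, HasInflow w z ∧
    ∀ w' z', IsJunctionSolution F uin0 uout0 s w' → HasInflow w' z' →
      ∑ i, z' i ≤ ∑ i, z i ∧ (∑ i, z' i = ∑ i, z i → priorityDist q z ≤ priorityDist q z')

/-- Equality almost everywhere on the roads. -/
def AEEqual (w w' : NetworkFunction) : Prop :=
  (∀ i, ∀ᵐ p ∂(volume.restrict (Iio (0 : ℝ) ×ˢ Ioi (0 : ℝ))),
    w.uin i p.1 p.2 = w'.uin i p.1 p.2 ∧ w.vin i p.1 p.2 = w'.vin i p.1 p.2) ∧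
  ∀ᵐ p ∂(volume.restrict (Ioi (0 : ℝ) ×ˢ Ioi (0 : ℝ))),
    w.uout p.1 p.2 = w'.uout p.1 p.2 ∧ w.vout p.1 p.2 = w'.vout p.1 p.2

/-- The maximal possible flux `min {D(u₁) + D(u₂), S(u_out)}` through the junction. -/
def maxFlux (F : DiscFlux) (uin0 : Fin 2 → ℝ) (uout0 : ℝ) (s : TrafficState) : ℝ :=
  min (∑ i, F.demand (uin0 i)) (F.supply s uout0)

/-- The feasible inflows. -/
def feasible (F : DiscFlux) (uin0 : Fin 2 → ℝ) (uout0 : ℝ) (s : TrafficState) :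
    Set (Fin 2 → ℝ) :=
  {z | (∀ i, z i ∈ Icc 0 (F.demand (uin0 i))) ∧ ∑ i, z i ≤ maxFlux F uin0 uout0 s}

/-- The point of the priority line with total flux `maxFlux`. -/
def priorityPoint (F : DiscFlux) (q : ℝ) (uin0 : Fin 2 → ℝ) (uout0 : ℝ) (s : TrafficState) :
    Fin 2 → ℝ :=
  ![q * maxFlux F uin0 uout0 s, (1 - q) * maxFlux F uin0 uout0 s]

/-- The inflows prescribed by the priority rule: the priority point if it is feasible, otherwise
the feasible point with maximal total flux closest to the priority line. -/
def IsPriorityInflow (F : DiscFlux) (q : ℝ) (uin0 : Fin 2 → ℝ) (uout0 : ℝ) (s : TrafficState)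
    (z : Fin 2 → ℝ) : Prop :=
  (priorityPoint F q uin0 uout0 s ∈ feasible F uin0 uout0 s →
    z = priorityPoint F q uin0 uout0 s) ∧
  (priorityPoint F q uin0 uout0 s ∉ feasible F uin0 uout0 s →
    z ∈ feasible F uin0 uout0 s ∧ ∑ i, z i = maxFlux F uin0 uout0 s ∧
    ∀ z' ∈ feasible F uin0 uout0 s, ∑ i, z' i = maxFlux F uin0 uout0 s →
      priorityDist q z ≤ priorityDist q z')

/-- The incoming road carries the convex hull wave from the datum `u0` to the junction state
`J = (u, v)`; all its speeds are negative, so the full Riemann solution is in the state `J` at every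
speed `ξ ≥ 0`. -/
def IncomingWave (F : DiscFlux) (u0 : ℝ) (J : ℝ × ℝ) (u v : ℝ → ℝ → ℝ) : Prop :=
  (∀ t > 0, Tendsto (fun x => u x t) (𝓝[<] 0) (𝓝 J.1)) ∧
  ∃ v0, (u0, v0) ∈ F.graph ∧
    (∀ᵐ p ∂(volume.restrict (Iio (0 : ℝ) ×ˢ Ioi (0 : ℝ))),
      F.IsHullValue (u0, v0) J (p.1 / p.2) (u p.1 p.2, v p.1 p.2)) ∧
    ∀ ξ ≥ 0, ∀ p, F.IsHullValue (u0, v0) J ξ p ↔ p = J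

/-- The outgoing road carries the convex hull wave from the junction state `J = (u, v)` to the
datum `u0`; all its speeds are positive, so the full Riemann solution is in the state `J` at every
speed `ξ ≤ 0`. -/
def OutgoingWave (F : DiscFlux) (s : TrafficState) (u0 : ℝ) (J : ℝ × ℝ) (u v : ℝ → ℝ → ℝ) :
    Prop :=
  (∀ t > 0, Tendsto (fun x => u x t) (𝓝[>] 0) (𝓝 J.1)) ∧
  (∀ᵐ p ∂(volume.restrict (Ioi (0 : ℝ) ×ˢ Ioi (0 : ℝ))),
    F.IsHullValue J (u0, F.datumFlux s u0) (p.1 / p.2) (u p.1 p.2, v p.1 p.2)) ∧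
  ∀ ξ ≤ 0, ∀ p, F.IsHullValue J (u0, F.datumFlux s u0) ξ p ↔ p = J

end JunctionFlux

end

noncomputable section

namespace JunctionFlux

/-! In the variable ξ = x/t a road solution becomes a pair (U, V) on a half-line. Put W = V - ξU.
The conservation law says W' = -U, and Kruzhkov's inequality says that, for k ≠ ustar, the signed
gap sgn(U - k)(W - (f(k) - ξk)) is nonincreasing off a null set (`RoadAdmissible.exists_profile`).
The gap W - (f(k) - ξk) is continuous with derivative k - U, and it keeps its sign as long as its
modulus stays away from zero. This prevents U from crossing a level upwards and returning
(`IsProfile.not_up_down`); reflection excludes the opposite pattern, so U is monotone.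

If U increases, W lies below p.2 - ξ p.1 for every graph point p between the end states
(`IsWave.le_of_mem_between`), while (U, V) attains W. So W(ξ) is the minimum of v - ξu over that
part of the graph: the solution is the convex hull wave (`IsWave.isHullPoint`) and its end states
determine it (`IsWave.unique`). The decreasing case follows from the point reflection (u, v) ↦ (-u,
-v); the class `IsJumpGraph` is closed under it, the graphs of the given fluxes are not.

Since a wave occupies only one half-line of speeds, the junction state is a strict extremum of the
flux among the graph points between it and the datum (`InState`, `OutState`). The graph rises
strictly, drops vertically and then falls strictly. From this shape come the sets of possible
densities, the bounds by demand and supply, and the fact that the junction flux determines the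
junction density. Hence the inflows determine the whole solution (`IsJunctionSolution.aeEqual`).

Conversely, minimizing v - ξu over a compact piece of the graph, for every ξ, produces an entropy
solution on a road (`IsMinSelection.roadAdmissible`) whose boundary term is the junction flux. Thus
`feasible` is exactly the set of inflows of junction solutions
(`IsJunctionSolution.inflow_mem_feasible`, `exists_junctionSolution`). Admissibility becomes a
finite-dimensional problem: on the segment of maximal total flux the distance to the priority line
is a multiple of |z 0 - q m|, with m the total, and the unique minimizer is a clamp
(`isAdmissible_iff`). -/

/-! ### Graphs with one jump and self-similar entropy profiles -/

/-- A compact multivalued graph over `[a, b]`, single-valued (with values `f`) off the point `c`, and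
whose values at `c` lie between the right limit and the left limit of `f`. -/
structure IsJumpGraph (G : Set (ℝ × ℝ)) (f : ℝ → ℝ) (c a b : ℝ) : Prop where
  isCompact : IsCompact G
  mem_Icc : ∀ p ∈ G, p.1 ∈ Icc a b
  eq_of_ne : ∀ p ∈ G, p.1 ≠ c → p.2 = f p.1
  mem_of_ne : ∀ k ∈ Icc a b, k ≠ c → (k, f k) ∈ G
  exists_right : ∀ p ∈ G, p.1 = c → ∃ l ≤ p.2, Tendsto f (𝓝[>] c) (𝓝 l)
  exists_left : ∀ p ∈ G, p.1 = c → ∃ l ≥ p.2, Tendsto f (𝓝[<] c) (𝓝 l)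

/-- Reflection exchanges left and right limits and reverses the order of the fluxes, so the two
conditions at the jump trade places. Results on increasing profiles pass to decreasing ones through
this. -/
theorem IsJumpGraph.neg {G : Set (ℝ × ℝ)} {f : ℝ → ℝ} {c a b : ℝ} (h : IsJumpGraph G f c a b) :
    IsJumpGraph {p | -p ∈ G} (fun k => -f (-k)) (-c) (-b) (-a) where
  isCompact := by
    have := h.isCompact.neg
    exact this
  mem_Icc p hp := by
    have := h.mem_Icc _ hp
    simp only [Prod.fst_neg] at this ⊢
    constructor <;> linarith [this.1, this.2]
  eq_of_ne p hp hc := by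
    have := h.eq_of_ne _ hp (fun h => hc (by simp at h; linarith))
    simp only [Prod.fst_neg, Prod.snd_neg] at this
    linarith
  mem_of_ne k hk hc := by
    have := h.mem_of_ne (-k) ⟨by linarith [hk.2], by linarith [hk.1]⟩ (fun h => hc (by linarith))
    simpa using this
  exists_right p hp hc := by
    obtain ⟨l, hl, ht⟩ := h.exists_left _ hp (by simp [hc])
    refine ⟨-l, by simp at hl; linarith, ?_⟩
    refine (ht.comp ?_).neg
    have := (tendsto_neg_nhdsGT (a := -c))
    simpa using this
  exists_left p hp hc := by
    obtain ⟨l, hl, ht⟩ := h.exists_right _ hp (by simp [hc])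
    refine ⟨-l, by simp at hl; linarith, ?_⟩
    refine (ht.comp ?_).neg
    have := (tendsto_neg_nhdsLT (a := -c))
    simpa using this

/-- The data of a self-similar entropy solution in the variable `ξ = x / t ∈ I`: `S` is a set of
full measure of good points, and `W = V - ξ U` satisfies `W' = -U`. -/
structure IsProfile (G : Set (ℝ × ℝ)) (f : ℝ → ℝ) (c a b : ℝ) (I S : Set ℝ) (U V W : ℝ → ℝ) :
    Prop where
  graph : IsJumpGraph G f c a b
  isOpen : IsOpen I
  ordConnected : I.OrdConnected
  subset : S ⊆ I
  null : volume (I \ S) = 0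
  continuousAt : ∀ ξ ∈ S, ContinuousAt U ξ
  intervalIntegrable : ∀ ξ ∈ I, ∀ η ∈ I, IntervalIntegrable U volume ξ η
  continuousOn : ContinuousOn W I
  mem : ∀ ξ ∈ S, (U ξ, V ξ) ∈ G
  eq : ∀ ξ ∈ S, V ξ - ξ * U ξ = W ξ
  integral : ∀ ξ ∈ I, ∀ η ∈ I, W η - W ξ = -∫ s in ξ..η, U s
  entropy : ∀ k ∈ Icc a b, k ≠ c → ∃ T ⊆ S, volume (I \ T) = 0 ∧
    AntitoneOn (fun ξ => Real.sign (U ξ - k) * (W ξ - (f k - ξ * k))) T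

theorem exists_mem_of_null {I T : Set ℝ} (hT : volume (I \ T) = 0) {N : Set ℝ} (hN : IsOpen N)
    (hne : (N ∩ I).Nonempty) (hI : IsOpen I) : ∃ s ∈ T, s ∈ N := by
  by_contra! hcon
  have hsub : N ∩ I ⊆ I \ T := fun s hs => ⟨hs.2, fun h => hcon s h hs.1⟩
  have := (hN.inter hI).measure_pos volume hne
  exact absurd (measure_mono_null hsub hT) this.ne'

namespace IsProfile

variable {G : Set (ℝ × ℝ)} {f : ℝ → ℝ} {c a b : ℝ} {I S : Set ℝ} {U V W : ℝ → ℝ}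

/-- The speed ξ is unchanged, and in the entropy product the sign changes of the two factors cancel.
-/
theorem neg (h : IsProfile G f c a b I S U V W) :
    IsProfile {p | -p ∈ G} (fun k => -f (-k)) (-c) (-b) (-a) I S (fun ξ => -U ξ) (fun ξ => -V ξ)
      (fun ξ => -W ξ) where
  graph := h.graph.neg
  isOpen := h.isOpen
  ordConnected := h.ordConnected
  subset := h.subset
  null := h.null
  continuousAt ξ hξ := (h.continuousAt ξ hξ).neg
  intervalIntegrable ξ hξ η hη := (h.intervalIntegrable ξ hξ η hη).neg
  continuousOn := h.continuousOn.neg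
  mem ξ hξ := by simpa using h.mem ξ hξ
  eq ξ hξ := by rw [← h.eq ξ hξ]; ring
  integral ξ hξ η hη := by
    rw [intervalIntegral.integral_neg]; linarith [h.integral ξ hξ η hη]
  entropy k hk hc := by
    obtain ⟨T, hTS, hT, hA⟩ := h.entropy (-k) ⟨by linarith [hk.2], by linarith [hk.1]⟩
      (fun h => hc (by linarith))
    refine ⟨T, hTS, hT, ?_⟩
    convert hA using 2 with ξ
    rw [show -U ξ - k = -(U ξ - -k) by ring, Real.sign_neg]
    ring

variable (h : IsProfile G f c a b I S U V W)
include h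

/-- The sign vanishes only where U = k. The graph is single-valued over k ≠ c, so the gap vanishes
there too. -/
theorem abs_eq {k : ℝ} (hc : k ≠ c) {ξ : ℝ} (hξ : ξ ∈ S) :
    |Real.sign (U ξ - k) * (W ξ - (f k - ξ * k))| = |W ξ - (f k - ξ * k)| := by
  rcases lt_trichotomy (U ξ - k) 0 with h0 | h0 | h0
  · rw [Real.sign_of_neg h0, neg_one_mul, abs_neg]
  · have hU : U ξ = k := by linarith
    have hV : V ξ = f k := by
      have := h.graph.eq_of_ne _ (h.mem ξ hξ) (by simpa [hU] using hc)
      simpa [hU] using this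
    have := h.eq ξ hξ
    rw [hU, hV] at this
    rw [← this]; simp
  · rw [Real.sign_of_pos h0]; simp

theorem continuousOn_gap (k : ℝ) : ContinuousOn (fun ξ => W ξ - (f k - ξ * k)) I :=
  h.continuousOn.sub (by fun_prop)

/-- The gap function keeps its sign as long as its modulus is bounded below almost everywhere. -/
theorem gap_mul_pos {k : ℝ} {T : Set ℝ} (hTS : T ⊆ S) (hT : volume (I \ T) = 0) {ζ η : ℝ}
    (hζ : ζ ∈ T) (hη : η ∈ T) (hlt : ζ < η) {m : ℝ} (hm : 0 < m)
    (hmT : ∀ s ∈ T, s ∈ Icc ζ η → m ≤ |W s - (f k - s * k)|) :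
    0 < (W ζ - (f k - ζ * k)) * (W η - (f k - η * k)) := by
  have hIcc : Icc ζ η ⊆ I := h.ordConnected.out (h.subset (hTS hζ)) (h.subset (hTS hη))
  have hne : ∀ s ∈ Icc ζ η, W s - (f k - s * k) ≠ 0 := by
    intro s hs h0
    rcases eq_or_lt_of_le hs.1 with he | h1
    · have := hmT ζ hζ ⟨le_rfl, hlt.le⟩
      rw [he, h0] at this; simp at this; linarith
    rcases eq_or_lt_of_le hs.2 with he | h2
    · have := hmT η hη ⟨hlt.le, le_rfl⟩
      rw [← he, h0] at this; simp at this; linarith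
    have hcont : ContinuousAt (fun ξ => W ξ - (f k - ξ * k)) s :=
      (h.continuousOn_gap k).continuousAt (h.isOpen.mem_nhds (hIcc hs))
    -- A zero of the continuous gap would make the modulus smaller than m on an open set, which
    -- contains points of T.
    have hev : ∀ᶠ x in 𝓝 s, |W x - (f k - x * k)| < m := by
      have := hcont.abs
      refine this.eventually (gt_mem_nhds ?_)
      simpa [h0] using hm
    have hev2 := hev.and (Ioo_mem_nhds h1 h2)
    obtain ⟨N, hN, hNo, hsN⟩ := eventually_nhds_iff.1 hev2
    obtain ⟨x, hxT, hxN⟩ := exists_mem_of_null hT hNo ⟨s, hsN, hIcc hs⟩ h.isOpen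
    have := hmT x hxT (Ioo_subset_Icc_self (hN x hxN).2)
    linarith [(hN x hxN).1]
  by_contra! hle
  have hcon := (h.continuousOn_gap k).mono hIcc
  have h0 : (0 : ℝ) ∈ uIcc (W ζ - (f k - ζ * k)) (W η - (f k - η * k)) := by
    rw [mem_uIcc]
    by_contra! hcon
    rcases lt_or_ge 0 (W ζ - (f k - ζ * k)) with h1 | h1
    · rcases lt_or_ge 0 (W η - (f k - η * k)) with h2 | h2
      · nlinarith
      · exact absurd (hcon.2 h2) (not_lt.2 h1.le)
    · rcases lt_or_ge 0 (W η - (f k - η * k)) with h2 | h2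
      · exact absurd (hcon.1 h1) (not_lt.2 h2.le)
      · have h3 := hne ζ ⟨le_rfl, hlt.le⟩
        have h4 := hne η ⟨hlt.le, le_rfl⟩
        have h5 := lt_of_le_of_ne h1 h3
        have h6 := lt_of_le_of_ne h2 h4
        nlinarith
  rw [← uIcc_of_le hlt.le] at hcon
  obtain ⟨s, hs, hs0⟩ := intermediate_value_uIcc hcon h0
  rw [uIcc_of_le hlt.le] at hs
  exact hne s hs hs0

/-- The signed gap is nonincreasing, so to the right of a negative value it stays at least as
negative, which bounds the modulus of the gap away from zero. `gap_mul_pos_of_pos` is the mirror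
statement to the left of a positive value. -/
theorem gap_mul_pos_of_neg {k : ℝ} (hc : k ≠ c) {T : Set ℝ} (hTS : T ⊆ S)
    (hT : volume (I \ T) = 0)
    (hA : AntitoneOn (fun ξ => Real.sign (U ξ - k) * (W ξ - (f k - ξ * k))) T) {ζ η : ℝ}
    (hζ : ζ ∈ T) (hη : η ∈ T) (hlt : ζ < η)
    (hneg : Real.sign (U ζ - k) * (W ζ - (f k - ζ * k)) < 0) :
    0 < (W ζ - (f k - ζ * k)) * (W η - (f k - η * k)) := by
  refine h.gap_mul_pos hTS hT hζ hη hlt (neg_pos.2 hneg) fun s hs hs' => ?_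
  rw [← h.abs_eq hc (hTS hs)]
  have := hA hζ hs hs'.1
  simp only at this
  rw [abs_of_neg (this.trans_lt hneg)]
  linarith

theorem gap_mul_pos_of_pos {k : ℝ} (hc : k ≠ c) {T : Set ℝ} (hTS : T ⊆ S)
    (hT : volume (I \ T) = 0)
    (hA : AntitoneOn (fun ξ => Real.sign (U ξ - k) * (W ξ - (f k - ξ * k))) T) {ζ η : ℝ}
    (hζ : ζ ∈ T) (hη : η ∈ T) (hlt : ζ < η)
    (hpos : 0 < Real.sign (U η - k) * (W η - (f k - η * k))) :
    0 < (W ζ - (f k - ζ * k)) * (W η - (f k - η * k)) := by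
  refine h.gap_mul_pos hTS hT hζ hη hlt hpos fun s hs hs' => ?_
  rw [← h.abs_eq hc (hTS hs)]
  have := hA hs hη hs'.2
  simp only at this
  rw [abs_of_pos (hpos.trans_le this)]
  exact this

omit h in
theorem _root_.JunctionFlux.exists_ne_between {x y : ℝ} (hxy : x < y) (hx : x ∈ Icc a b)
    (hy : y ∈ Icc a b) : ∃ k ∈ Icc a b, k ≠ c ∧ x < k ∧ k < y := by
  obtain ⟨k, hk, hk'⟩ := exists_between hxy
  by_cases hkc : k = c
  · obtain ⟨k', h1, h2⟩ := exists_between hk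
    exact ⟨k', ⟨by linarith [hx.1], by linarith [hy.2]⟩, by rw [← hkc]; exact h2.ne, h1, by linarith⟩
  · exact ⟨k, ⟨by linarith [hx.1], by linarith [hy.2]⟩, hkc, hk, hk'⟩

theorem exists_mem_Ioo {T : Set ℝ} (hT : volume (I \ T) = 0) {u v : ℝ} (hu : u ∈ I) (hv : v ∈ I)
    (huv : u < v) : ∃ s ∈ T, u < s ∧ s < v := by
  obtain ⟨w, hw⟩ := exists_between huv
  exact exists_mem_of_null hT isOpen_Ioo
    ⟨w, hw, h.ordConnected.out hu hv ⟨hw.1.le, hw.2.le⟩⟩ h.isOpen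

theorem exists_mem_near {T : Set ℝ} (hT : volume (I \ T) = 0) {N : Set ℝ} (hN : IsOpen N) {s : ℝ}
    (hs : s ∈ S) (hsN : U s ∈ N) {u v : ℝ} (hu : u < s) (hv : s < v) :
    ∃ s' ∈ T, u < s' ∧ s' < v ∧ U s' ∈ N := by
  have hev := ((h.continuousAt s hs).eventually (hN.mem_nhds hsN)).and (Ioo_mem_nhds hu hv)
  obtain ⟨N', hN', hNo, hsN'⟩ := eventually_nhds_iff.1 hev
  obtain ⟨s', hs', hs''⟩ := exists_mem_of_null hT hNo ⟨s, hsN', h.subset hs⟩ h.isOpen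
  exact ⟨s', hs', (hN' _ hs'').2.1, (hN' _ hs'').2.2, (hN' _ hs'').1⟩

theorem fst_mem_Icc {s : ℝ} (hs : s ∈ S) : U s ∈ Icc a b := h.graph.mem_Icc _ (h.mem s hs)

/-- Take a level k below U y and above the other two values. The gap decreases strictly across y, so
it is positive just before y or negative just after. It keeps that sign back to x, respectively on
to z, where U is below k; the signed gap would then have increased. -/
theorem not_up_down {x y z : ℝ} (hx : x ∈ S) (hy : y ∈ S) (hz : z ∈ S) (hxy : x < y) (hyz : y < z)
    (h1 : U x < U y) (h2 : U z < U y) : False := by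
  obtain ⟨k, hkab, hkc, hk1, hk2⟩ := exists_ne_between (c := c) (max_lt h1 h2)
    (by rcases max_choice (U x) (U z) with e | e <;> rw [e]; exacts [h.fst_mem_Icc hx, h.fst_mem_Icc hz])
    (h.fst_mem_Icc hy)
  obtain ⟨hkx, hkz⟩ := max_lt_iff.1 hk1
  obtain ⟨T, hTS, hT, hA⟩ := h.entropy k hkab hkc
  obtain ⟨l, r, hlr, hsub⟩ := mem_nhds_iff_exists_Ioo_subset.1
    ((h.continuousAt y hy).eventually (lt_mem_nhds hk2))
  have hIxz : Icc x z ⊆ I := h.ordConnected.out (h.subset hx) (h.subset hz)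
  have hyI := h.subset hy
  -- The points y' < y < y'' lie in the full-measure set and so close to y that U > k between them.
  obtain ⟨y', hy'T, hy1, hy2⟩ := h.exists_mem_Ioo hT
    (hIxz ⟨le_max_right l x, (max_lt hlr.1 hxy).le.trans hyz.le⟩) hyI (max_lt hlr.1 hxy)
  obtain ⟨y'', hy''T, hy3, hy4⟩ := h.exists_mem_Ioo hT hyI
    (hIxz ⟨hxy.le.trans (lt_min hlr.2 hyz).le, min_le_right r z⟩) (lt_min hlr.2 hyz)
  obtain ⟨hly', hxy'⟩ := max_lt_iff.1 hy1
  obtain ⟨hy''r, hy''z⟩ := lt_min_iff.1 hy4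
  obtain ⟨x', hx'T, -, hx'y, hUx'⟩ := h.exists_mem_near hT isOpen_Iio hx hkx (sub_one_lt x) hxy'
  obtain ⟨z', hz'T, hzy, -, hUz'⟩ := h.exists_mem_near hT isOpen_Iio hz hkz hy''z (lt_add_one z)
  have hlt : y' < y'' := hy2.trans hy3
  have hbig : ∀ s ∈ Icc y' y'', k < U s := fun s hs =>
    hsub ⟨by linarith [hs.1], by linarith [hs.2]⟩
  have hy'I := h.subset (hTS hy'T)
  have hy''I := h.subset (hTS hy''T)
  -- The gap has derivative k - U, which is negative here.
  have hgap : W y'' - (f k - y'' * k) < W y' - (f k - y' * k) := by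
    have h3 := h.integral y' hy'I y'' hy''I
    have h4 : 0 < ∫ s in y'..y'', (U s - k) := by
      refine intervalIntegral.intervalIntegral_pos_of_pos_on
        ((h.intervalIntegrable _ hy'I _ hy''I).sub intervalIntegrable_const) ?_ hlt
      intro s hs
      have := hbig s (Ioo_subset_Icc_self hs)
      linarith
    rw [intervalIntegral.integral_sub (h.intervalIntegrable _ hy'I _ hy''I)
      intervalIntegrable_const] at h4
    simp only [intervalIntegral.integral_const, smul_eq_mul] at h4
    linarith
  have s1 : Real.sign (U y' - k) = 1 := Real.sign_of_pos (by linarith [hbig y' ⟨le_rfl, hlt.le⟩])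
  have s2 : Real.sign (U y'' - k) = 1 := Real.sign_of_pos (by linarith [hbig y'' ⟨hlt.le, le_rfl⟩])
  have s3 : Real.sign (U x' - k) = -1 := Real.sign_of_neg (by simp at hUx'; linarith)
  have s4 : Real.sign (U z' - k) = -1 := Real.sign_of_neg (by simp at hUz'; linarith)
  rcases lt_or_ge 0 (W y' - (f k - y' * k)) with hp | hp
  · have h5 := h.gap_mul_pos_of_pos hkc hTS hT hA hx'T hy'T hx'y (by rw [s1]; linarith)
    have h6 := hA hx'T hy'T hx'y.le
    simp only [s1, s3] at h6
    nlinarith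
  · have h5 := h.gap_mul_pos_of_neg hkc hTS hT hA hy''T hz'T hzy (by rw [s2]; linarith)
    have h6 := hA hy''T hz'T hzy.le
    simp only [s2, s4] at h6
    nlinarith

/-- A down-up pattern is an up-down pattern of the reflected profile. -/
theorem monotoneOn_or_antitoneOn : MonotoneOn U S ∨ AntitoneOn U S := by
  by_contra! hcon
  obtain ⟨x, hx, y, hy, z, hz, hxy, hyz, h1 | h1⟩ :=
    not_monotoneOn_not_antitoneOn_iff_exists_lt_lt.1 hcon
  · exact h.not_up_down hx hy hz hxy hyz h1.1 h1.2
  · exact h.neg.not_up_down hx hy hz hxy hyz (neg_lt_neg h1.1) (neg_lt_neg h1.2)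

/-- Suppose the gap is positive at ζ. If U ζ < k, the signed gap is negative and the gap stays
positive up to a point on the right where U > k; if U ζ > k, go instead to a point on the left where
U < k. Either way the signed gap increases from left to right. -/
theorem le_of_between (hm : MonotoneOn U S) {k : ℝ} (hk : k ∈ Icc a b) (hc : k ≠ c) {x y : ℝ}
    (hx : x ∈ S) (hy : y ∈ S) (hxk : U x < k) (hky : k < U y) {ξ : ℝ} (hξ : ξ ∈ I) :
    W ξ ≤ f k - ξ * k := by
  obtain ⟨T, hTS, hT, hA⟩ := h.entropy k hk hc
  have hxy : x < y := by
    by_contra! hle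
    linarith [hm hy hx hle]
  obtain ⟨x', hx'T, -, -, hUx'⟩ :=
    h.exists_mem_near hT isOpen_Iio hx hxk (sub_one_lt x) (lt_add_one x)
  obtain ⟨y', hy'T, -, -, hUy'⟩ :=
    h.exists_mem_near hT isOpen_Ioi hy hky (sub_one_lt y) (lt_add_one y)
  simp only [mem_Iio, mem_Ioi] at hUx' hUy'
  have key : ∀ ζ ∈ T, W ζ - (f k - ζ * k) ≤ 0 := by
    intro ζ hζ
    by_contra! hpos
    rcases lt_trichotomy (U ζ - k) 0 with h0 | h0 | h0
    · have hlt : ζ < y' := by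
        by_contra! hle
        linarith [hm (hTS hy'T) (hTS hζ) hle]
      have h5 := h.gap_mul_pos_of_neg hc hTS hT hA hζ hy'T hlt
        (by rw [Real.sign_of_neg h0]; linarith)
      have h6 := hA hζ hy'T hlt.le
      simp only [Real.sign_of_neg h0, Real.sign_of_pos (sub_pos.2 hUy')] at h6
      nlinarith
    · have := h.abs_eq hc (hTS hζ)
      rw [h0, Real.sign_zero, zero_mul, abs_zero] at this
      exact hpos.ne' (abs_eq_zero.1 this.symm)
    · have hlt : x' < ζ := by
        by_contra! hle
        linarith [hm (hTS hζ) (hTS hx'T) hle]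
      have h5 := h.gap_mul_pos_of_pos hc hTS hT hA hx'T hζ hlt
        (by rw [Real.sign_of_pos h0]; linarith)
      have h6 := hA hx'T hζ hlt.le
      simp only [Real.sign_of_pos h0, Real.sign_of_neg (sub_neg.2 hUx')] at h6
      nlinarith
  by_contra! hgt
  -- By continuity of the gap, the bound on the full-measure set T extends to all of I.
  have hev := ((h.continuousOn_gap k).continuousAt (h.isOpen.mem_nhds hξ)).eventually
    (lt_mem_nhds (a := 0) (by linarith))
  obtain ⟨N', hN', hNo, hsN'⟩ := eventually_nhds_iff.1 hev
  obtain ⟨s', hs', hs''⟩ := exists_mem_of_null hT hNo ⟨ξ, hsN', hξ⟩ h.isOpen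
  linarith [hN' _ hs'', key _ hs']

theorem integral_ge {ξ η : ℝ} (hξ : ξ ∈ I) (hη : η ∈ I) (hle : ξ ≤ η) {m : ℝ}
    (hm : ∀ s ∈ S, s ∈ Ioo ξ η → m ≤ U s) : (η - ξ) * m ≤ ∫ s in ξ..η, U s := by
  have h1 : (η - ξ) * m = ∫ s in ξ..η, m := by simp
  rw [h1]
  refine intervalIntegral.integral_mono_ae_restrict hle intervalIntegrable_const
    (h.intervalIntegrable ξ hξ η hη) ?_
  have hIcc : Icc ξ η ⊆ I := h.ordConnected.out hξ hη
  rw [← restrict_Ioo_eq_restrict_Icc]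
  rw [EventuallyLE, ae_restrict_iff' measurableSet_Ioo]
  have : ∀ᵐ s, s ∉ I \ S := measure_eq_zero_iff_ae_notMem.1 h.null
  filter_upwards [this] with s hs hs'
  refine hm s ?_ hs'
  by_contra hcon
  exact hs ⟨hIcc (Ioo_subset_Icc_self hs'), hcon⟩

/-- The lines through the points of a monotone profile support `W` from above. -/
theorem le_support (hm : MonotoneOn U S) {ξ η : ℝ} (hξ : ξ ∈ I) (hη : η ∈ S) :
    W ξ ≤ V η - ξ * U η := by
  have hηI := h.subset hη
  have he := h.eq η hη
  have hi := h.integral ξ hξ η hηI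
  rcases le_total ξ η with hle | hle
  · have := h.neg.integral_ge hξ hηI hle (m := -U η) fun s hs hs' =>
      neg_le_neg (hm hs hη hs'.2.le)
    rw [intervalIntegral.integral_neg] at this
    linarith
  · have := h.integral_ge hηI hξ hle (m := U η) fun s hs hs' => hm hη hs hs'.1.le
    rw [intervalIntegral.integral_symm] at hi
    linarith

end IsProfile

/-! ### Points on supporting lines of the convex hull -/

/-- The part of `G` between the states `L` and `R`. -/
def between (G : Set (ℝ × ℝ)) (L R : ℝ × ℝ) : Set (ℝ × ℝ) :=
  {p | p ∈ G ∧ p.1 ∈ uIcc L.1 R.1 ∧ (p.1 = L.1 → p = L) ∧ (p.1 = R.1 → p = R)}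

/-- The points of `between G L R` on the supporting line of slope `ξ`. -/
def IsHullPoint (G : Set (ℝ × ℝ)) (L R : ℝ × ℝ) (ξ : ℝ) (p : ℝ × ℝ) : Prop :=
  p ∈ between G L R ∧
  (L.1 ≤ R.1 → ∀ g ∈ convexHull ℝ (between G L R), p.2 - ξ * p.1 ≤ g.2 - ξ * g.1) ∧
  (R.1 ≤ L.1 → ∀ g ∈ convexHull ℝ (between G L R), g.2 - ξ * g.1 ≤ p.2 - ξ * p.1)

theorem mem_between_neg {G : Set (ℝ × ℝ)} {L R p : ℝ × ℝ} :
    -p ∈ between {p | -p ∈ G} (-L) (-R) ↔ p ∈ between G L R := by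
  simp only [between, mem_ofPred_eq, neg_neg, Prod.fst_neg, neg_inj, mem_uIcc]
  refine and_congr_right fun _ => and_congr_left fun _ => ?_
  constructor <;> rintro (h | h)
  · exact Or.inr ⟨by linarith [h.2], by linarith [h.1]⟩
  · exact Or.inl ⟨by linarith [h.2], by linarith [h.1]⟩
  · exact Or.inr ⟨by linarith [h.2], by linarith [h.1]⟩
  · exact Or.inl ⟨by linarith [h.2], by linarith [h.1]⟩

theorem le_of_mem_convexHull {A : Set (ℝ × ℝ)} {m ξ : ℝ} (hA : ∀ g ∈ A, m ≤ g.2 - ξ * g.1)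
    {g : ℝ × ℝ} (hg : g ∈ convexHull ℝ A) : m ≤ g.2 - ξ * g.1 := by
  have hc : Convex ℝ {g : ℝ × ℝ | m ≤ g.2 - ξ * g.1} := by
    intro x hx y hy s t hs ht hst
    simp only [mem_ofPred_eq, Prod.fst_add, Prod.snd_add, Prod.smul_fst, Prod.smul_snd,
      smul_eq_mul] at *
    have := add_le_add (mul_le_mul_of_nonneg_left hx hs) (mul_le_mul_of_nonneg_left hy ht)
    rw [← add_mul, hst, one_mul] at this
    linarith
  exact convexHull_min hA hc hg

theorem ge_of_mem_convexHull {A : Set (ℝ × ℝ)} {m ξ : ℝ} (hA : ∀ g ∈ A, g.2 - ξ * g.1 ≤ m)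
    {g : ℝ × ℝ} (hg : g ∈ convexHull ℝ A) : g.2 - ξ * g.1 ≤ m := by
  have hc : Convex ℝ {g : ℝ × ℝ | g.2 - ξ * g.1 ≤ m} := by
    intro x hx y hy s t hs ht hst
    simp only [mem_ofPred_eq, Prod.fst_add, Prod.snd_add, Prod.smul_fst, Prod.smul_snd,
      smul_eq_mul] at *
    have := add_le_add (mul_le_mul_of_nonneg_left hx hs) (mul_le_mul_of_nonneg_left hy ht)
    rw [← add_mul, hst, one_mul] at this
    linarith
  exact convexHull_min hA hc hg

/-- Half-planes are convex, so a linear bound on a set and on its convex hull are the same; from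
here on the hull disappears. -/
theorem isHullPoint_iff {G : Set (ℝ × ℝ)} {L R p : ℝ × ℝ} {ξ : ℝ} :
    IsHullPoint G L R ξ p ↔ p ∈ between G L R ∧
      (L.1 ≤ R.1 → ∀ g ∈ between G L R, p.2 - ξ * p.1 ≤ g.2 - ξ * g.1) ∧
      (R.1 ≤ L.1 → ∀ g ∈ between G L R, g.2 - ξ * g.1 ≤ p.2 - ξ * p.1) := by
  refine and_congr_right fun _ => and_congr (forall_congr' fun _ => ?_) (forall_congr' fun _ => ?_)
  · exact ⟨fun h g hg => h g (subset_convexHull ℝ _ hg), fun h g hg => le_of_mem_convexHull h hg⟩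
  · exact ⟨fun h g hg => h g (subset_convexHull ℝ _ hg), fun h g hg => ge_of_mem_convexHull h hg⟩

/-- Reflection exchanges supporting lines from below and from above. -/
theorem isHullPoint_neg {G : Set (ℝ × ℝ)} {L R p : ℝ × ℝ} {ξ : ℝ} :
    IsHullPoint {p | -p ∈ G} (-L) (-R) ξ (-p) ↔ IsHullPoint G L R ξ p := by
  have key : ∀ P : ℝ × ℝ → Prop, (∀ g ∈ between {p | -p ∈ G} (-L) (-R), P g) ↔
      ∀ g ∈ between G L R, P (-g) := fun P =>
    ⟨fun h g hg => h _ (mem_between_neg.2 hg), fun h g hg => by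
      have := h (-g) (mem_between_neg.1 (by rwa [neg_neg]))
      rwa [neg_neg] at this⟩
  rw [isHullPoint_iff, isHullPoint_iff, mem_between_neg, key, key]
  simp only [Prod.fst_neg, Prod.snd_neg, neg_le_neg_iff]
  refine and_congr_right fun _ => ?_
  rw [and_comm]
  refine and_congr (forall_congr' fun _ => forall₂_congr fun g _ => ?_)
    (forall_congr' fun _ => forall₂_congr fun g _ => ?_)
  · constructor <;> intro h <;> linarith
  · constructor <;> intro h <;> linarith

/-! ### Waves with given end states -/

/-- A profile together with its states `L` and `R` at the left and right end of `I`. -/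
structure IsWave (G : Set (ℝ × ℝ)) (f : ℝ → ℝ) (c a b : ℝ) (I S : Set ℝ) (U V W : ℝ → ℝ)
    (L R : ℝ × ℝ) : Prop extends IsProfile G f c a b I S U V W where
  -- Filters instead of limits: only the density is known to have bounded variation, so the flux may
  -- converge only along a finer filter.
  left_end : ∃ l : Filter ℝ, l.NeBot ∧ l ≤ 𝓟 S ∧ (∀ ξ ∈ S, ∀ᶠ η in l, η < ξ) ∧
    Tendsto (fun η => (U η, V η)) l (𝓝 L)
  right_end : ∃ l : Filter ℝ, l.NeBot ∧ l ≤ 𝓟 S ∧ (∀ ξ ∈ S, ∀ᶠ η in l, ξ < η) ∧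
    Tendsto (fun η => (U η, V η)) l (𝓝 R)

namespace IsWave

variable {G : Set (ℝ × ℝ)} {f : ℝ → ℝ} {c a b : ℝ} {I S : Set ℝ} {U V W : ℝ → ℝ} {L R : ℝ × ℝ}

theorem neg (h : IsWave G f c a b I S U V W L R) :
    IsWave {p | -p ∈ G} (fun k => -f (-k)) (-c) (-b) (-a) I S (fun ξ => -U ξ) (fun ξ => -V ξ)
      (fun ξ => -W ξ) (-L) (-R) where
  toIsProfile := h.toIsProfile.neg
  left_end := by
    obtain ⟨l, h1, h2, h3, h4⟩ := h.left_end
    exact ⟨l, h1, h2, h3, h4.neg⟩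
  right_end := by
    obtain ⟨l, h1, h2, h3, h4⟩ := h.right_end
    exact ⟨l, h1, h2, h3, h4.neg⟩

variable (h : IsWave G f c a b I S U V W L R)
include h

theorem left_mem : L ∈ G := by
  obtain ⟨l, h1, h2, h3, h4⟩ := h.left_end
  exact h.graph.isCompact.isClosed.mem_of_tendsto h4
    (eventually_of_mem (h2 (mem_principal_self S)) fun η hη => h.mem η hη)

theorem right_mem : R ∈ G := by
  obtain ⟨l, h1, h2, h3, h4⟩ := h.right_end
  exact h.graph.isCompact.isClosed.mem_of_tendsto h4
    (eventually_of_mem (h2 (mem_principal_self S)) fun η hη => h.mem η hη)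

theorem left_le (hm : MonotoneOn U S) {ξ : ℝ} (hξ : ξ ∈ S) : L.1 ≤ U ξ := by
  obtain ⟨l, h1, h2, h3, h4⟩ := h.left_end
  refine le_of_tendsto ((continuous_fst.tendsto _).comp h4) ?_
  filter_upwards [h2 (mem_principal_self S), h3 ξ hξ] with η hη hlt
  exact hm hη hξ hlt.le

theorem le_right (hm : MonotoneOn U S) {ξ : ℝ} (hξ : ξ ∈ S) : U ξ ≤ R.1 := by
  obtain ⟨l, h1, h2, h3, h4⟩ := h.right_end
  refine ge_of_tendsto ((continuous_fst.tendsto _).comp h4) ?_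
  filter_upwards [h2 (mem_principal_self S), h3 ξ hξ] with η hη hlt
  exact hm hξ hη hlt.le

theorem nonempty : S.Nonempty := by
  obtain ⟨l, h1, h2, -, -⟩ := h.left_end
  exact h1.nonempty_of_mem (h2 (mem_principal_self S))

theorem left_le_right (hm : MonotoneOn U S) : L.1 ≤ R.1 := by
  obtain ⟨ξ, hξ⟩ := h.nonempty
  exact (h.left_le hm hξ).trans (h.le_right hm hξ)

theorem exists_lt {k : ℝ} (hk : L.1 < k) : ∃ ξ ∈ S, U ξ < k := by
  obtain ⟨l, h1, h2, h3, h4⟩ := h.left_end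
  have := (((continuous_fst.tendsto _).comp h4).eventually (gt_mem_nhds hk)).and
    (h2 (mem_principal_self S))
  obtain ⟨ξ, hξ, hξS⟩ := this.exists
  exact ⟨ξ, hξS, hξ⟩

theorem exists_gt {k : ℝ} (hk : k < R.1) : ∃ ξ ∈ S, k < U ξ := by
  obtain ⟨l, h1, h2, h3, h4⟩ := h.right_end
  have := (((continuous_fst.tendsto _).comp h4).eventually (lt_mem_nhds hk)).and
    (h2 (mem_principal_self S))
  obtain ⟨ξ, hξ, hξS⟩ := this.exists
  exact ⟨ξ, hξS, hξ⟩

theorem le_left_state (hm : MonotoneOn U S) {ξ : ℝ} (hξ : ξ ∈ I) : W ξ ≤ L.2 - ξ * L.1 := by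
  obtain ⟨l, h1, h2, h3, h4⟩ := h.left_end
  refine ge_of_tendsto (((continuous_snd.tendsto _).comp h4).sub
    (((continuous_fst.tendsto _).comp h4).const_mul ξ)) ?_
  filter_upwards [h2 (mem_principal_self S)] with η hη
  exact h.le_support hm hξ hη

theorem le_right_state (hm : MonotoneOn U S) {ξ : ℝ} (hξ : ξ ∈ I) : W ξ ≤ R.2 - ξ * R.1 := by
  obtain ⟨l, h1, h2, h3, h4⟩ := h.right_end
  refine ge_of_tendsto (((continuous_snd.tendsto _).comp h4).sub
    (((continuous_fst.tendsto _).comp h4).const_mul ξ)) ?_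
  filter_upwards [h2 (mem_principal_self S)] with η hη
  exact h.le_support hm hξ hη

/-- For k ≠ c strictly between the end densities this is `le_of_between`. At the jump every flux is
at least the right limit of f, so k may decrease to c. Hence over the left end density any flux of
the graph is allowed, which matters for uniqueness. -/
theorem le_of_mem_graph (hm : MonotoneOn U S) {p : ℝ × ℝ} (hp : p ∈ G) (hL : L.1 ≤ p.1)
    (hR : p.1 < R.1) {ξ : ℝ} (hξ : ξ ∈ I) : W ξ ≤ p.2 - ξ * p.1 := by
  have hkey : ∀ k, L.1 < k → k < R.1 → k ≠ c → W ξ ≤ f k - ξ * k := by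
    intro k h1 h2 hc
    obtain ⟨x, hx, hxk⟩ := h.exists_lt h1
    obtain ⟨y, hy, hyk⟩ := h.exists_gt h2
    exact h.le_of_between hm ⟨(h.fst_mem_Icc hx).1.trans hxk.le, hyk.le.trans (h.fst_mem_Icc hy).2⟩
      hc hx hy hxk hyk hξ
  by_cases hc : p.1 = c
  · obtain ⟨l, hl, ht⟩ := h.graph.exists_right p hp hc
    have : W ξ ≤ l - ξ * p.1 := by
      refine ge_of_tendsto (ht.sub ((tendsto_nhdsWithin_of_tendsto_nhds tendsto_id).const_mul ξ)) ?_
        |>.trans_eq (by rw [hc])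
      filter_upwards [Ioo_mem_nhdsGT (hc ▸ hR : c < R.1)] with k hk
      exact hkey k (by linarith [hk.1]) hk.2 hk.1.ne'
    linarith
  · have hpf := h.graph.eq_of_ne p hp hc
    rcases eq_or_lt_of_le hL with he | hlt
    · have hLf := h.graph.eq_of_ne L h.left_mem (he ▸ hc)
      have := h.le_left_state hm hξ
      rw [hLf, he, ← hpf] at this
      exact this
    · rw [hpf]
      exact hkey _ hlt hR hc

theorem le_of_mem_between (hm : MonotoneOn U S) {p : ℝ × ℝ} (hp : p ∈ between G L R) {ξ : ℝ}
    (hξ : ξ ∈ I) : W ξ ≤ p.2 - ξ * p.1 := by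
  obtain ⟨hpG, hI, -, hR⟩ := hp
  rw [uIcc_of_le (h.left_le_right hm)] at hI
  rcases eq_or_lt_of_le hI.2 with he | hlt
  · rw [hR he]
    exact h.le_right_state hm hξ
  · exact h.le_of_mem_graph hm hpG hI.1 hlt hξ

/-- Once U equals an end density it is constant up to that end; comparing supporting lines in both
directions then forces V to be the end flux. -/
theorem mem_between (hm : MonotoneOn U S) {ξ : ℝ} (hξ : ξ ∈ S) : (U ξ, V ξ) ∈ between G L R := by
  refine ⟨h.mem ξ hξ, ?_, fun he => ?_, fun he => ?_⟩
  · rw [uIcc_of_le (h.left_le_right hm)]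
    exact ⟨h.left_le hm hξ, h.le_right hm hξ⟩
  · refine Prod.ext he (le_antisymm ?_ ?_)
    · have := h.le_left_state hm (h.subset hξ)
      rw [← h.eq ξ hξ] at this
      simp only at he ⊢
      rw [he] at this
      linarith
    · obtain ⟨l, h1, h2, h3, h4⟩ := h.left_end
      refine le_of_tendsto ((continuous_snd.tendsto _).comp h4) ?_
      filter_upwards [h2 (mem_principal_self S), h3 ξ hξ] with η hη hlt
      have h5 : U η = U ξ := le_antisymm (hm hη hξ hlt.le) (by
        simp only at he; rw [he]; exact h.left_le hm hη)
      have := h.le_support hm (h.subset hη) hξ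
      rw [← h.eq η hη, h5] at this
      simp only [Function.comp_apply]
      linarith
  · refine Prod.ext he (le_antisymm ?_ ?_)
    · have := h.le_right_state hm (h.subset hξ)
      rw [← h.eq ξ hξ] at this
      simp only at he ⊢
      rw [he] at this
      linarith
    · obtain ⟨l, h1, h2, h3, h4⟩ := h.right_end
      refine le_of_tendsto ((continuous_snd.tendsto _).comp h4) ?_
      filter_upwards [h2 (mem_principal_self S), h3 ξ hξ] with η hη hlt
      have h5 : U η = U ξ := le_antisymm (by
        simp only at he; rw [he]; exact h.le_right hm hη) (hm hξ hη hlt.le)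
      have := h.le_support hm (h.subset hη) hξ
      rw [← h.eq η hη, h5] at this
      simp only [Function.comp_apply]
      linarith

theorem eq_of_fst_eq_of_monotoneOn (hm : MonotoneOn U S) (he : L.1 = R.1) : L = R := by
  obtain ⟨ξ, hξ⟩ := h.nonempty
  have h1 := h.mem_between hm hξ
  have h2 : U ξ = L.1 := le_antisymm (he ▸ h.le_right hm hξ) (h.left_le hm hξ)
  exact (h1.2.2.1 h2).symm.trans (h1.2.2.2 (h2.trans he))

theorem eq_of_fst_eq (he : L.1 = R.1) : L = R := by
  rcases h.monotoneOn_or_antitoneOn with hm | hm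
  · exact h.eq_of_fst_eq_of_monotoneOn hm he
  · exact neg_injective (h.neg.eq_of_fst_eq_of_monotoneOn hm.neg (by simp [he]))

theorem isHullPoint_of_monotoneOn (hm : MonotoneOn U S) {ξ : ℝ} (hξ : ξ ∈ S) :
    IsHullPoint G L R ξ (U ξ, V ξ) := by
  have hmem := h.mem_between hm hξ
  refine isHullPoint_iff.2 ⟨hmem, fun _ g hg => ?_, fun hRL g hg => ?_⟩
  · simp only [h.eq ξ hξ]
    exact h.le_of_mem_between hm hg (h.subset hξ)
  · have he := le_antisymm (h.left_le_right hm) hRL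
    have key : ∀ q ∈ between G L R, q = L := fun q hq => hq.2.2.1 (by
      have := hq.2.1
      rw [he, uIcc_self] at this
      rw [he]; exact this)
    rw [key g hg, key _ hmem]

/-- A self-similar entropy solution is a convex hull wave. -/
theorem isHullPoint {ξ : ℝ} (hξ : ξ ∈ S) : IsHullPoint G L R ξ (U ξ, V ξ) := by
  rcases h.monotoneOn_or_antitoneOn with hm | hm
  · exact h.isHullPoint_of_monotoneOn hm hξ
  · exact isHullPoint_neg.1 (h.neg.isHullPoint_of_monotoneOn hm.neg hξ)

/-- The support inequality at slope η reads W η ≤ V ξ - η U ξ; let η tend to 0. -/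
theorem snd_le_of_end (hm : MonotoneOn U S) {J : ℝ × ℝ} {l : Filter ℝ} [l.NeBot] (hl : l ≤ 𝓟 S)
    (h0 : Tendsto id l (𝓝 (0 : ℝ))) (hJ : Tendsto (fun η => (U η, V η)) l (𝓝 J)) {ξ : ℝ}
    (hξ : ξ ∈ S) : J.2 ≤ V ξ := by
  have h1 : Tendsto (fun η => V η - η * U η) l (𝓝 (J.2 - 0 * J.1)) :=
    ((continuous_snd.tendsto _).comp hJ).sub (h0.mul ((continuous_fst.tendsto _).comp hJ))
  have h2 : Tendsto (fun η => V ξ - η * U ξ) l (𝓝 (V ξ - 0 * U ξ)) :=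
    tendsto_const_nhds.sub (h0.mul_const _)
  have := le_of_tendsto_of_tendsto h1 h2 (by
    filter_upwards [hl (mem_principal_self S)] with η hη
    rw [h.eq η hη]
    exact h.le_support hm (h.subset hη) hξ)
  linarith

end IsWave

/-! ### Junction states -/

/-- `J` is a possible junction state of an incoming road with datum `u0`: all speeds of the wave
from `u0` to `J` are negative. -/
def InState (G : Set (ℝ × ℝ)) (u0 : ℝ) (J : ℝ × ℝ) : Prop :=
  J ∈ G ∧ ((u0 ≤ J.1 ∧ ∀ p ∈ G, u0 ≤ p.1 → p.1 < J.1 → J.2 < p.2) ∨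
    (J.1 ≤ u0 ∧ ∀ p ∈ G, p.1 ≤ u0 → J.1 < p.1 → p.2 < J.2))

/-- `J` is a possible junction state of an outgoing road with datum `R`: all speeds of the wave
from `J` to `R` are positive. -/
def OutState (G : Set (ℝ × ℝ)) (R J : ℝ × ℝ) : Prop :=
  J ∈ G ∧ R ∈ G ∧ (J.1 = R.1 → J = R) ∧
  ((J.1 ≤ R.1 ∧ ∀ p ∈ G, J.1 < p.1 → (p.1 < R.1 ∨ p = R) → J.2 < p.2) ∨
    (R.1 ≤ J.1 ∧ ∀ p ∈ G, p.1 < J.1 → (R.1 < p.1 ∨ p = R) → p.2 < J.2))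

namespace IsWave

variable {G : Set (ℝ × ℝ)} {f : ℝ → ℝ} {c a b : ℝ} {I S : Set ℝ} {U V W : ℝ → ℝ} {L R : ℝ × ℝ}

/-- At a speed η < 0 with U η > p.1 the hull inequality gives p.2 ≥ V η - η (U η - p.1) > V η, and V
η is at least the junction flux. -/
theorem inState_of_monotoneOn (h : IsWave G f c a b (Iio 0) S U V W L R) (hm : MonotoneOn U S)
    {l : Filter ℝ} [l.NeBot] (hl : l ≤ 𝓟 S) (h0 : Tendsto id l (𝓝 (0 : ℝ)))
    (hJ : Tendsto (fun η => (U η, V η)) l (𝓝 R)) {p : ℝ × ℝ} (hp : p ∈ G) (hpL : L.1 ≤ p.1)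
    (hpR : p.1 < R.1) : R.2 < p.2 := by
  obtain ⟨η, hη, hlt⟩ := h.exists_gt hpR
  have h1 := h.snd_le_of_end hm hl h0 hJ hη
  have hη0 : η < 0 := h.subset hη
  have h2 := h.le_of_mem_graph hm hp hpL hpR (h.subset hη)
  rw [← h.eq η hη] at h2
  nlinarith

theorem inState (h : IsWave G f c a b (Iio 0) S U V W L R)
    {l : Filter ℝ} [l.NeBot] (hl : l ≤ 𝓟 S) (h0 : Tendsto id l (𝓝 (0 : ℝ)))
    (hJ : Tendsto (fun η => (U η, V η)) l (𝓝 R)) : InState G L.1 R := by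
  refine ⟨h.right_mem, ?_⟩
  rcases h.monotoneOn_or_antitoneOn with hm | hm
  · exact Or.inl ⟨h.left_le_right hm, fun p hp => h.inState_of_monotoneOn hm hl h0 hJ hp⟩
  · refine Or.inr ⟨by simpa using h.neg.left_le_right hm.neg, fun p hp hpL hpR => ?_⟩
    simpa using h.neg.inState_of_monotoneOn hm.neg hl h0 hJ.neg (p := -p) (by simpa using hp)
      (by simpa using hpL) (by simpa using hpR)

/-- The mirror argument uses η > 0 with U η < p.1. Over the density of R only R itself is
controlled, hence the form of the hypothesis on p. -/
theorem outState_of_monotoneOn (h : IsWave G f c a b (Ioi 0) S U V W L R) (hm : MonotoneOn U S)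
    {l : Filter ℝ} [l.NeBot] (hl : l ≤ 𝓟 S) (h0 : Tendsto id l (𝓝 (0 : ℝ)))
    (hJ : Tendsto (fun η => (U η, V η)) l (𝓝 L)) {p : ℝ × ℝ} (hp : p ∈ G) (hpL : L.1 < p.1)
    (hpR : p.1 < R.1 ∨ p = R) : L.2 < p.2 := by
  obtain ⟨η, hη, hlt⟩ := h.exists_lt hpL
  have h1 := h.snd_le_of_end hm hl h0 hJ hη
  have hη0 : 0 < η := h.subset hη
  have h2 : W η ≤ p.2 - η * p.1 := by
    rcases hpR with hpR | rfl
    · exact h.le_of_mem_graph hm hp hpL.le hpR (h.subset hη)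
    · exact h.le_right_state hm (h.subset hη)
  rw [← h.eq η hη] at h2
  nlinarith

theorem outState (h : IsWave G f c a b (Ioi 0) S U V W L R)
    {l : Filter ℝ} [l.NeBot] (hl : l ≤ 𝓟 S) (h0 : Tendsto id l (𝓝 (0 : ℝ)))
    (hJ : Tendsto (fun η => (U η, V η)) l (𝓝 L)) : OutState G R L := by
  refine ⟨h.left_mem, h.right_mem, h.eq_of_fst_eq, ?_⟩
  rcases h.monotoneOn_or_antitoneOn with hm | hm
  · exact Or.inl ⟨h.left_le_right hm, fun p hp => h.outState_of_monotoneOn hm hl h0 hJ hp⟩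
  · refine Or.inr ⟨by simpa using h.neg.left_le_right hm.neg, fun p hp hpL hpR => ?_⟩
    simpa using h.neg.outState_of_monotoneOn hm.neg hl h0 hJ.neg (p := -p) (by simpa using hp)
      (by simpa using hpL) (by simpa using hpR)

end IsWave

/-- J is already the strict extremum of v over the part of the graph in question, and for ξ ≥ 0 the
term -ξu favours J as well. -/
theorem InState.isHullPoint_iff {G : Set (ℝ × ℝ)} {L J : ℝ × ℝ} (h : InState G L.1 J)
    (he : L.1 = J.1 → L = J) {ξ : ℝ} (hξ : 0 ≤ ξ) (p : ℝ × ℝ) :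
    IsHullPoint G L J ξ p ↔ p = J := by
  have hJ : J ∈ between G L J := ⟨h.1, right_mem_uIcc, fun h => (he h.symm).symm, fun _ => rfl⟩
  rw [JunctionFlux.isHullPoint_iff]
  constructor
  · rintro ⟨hp, h1, h2⟩
    by_contra hne
    rcases h.2 with ⟨hle, hs⟩ | ⟨hle, hs⟩
    · have h3 := hp.2.1
      rw [uIcc_of_le hle] at h3
      have h4 : p.1 < J.1 := lt_of_le_of_ne h3.2 fun h => hne (hp.2.2.2 h)
      have h5 := hs p hp.1 h3.1 h4
      have h6 := h1 hle J hJ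
      nlinarith
    · have h3 := hp.2.1
      rw [uIcc_of_ge hle] at h3
      have h4 : J.1 < p.1 := lt_of_le_of_ne h3.1 fun h => hne (hp.2.2.2 h.symm)
      have h5 := hs p hp.1 h3.2 h4
      have h6 := h2 hle J hJ
      nlinarith
  · rintro rfl
    refine ⟨hJ, fun hle g hg => ?_, fun hle g hg => ?_⟩
    · by_cases hg1 : g.1 = p.1
      · rw [hg.2.2.2 hg1]
      have h3 := hg.2.1
      rw [uIcc_of_le hle] at h3
      have h4 : g.1 < p.1 := lt_of_le_of_ne h3.2 hg1
      rcases h.2 with ⟨-, hs⟩ | ⟨hle', -⟩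
      · have h5 := hs g hg.1 h3.1 h4
        nlinarith
      · exact absurd (le_antisymm hle hle') (by intro h; linarith [h3.1])
    · by_cases hg1 : g.1 = p.1
      · rw [hg.2.2.2 hg1]
      have h3 := hg.2.1
      rw [uIcc_of_ge hle] at h3
      have h4 : p.1 < g.1 := lt_of_le_of_ne h3.1 (Ne.symm hg1)
      rcases h.2 with ⟨hle', -⟩ | ⟨-, hs⟩
      · exact absurd (le_antisymm hle' hle) (by intro h; linarith [h3.2])
      · have h5 := hs g hg.1 h3.2 h4
        nlinarith

theorem OutState.isHullPoint_iff {G : Set (ℝ × ℝ)} {R J : ℝ × ℝ} (h : OutState G R J) {ξ : ℝ}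
    (hξ : ξ ≤ 0) (p : ℝ × ℝ) : IsHullPoint G J R ξ p ↔ p = J := by
  obtain ⟨hJG, hRG, he, hs'⟩ := h
  have hJ : J ∈ between G J R := ⟨hJG, left_mem_uIcc, fun _ => rfl, he⟩
  have hor : ∀ g ∈ between G J R, g.1 ≠ J.1 → (J.1 ≤ R.1 → J.1 < g.1 ∧ (g.1 < R.1 ∨ g = R)) ∧
      (R.1 ≤ J.1 → g.1 < J.1 ∧ (R.1 < g.1 ∨ g = R)) := by
    intro g hg hg1
    have h3 := hg.2.1
    constructor <;> intro hle
    · rw [uIcc_of_le hle] at h3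
      refine ⟨lt_of_le_of_ne h3.1 (Ne.symm hg1), ?_⟩
      rcases eq_or_lt_of_le h3.2 with h4 | h4
      exacts [Or.inr (hg.2.2.2 h4), Or.inl h4]
    · rw [uIcc_of_ge hle] at h3
      refine ⟨lt_of_le_of_ne h3.2 hg1, ?_⟩
      rcases eq_or_lt_of_le h3.1 with h4 | h4
      exacts [Or.inr (hg.2.2.2 h4.symm), Or.inl h4]
  rw [JunctionFlux.isHullPoint_iff]
  constructor
  · rintro ⟨hp, h1, h2⟩
    by_contra hne
    have h3 := hor p hp fun h => hne (hp.2.2.1 h)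
    rcases hs' with ⟨hle, hs⟩ | ⟨hle, hs⟩
    · obtain ⟨h4, h5⟩ := h3.1 hle
      have h6 := hs p hp.1 h4 h5
      have h7 := h1 hle J hJ
      nlinarith
    · obtain ⟨h4, h5⟩ := h3.2 hle
      have h6 := hs p hp.1 h4 h5
      have h7 := h2 hle J hJ
      nlinarith
  · rintro rfl
    refine ⟨hJ, fun hle g hg => ?_, fun hle g hg => ?_⟩
    · by_cases hg1 : g.1 = p.1
      · rw [hg.2.2.1 hg1]
      obtain ⟨h4, h5⟩ := (hor g hg hg1).1 hle
      rcases hs' with ⟨-, hs⟩ | ⟨hle', hs⟩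
      · have h6 := hs g hg.1 h4 h5
        nlinarith
      · obtain ⟨h6, -⟩ := (hor g hg hg1).2 hle'
        linarith
    · by_cases hg1 : g.1 = p.1
      · rw [hg.2.2.1 hg1]
      obtain ⟨h4, h5⟩ := (hor g hg hg1).2 hle
      rcases hs' with ⟨hle', hs⟩ | ⟨-, hs⟩
      · obtain ⟨h6, -⟩ := (hor g hg hg1).1 hle'
        linarith
      · have h6 := hs g hg.1 h4 h5
        nlinarith

/-! ### Uniqueness of waves -/

namespace IsWave

variable {G : Set (ℝ × ℝ)} {f : ℝ → ℝ} {c a b : ℝ} {I S S' : Set ℝ} {U V W U' V' W' : ℝ → ℝ}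
  {L L' R R' : ℝ × ℝ}

theorem null_inter (h : IsWave G f c a b I S U V W L R)
    (h' : IsWave G f c a b I S' U' V' W' L' R') : volume (I \ (S ∩ S')) = 0 := by
  rw [sdiff_inter]
  exact measure_union_null h.null h'.null

/-- Two profiles with the same `W` agree at the common good points. -/
theorem eq_of_eqOn (h : IsWave G f c a b I S U V W L R)
    (h' : IsWave G f c a b I S' U' V' W' L' R') (hW : ∀ ξ ∈ S ∩ S', W ξ = W' ξ) {ξ : ℝ}
    (hξ : ξ ∈ S ∩ S') : U ξ = U' ξ ∧ V ξ = V' ξ := by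
  -- If U < U' at a common continuity point, the same holds just to its right, and the increments of
  -- W and W' would differ there.
  have key : ∀ {S S' : Set ℝ} {U V W U' V' W' : ℝ → ℝ} {L L' R R' : ℝ × ℝ},
      IsWave G f c a b I S U V W L R → IsWave G f c a b I S' U' V' W' L' R' →
      (∀ ξ ∈ S ∩ S', W ξ = W' ξ) → ξ ∈ S ∩ S' → ¬ U ξ < U' ξ := by
    intro S S' U V W U' V' W' L L' R R' h h' hW hξ hlt
    obtain ⟨N, hN, hNo, hξN⟩ := eventually_nhds_iff.1
      ((((h'.continuousAt ξ hξ.2).sub (h.continuousAt ξ hξ.1)).eventually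
        (lt_mem_nhds (sub_pos.2 hlt))).and (h.isOpen.mem_nhds (h.subset hξ.1)))
    obtain ⟨l, r, hlr, hsub⟩ := mem_nhds_iff_exists_Ioo_subset.1 (hNo.mem_nhds hξN)
    obtain ⟨r', hr1, hr2⟩ := exists_between hlr.2
    have hr'I : r' ∈ I := (hN r' (hsub ⟨hlr.1.trans hr1, hr2⟩)).2
    obtain ⟨s, hs, h1, h2⟩ := h.exists_mem_Ioo (h.null_inter h') (h.subset hξ.1) hr'I hr1
    have hi := h.integral ξ (h.subset hξ.1) s (h.subset hs.1)
    have hi' := h'.integral ξ (h.subset hξ.1) s (h.subset hs.1)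
    have hii := h.intervalIntegrable ξ (h.subset hξ.1) s (h.subset hs.1)
    have hii' := h'.intervalIntegrable ξ (h.subset hξ.1) s (h.subset hs.1)
    have hpos : 0 < ∫ x in ξ..s, (U' x - U x) := by
      refine intervalIntegral.intervalIntegral_pos_of_pos_on (hii'.sub hii) (fun x hx => ?_) h1
      exact (hN x (hsub ⟨hlr.1.trans hx.1, hx.2.trans (h2.trans hr2)⟩)).1
    rw [intervalIntegral.integral_sub hii' hii] at hpos
    rw [hW ξ hξ, hW s hs] at hi
    linarith
  have hU : U ξ = U' ξ := by
    rcases lt_trichotomy (U ξ) (U' ξ) with h1 | h1 | h1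
    · exact absurd h1 (key h h' hW hξ)
    · exact h1
    · exact absurd h1 (key h' h (fun s hs => (hW s hs.symm).symm) hξ.symm)
  refine ⟨hU, ?_⟩
  have h1 := h.eq ξ hξ.1
  have h2 := h'.eq ξ hξ.2
  rw [hW ξ hξ, ← h2, hU] at h1
  linarith

/-- Uniqueness of the wave with given end states, where the flux at the left end may be free. -/
theorem unique_of_monotoneOn (h : IsWave G f c a b I S U V W L R)
    (h' : IsWave G f c a b I S' U' V' W' L' R) (hL : L.1 = L'.1)
    (hm : MonotoneOn U S) (hm' : MonotoneOn U' S') {ξ : ℝ} (hξ : ξ ∈ S ∩ S') :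
    U ξ = U' ξ ∧ V ξ = V' ξ := by
  -- Each W is a lower bound for the values attained by the other wave. Over the right end density
  -- the flux is that of R; over the left one `le_of_mem_graph` accepts any flux.
  have key : ∀ {S S' : Set ℝ} {U V W U' V' W' : ℝ → ℝ} {L L' : ℝ × ℝ},
      IsWave G f c a b I S U V W L R → IsWave G f c a b I S' U' V' W' L' R → L.1 = L'.1 →
      MonotoneOn U S → MonotoneOn U' S' → ∀ ξ ∈ S ∩ S', W' ξ ≤ W ξ := by
    intro S S' U V W U' V' W' L L' h h' hL hm hm' ξ hξ
    have hb := h.mem_between hm hξ.1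
    rw [← h.eq ξ hξ.1]
    rcases eq_or_lt_of_le (h.le_right hm hξ.1) with he | hlt
    · have := h'.le_right_state hm' (h.subset hξ.1)
      rw [← hb.2.2.2 he] at this
      exact this
    · exact h'.le_of_mem_graph hm' hb.1 (hL ▸ h.left_le hm hξ.1) hlt (h.subset hξ.1)
  exact h.eq_of_eqOn h' (fun s hs => le_antisymm (key h' h hL.symm hm' hm s hs.symm)
    (key h h' hL hm hm' s hs)) hξ

/-- The order of the end densities fixes the direction of monotonicity, a constant profile having
both; so the two waves rise together or fall together. -/
theorem unique (h : IsWave G f c a b I S U V W L R)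
    (h' : IsWave G f c a b I S' U' V' W' L' R) (hL : L.1 = L'.1) {ξ : ℝ} (hξ : ξ ∈ S ∩ S') :
    U ξ = U' ξ ∧ V ξ = V' ξ := by
  have hconst : ∀ {S : Set ℝ} {U V W : ℝ → ℝ} {L R : ℝ × ℝ}, IsWave G f c a b I S U V W L R →
      L.1 = R.1 → MonotoneOn U S := by
    intro S U V W L R h he
    rcases h.monotoneOn_or_antitoneOn with hm | hm
    · exact hm
    · have key : ∀ s ∈ S, U s = L.1 := fun s hs => by
        have h1 := h.neg.left_le hm.neg hs
        have h2 := h.neg.le_right hm.neg hs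
        simp only [Prod.fst_neg, neg_le_neg_iff] at h1 h2
        linarith
      intro s hs t ht _
      rw [key s hs, key t ht]
  have hmono : ∀ {S : Set ℝ} {U V W : ℝ → ℝ} {L R : ℝ × ℝ}, IsWave G f c a b I S U V W L R →
      L.1 ≤ R.1 → MonotoneOn U S := by
    intro S U V W L R h hle
    rcases h.monotoneOn_or_antitoneOn with hm | hm
    · exact hm
    · exact hconst h (le_antisymm hle (by simpa using h.neg.left_le_right hm.neg))
  rcases le_total L.1 R.1 with hle | hle
  · exact h.unique_of_monotoneOn h' hL (hmono h hle) (hmono h' (hL ▸ hle)) hξ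
  · have hanti : ∀ {S : Set ℝ} {U V W : ℝ → ℝ} {L R : ℝ × ℝ}, IsWave G f c a b I S U V W L R →
      R.1 ≤ L.1 → AntitoneOn U S := by
      intro S U V W L R h hle
      rcases h.monotoneOn_or_antitoneOn with hm | hm
      · intro s hs t ht hst
        have := le_antisymm hle (h.left_le_right hm)
        linarith [h.left_le hm hs, h.le_right hm ht]
      · exact hm
    have := h.neg.unique_of_monotoneOn h'.neg (by simp [hL]) (hanti h hle).neg
      (hanti h' (hL ▸ hle)).neg hξ
    simpa using this

end IsWave

/-! ### From distributional inequalities to monotone functions -/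

/-- A distributionally nonincreasing function is nonincreasing on a set of full measure. -/
theorem exists_antitoneOn_of_integral_nonneg {I : Set ℝ} (hI : IsOpen I) (hc : I.OrdConnected)
    {Q : ℝ → ℝ} (hQ : LocallyIntegrable Q)
    (h : ∀ α : ℝ → ℝ, ContDiff ℝ 1 α → HasCompactSupport α → tsupport α ⊆ I → (∀ x, 0 ≤ α x) →
      0 ≤ ∫ x, Q x * deriv α x) :
    ∃ T ⊆ I, volume (I \ T) = 0 ∧ AntitoneOn Q T := by
  let φ : ℕ → ContDiffBump (0 : ℝ) := fun n =>
    { rIn := 1 / (n + 1 : ℝ), rOut := 2 * (1 / (n + 1 : ℝ)), rIn_pos := by positivity,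
      rIn_lt_rOut := by
        have : (0 : ℝ) < 1 / (n + 1 : ℝ) := by positivity
        linarith }
  have hr : Tendsto (fun n => (φ n).rOut) atTop (𝓝 0) := by
    simpa [φ] using (tendsto_one_div_add_atTop_nhds_zero_nat (𝕜 := ℝ)).const_mul 2
  have hae := ContDiffBump.ae_convolution_tendsto_right_of_locallyIntegrable (μ := volume) hr
    (K := 2) (Eventually.of_forall fun n => le_rfl) hQ
  refine ⟨{ξ ∈ I | Tendsto (fun i ↦ (MeasureTheory.convolution ((φ i).normed volume) Q
    (ContinuousLinearMap.lsmul ℝ ℝ) volume) ξ) atTop (𝓝 (Q ξ))}, fun ξ hξ => hξ.1, ?_, ?_⟩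
  · refine measure_mono_null ?_ (ae_iff.1 hae)
    intro ξ hξ hcon
    exact hξ.2 ⟨hξ.1, hcon⟩
  rintro ξ ⟨hξ, hξl⟩ η ⟨hη, hηl⟩ hle
  rcases eq_or_lt_of_le hle with rfl | hlt
  · exact le_rfl
  refine le_of_tendsto_of_tendsto hηl hξl ?_
  have hev1 : ∀ᶠ n in atTop, ξ - (φ n).rOut ∈ I := by
    have : Tendsto (fun n => ξ - (φ n).rOut) atTop (𝓝 (ξ - 0)) := tendsto_const_nhds.sub hr
    exact this.eventually (hI.mem_nhds (by simpa using hξ))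
  have hev2 : ∀ᶠ n in atTop, η + (φ n).rOut ∈ I := by
    have : Tendsto (fun n => η + (φ n).rOut) atTop (𝓝 (η + 0)) := tendsto_const_nhds.add hr
    exact this.eventually (hI.mem_nhds (by simpa using hη))
  filter_upwards [hev1, hev2] with n h1 h2
  set ρ := (φ n).normed volume with hρ
  set r := (φ n).rOut with hrdef
  have hr0 : 0 < r := (φ n).rOut_pos
  have hρc : Continuous ρ := (φ n).continuous_normed
  have hρ0 : ∀ x, 0 ≤ ρ x := fun x => (φ n).nonneg_normed x
  have hρs : ∀ x, x ∉ Ioo (-r) r → ρ x = 0 := by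
    intro x hx
    by_contra hne
    have : x ∈ Function.support ρ := hne
    rw [hρ, (φ n).support_normed_eq, Real.ball_eq_Ioo] at this
    exact hx (by simpa using this)
  let P : ℝ → ℝ := fun s => ∫ x in (-r)..s, ρ x
  have hPd : ∀ s, HasDerivAt P (ρ s) s := fun s =>
    intervalIntegral.integral_hasDerivAt_right (hρc.intervalIntegrable _ _)
      (hρc.stronglyMeasurableAtFilter _ _) hρc.continuousAt
  have hPmono : Monotone P := monotone_of_deriv_nonneg (fun s => (hPd s).differentiableAt)
    fun s => by rw [(hPd s).deriv]; exact hρ0 s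
  have hP0 : ∀ s ≤ -r, P s = 0 := by
    intro s hs
    refine intervalIntegral.integral_zero_ae (Eventually.of_forall fun x hx => ?_)
    rw [uIoc_of_ge hs] at hx
    exact hρs x fun h => by linarith [hx.2, h.1]
  have hP1 : ∀ s, r ≤ s → P s = P r := by
    intro s hs
    have : P s - P r = ∫ x in r..s, ρ x := intervalIntegral.integral_interval_sub_left
      (hρc.intervalIntegrable _ _) (hρc.intervalIntegrable _ _)
    have h0 : ∫ x in r..s, ρ x = 0 := by
      refine intervalIntegral.integral_zero_ae (Eventually.of_forall fun x hx => ?_)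
      rw [uIoc_of_le hs] at hx
      exact hρs x fun h => by linarith [hx.1, h.2]
    linarith
  -- A smoothed indicator of [ξ, η]: its derivative is the difference of the mollifiers centred at ξ
  -- and η, so testing with it compares the two mollified values of Q.
  let α : ℝ → ℝ := fun s => P (s - ξ) - P (s - η)
  have hαd : ∀ s, HasDerivAt α (ρ (s - ξ) - ρ (s - η)) s := fun s =>
    ((hPd _).comp_sub_const s ξ).sub ((hPd _).comp_sub_const s η)
  have hαd' : deriv α = fun s => ρ (s - ξ) - ρ (s - η) := funext fun s => (hαd s).deriv
  have hα1 : ContDiff ℝ 1 α := by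
    refine contDiff_one_iff_deriv.2 ⟨fun s => (hαd s).differentiableAt, ?_⟩
    rw [hαd']
    fun_prop
  have hsupp : Function.support α ⊆ Icc (ξ - r) (η + r) := by
    intro s hs
    by_contra hcon
    apply hs
    rcases lt_or_ge s (ξ - r) with h3 | h3
    · simp only [α]
      rw [hP0 _ (by linarith), hP0 _ (by linarith), sub_zero]
    · have h4 : η + r < s := not_le.1 fun h4 => hcon ⟨h3, h4⟩
      simp only [α]
      rw [hP1 _ (by linarith), hP1 (s - η) (by linarith), sub_self]
  have hts : tsupport α ⊆ Icc (ξ - r) (η + r) := closure_minimal hsupp isClosed_Icc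
  have hcs : HasCompactSupport α := HasCompactSupport.of_support_subset_isCompact isCompact_Icc hsupp
  have hkey := h α hα1 hcs (hts.trans (hc.out h1 h2)) fun s => sub_nonneg.2 (hPmono (by linarith))
  have hint : ∀ y, Integrable fun s => Q s * ρ (s - y) := by
    intro y
    have hcont : Continuous fun s => ρ (s - y) := by fun_prop
    have hcomp : HasCompactSupport fun s => ρ (s - y) := by
      refine HasCompactSupport.of_support_subset_isCompact (K := Icc (y - r) (y + r))
        isCompact_Icc fun s hs => ?_
      by_contra hcon
      exact hs (hρs _ fun h => hcon ⟨by linarith [h.1], by linarith [h.2]⟩)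
    exact hQ.integrable_smul_right_of_hasCompactSupport hcont hcomp
  have hconv : ∀ y, MeasureTheory.convolution ρ Q (ContinuousLinearMap.lsmul ℝ ℝ) volume y =
      ∫ s, Q s * ρ (s - y) := by
    intro y
    rw [convolution_eq_swap]
    refine integral_congr_ae (Eventually.of_forall fun s => ?_)
    simp only [ContinuousLinearMap.lsmul_apply, smul_eq_mul]
    rw [hρ, ← (φ n).normed_neg (μ := volume) (y - s), neg_sub, mul_comm]
  rw [hconv, hconv, ← sub_nonneg, ← integral_sub (hint ξ) (hint η)]
  rw [hαd'] at hkey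
  simpa only [mul_sub] using hkey

/-- Integration by parts against a compactly supported test function. -/
theorem integral_mul_deriv_sub {U W α : ℝ → ℝ} {N : Set ℝ} (hN : N.Countable) {x y : ℝ}
    (hW : ContinuousOn W (uIcc x y))
    (hd : ∀ s ∈ Ioo (min x y) (max x y) \ N, HasDerivAt W (-U s) s)
    (hU : IntervalIntegrable U volume x y) (hα : ContDiff ℝ 1 α) :
    ∫ s in x..y, (W s * deriv α s - U s * α s) = W y * α y - W x * α x := by
  have hαd : ∀ s, HasDerivAt α (deriv α s) s := fun s =>
    (hα.differentiable one_ne_zero s).hasDerivAt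
  have hαc : Continuous (deriv α) := hα.continuous_deriv le_rfl
  refine integral_eq_of_hasDerivAt_off_countable (fun s => W s * α s) _ hN
    (hW.mul hα.continuous.continuousOn) (fun s hs => ?_) ?_
  · exact ((hd s hs).fun_mul (hαd s)).congr_deriv (by ring)
  · exact (hW.mul hαc.continuousOn).intervalIntegrable.sub
      (hU.mul_continuousOn hα.continuous.continuousOn)

/-- A measurable set of reals invariant under positive dilations. -/
structure IsCone (I : Set ℝ) : Prop where
  measurableSet : MeasurableSet I
  mul_mem_iff : ∀ x, ∀ t > 0, x * t ∈ I ↔ x ∈ I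

theorem IsCone.div_mem_iff {I : Set ℝ} (hI : IsCone I) {x t : ℝ} (ht : 0 < t) :
    x / t ∈ I ↔ x ∈ I := by
  rw [← hI.mul_mem_iff (x / t) t ht, div_mul_cancel₀ _ ht.ne']

theorem isCone_Iio : IsCone (Iio (0 : ℝ)) :=
  ⟨measurableSet_Iio, fun x t ht => by simp [mul_neg_iff, ht, not_lt.2 ht.le]⟩

theorem isCone_Ioi : IsCone (Ioi (0 : ℝ)) :=
  ⟨measurableSet_Ioi, fun x t ht => by simp [ht]⟩

/-- Partial derivative in the first variable. -/
def derivFst (φ : ℝ × ℝ → ℝ) (p : ℝ × ℝ) : ℝ := deriv (fun x => φ (x, p.2)) p.1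

/-- Partial derivative in the second variable. -/
def derivSnd (φ : ℝ × ℝ → ℝ) (p : ℝ × ℝ) : ℝ := deriv (fun t => φ (p.1, t)) p.2

section Partial

variable {φ : ℝ × ℝ → ℝ}

theorem hasFDerivAt_of_contDiff (hφ : ContDiff ℝ 1 φ) (p : ℝ × ℝ) :
    HasFDerivAt φ (fderiv ℝ φ p) p := (hφ.differentiable one_ne_zero p).hasFDerivAt

theorem derivFst_eq (hφ : ContDiff ℝ 1 φ) (p : ℝ × ℝ) : derivFst φ p = fderiv ℝ φ p (1, 0) := by
  have h1 : HasDerivAt (fun x : ℝ => (x, p.2)) ((1 : ℝ), (0 : ℝ)) p.1 :=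
    (hasDerivAt_id _).prodMk (hasDerivAt_const _ _)
  exact ((hasFDerivAt_of_contDiff hφ p).comp_hasDerivAt p.1 h1).deriv

theorem derivSnd_eq (hφ : ContDiff ℝ 1 φ) (p : ℝ × ℝ) : derivSnd φ p = fderiv ℝ φ p (0, 1) := by
  have h1 : HasDerivAt (fun t : ℝ => (p.1, t)) ((0 : ℝ), (1 : ℝ)) p.2 :=
    (hasDerivAt_const _ _).prodMk (hasDerivAt_id _)
  exact ((hasFDerivAt_of_contDiff hφ p).comp_hasDerivAt p.2 h1).deriv

theorem continuous_derivFst (hφ : ContDiff ℝ 1 φ) : Continuous (derivFst φ) := by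
  rw [funext (derivFst_eq hφ)]
  exact (hφ.continuous_fderiv one_ne_zero).clm_apply continuous_const

theorem continuous_derivSnd (hφ : ContDiff ℝ 1 φ) : Continuous (derivSnd φ) := by
  rw [funext (derivSnd_eq hφ)]
  exact (hφ.continuous_fderiv one_ne_zero).clm_apply continuous_const

theorem hasDerivAt_ray (hφ : ContDiff ℝ 1 φ) (ξ t : ℝ) :
    HasDerivAt (fun t => φ (ξ * t, t)) (ξ * derivFst φ (ξ * t, t) + derivSnd φ (ξ * t, t)) t := by
  have h1 : HasDerivAt (fun t : ℝ => (ξ * t, t)) (ξ, (1 : ℝ)) t :=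
    (by simpa using (hasDerivAt_id t).const_mul ξ : HasDerivAt (fun t => ξ * t) ξ t).prodMk
      (hasDerivAt_id _)
  refine ((hasFDerivAt_of_contDiff hφ _).comp_hasDerivAt t h1).congr_deriv ?_
  rw [derivFst_eq hφ, derivSnd_eq hφ, show (ξ, (1 : ℝ)) = ξ • ((1 : ℝ), (0 : ℝ)) + (0, 1) by simp,
    map_add, map_smul, smul_eq_mul]

theorem hasDerivAt_slice (hφ : ContDiff ℝ 1 φ) (ξ t : ℝ) :
    HasDerivAt (fun ξ => φ (ξ * t, t)) (t * derivFst φ (ξ * t, t)) ξ := by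
  have h1 : HasDerivAt (fun ξ : ℝ => (ξ * t, t)) (t, (0 : ℝ)) ξ :=
    (by simpa using (hasDerivAt_id ξ).mul_const t : HasDerivAt (fun ξ => ξ * t) t ξ).prodMk
      (hasDerivAt_const _ _)
  refine ((hasFDerivAt_of_contDiff hφ _).comp_hasDerivAt ξ h1).congr_deriv ?_
  rw [derivFst_eq hφ, show (t, (0 : ℝ)) = t • ((1 : ℝ), (0 : ℝ)) by simp, map_smul, smul_eq_mul]

theorem exists_box (hφ : ContDiff ℝ 1 φ) (hc : HasCompactSupport φ) :
    ∃ R > 0, ∀ p : ℝ × ℝ, (R < |p.1| ∨ R < |p.2|) → φ p = 0 ∧ derivFst φ p = 0 ∧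
      derivSnd φ p = 0 := by
  obtain ⟨R, hR⟩ := hc.isCompact.isBounded.subset_closedBall (0 : ℝ × ℝ)
  refine ⟨max R 1, by positivity, fun p hp => ?_⟩
  have hnot : p ∉ tsupport φ := fun h => by
    have := hR h
    rw [mem_closedBall_zero_iff, Prod.norm_def, max_le_iff, Real.norm_eq_abs,
      Real.norm_eq_abs] at this
    rcases hp with hp | hp <;> linarith [le_max_left R 1, this.1, this.2]
  have hd : fderiv ℝ φ p = 0 := by
    by_contra hne
    exact hnot (support_fderiv_subset ℝ hne)
  exact ⟨image_eq_zero_of_notMem_tsupport hnot, by rw [derivFst_eq hφ, hd]; simp,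
    by rw [derivSnd_eq hφ, hd]; simp⟩

end Partial

theorem integrableOn_mul_of_box {e g : ℝ × ℝ → ℝ} (he : Measurable e) {C : ℝ}
    (hC : ∀ p, |e p| ≤ C) (hg : Continuous g) {s : Set (ℝ × ℝ)} (hs : MeasurableSet s) {R : ℝ}
    (hg0 : ∀ p ∈ s, (R < |p.1| ∨ R < |p.2|) → g p = 0) : IntegrableOn (fun p => e p * g p) s := by
  have hK : IsCompact (Icc (-R) R ×ˢ Icc (-R) R : Set (ℝ × ℝ)) := isCompact_Icc.prod isCompact_Icc
  obtain ⟨M, hM⟩ := hK.exists_bound_of_continuousOn hg.continuousOn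
  refine IntegrableOn.of_forall_sdiff_eq_zero (s := Icc (-R) R ×ˢ Icc (-R) R) ?_ hs ?_
  · refine Measure.integrableOn_of_bounded (M := C * M) hK.measure_lt_top.ne
      (he.aestronglyMeasurable.mul hg.aestronglyMeasurable) ?_
    rw [ae_restrict_iff' hK.measurableSet]
    refine Eventually.of_forall fun p hp => ?_
    rw [norm_mul]
    exact mul_le_mul (hC p) (hM p hp) (norm_nonneg _) ((abs_nonneg _).trans (hC p))
  · rintro p ⟨hp, hpK⟩
    rw [hg0 p hp, mul_zero]
    by_contra! hcon
    exact hpK ⟨abs_le.1 hcon.1, abs_le.1 hcon.2⟩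

theorem IsCone.setIntegral_eq {I : Set ℝ} (hI : IsCone I) {t : ℝ} (ht : 0 < t) (h : ℝ → ℝ) :
    ∫ x in I, h x = ∫ ξ in I, t * h (ξ * t) := by
  rw [integral_const_mul, ← integral_indicator hI.measurableSet, ← integral_indicator
    hI.measurableSet]
  have : (I.indicator fun ξ => h (ξ * t)) = fun ξ => I.indicator h (ξ * t) := by
    funext ξ
    by_cases hξ : ξ ∈ I
    · rw [indicator_of_mem hξ, indicator_of_mem ((hI.mul_mem_iff ξ t ht).2 hξ)]
    · rw [indicator_of_notMem hξ, indicator_of_notMem (mt (hI.mul_mem_iff ξ t ht).1 hξ)]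
  rw [this, Measure.integral_comp_mul_right, abs_of_pos (inv_pos.2 ht), smul_eq_mul,
    mul_inv_cancel_left₀ ht.ne']

/-- Inner integral of the weak formulation in the variable `ξ = x / t` at time `t`. -/
def rayBracket (I : Set ℝ) (E Q : ℝ → ℝ) (φ : ℝ × ℝ → ℝ) (t : ℝ) : ℝ :=
  ∫ ξ in I, ((Q ξ - ξ * E ξ) * (t * derivFst φ (ξ * t, t)) - E ξ * φ (ξ * t, t))

section Weak

variable {I : Set ℝ} (hI : IsCone I) {E Q : ℝ → ℝ} (hE : Measurable E) (hQ : Measurable Q) {C : ℝ}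
  (hEC : ∀ ξ, |E ξ| ≤ C) (hQC : ∀ ξ, |Q ξ| ≤ C) {φ : ℝ × ℝ → ℝ} (hφ : ContDiff ℝ 1 φ)
  (hc : HasCompactSupport φ)

include hE hQ hEC hQC hφ hc in
theorem integrable_weak : Integrable fun p : ℝ × ℝ =>
    E (p.1 / p.2) * derivSnd φ p + Q (p.1 / p.2) * derivFst φ p := by
  obtain ⟨R, hR, hbox⟩ := exists_box hφ hc
  have hm : Measurable fun p : ℝ × ℝ => p.1 / p.2 := measurable_fst.div measurable_snd
  rw [← integrableOn_univ]
  exact (integrableOn_mul_of_box (hE.comp hm) (fun p => hEC _) (continuous_derivSnd hφ)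
    MeasurableSet.univ fun p _ hp => (hbox p hp).2.2).add
    (integrableOn_mul_of_box (hQ.comp hm) (fun p => hQC _) (continuous_derivFst hφ)
    MeasurableSet.univ fun p _ hp => (hbox p hp).2.1)

include hI hE hQ hEC hQC hφ hc in
-- After x = ξt the integrand is E(ξ) times the t-derivative of t φ(ξt, t), called A, plus the
-- integrand B of `rayBracket`. The first part integrates to the boundary term at t = ε. The cutoff
-- keeps ξ bounded on the support of φ.
theorem integral_weak_eq {ε : ℝ} (hε : 0 < ε) :
    ∫ p in I ×ˢ Ioi ε, (E (p.1 / p.2) * derivSnd φ p + Q (p.1 / p.2) * derivFst φ p) =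
      -(∫ x in I, E (x / ε) * φ (x, ε)) + ∫ t in Ioi ε, rayBracket I E Q φ t := by
  obtain ⟨R, hR, hbox⟩ := exists_box hφ hc
  have hprod : (volume : Measure (ℝ × ℝ)).restrict (I ×ˢ Ioi ε) =
      (volume.restrict I).prod (volume.restrict (Ioi ε)) := by
    rw [Measure.prod_restrict]; rfl
  have hmeas : MeasurableSet (I ×ˢ Ioi ε) := hI.measurableSet.prod measurableSet_Ioi
  have hφc := hφ.continuous
  have hF := continuous_derivFst hφ
  have hS := continuous_derivSnd hφ
  let A : ℝ × ℝ → ℝ := fun p => E p.1 * (φ (p.1 * p.2, p.2) +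
    p.2 * (p.1 * derivFst φ (p.1 * p.2, p.2) + derivSnd φ (p.1 * p.2, p.2)))
  let B : ℝ × ℝ → ℝ := fun p => (Q p.1 - p.1 * E p.1) * (p.2 * derivFst φ (p.1 * p.2, p.2)) -
    E p.1 * φ (p.1 * p.2, p.2)
  have hbox' : ∀ p ∈ I ×ˢ Ioi ε, (max R (R / ε) < |p.1| ∨ max R (R / ε) < |p.2|) →
      φ (p.1 * p.2, p.2) = 0 ∧ derivFst φ (p.1 * p.2, p.2) = 0 ∧
      derivSnd φ (p.1 * p.2, p.2) = 0 := by
    rintro p ⟨-, hp2⟩ hp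
    refine hbox _ ?_
    rcases hp with hp | hp
    · left
      have h1 : R / ε < |p.1| := (le_max_right _ _).trans_lt hp
      have h2 : ε < |p.2| := (mem_Ioi.1 hp2).trans_le (le_abs_self _)
      rw [div_lt_iff₀ hε] at h1
      simp only [abs_mul]
      nlinarith [abs_nonneg p.1]
    · exact Or.inr ((le_max_left _ _).trans_lt hp)
  have hA : IntegrableOn A (I ×ˢ Ioi ε) := by
    refine integrableOn_mul_of_box (hE.comp measurable_fst) (fun p => hEC _) (by fun_prop) hmeas
      (R := max R (R / ε)) fun p hp hp' => ?_
    obtain ⟨h1, h2, h3⟩ := hbox' p hp hp'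
    rw [h1, h2, h3]; ring
  have hB : IntegrableOn B (I ×ˢ Ioi ε) := by
    have h1 : IntegrableOn (fun p : ℝ × ℝ => Q p.1 * (p.2 * derivFst φ (p.1 * p.2, p.2)))
        (I ×ˢ Ioi ε) := by
      refine integrableOn_mul_of_box (hQ.comp measurable_fst) (fun p => hQC _) (by fun_prop) hmeas
        (R := max R (R / ε)) fun p hp hp' => ?_
      rw [(hbox' p hp hp').2.1]; ring
    have h2 : IntegrableOn (fun p : ℝ × ℝ => E p.1 * (p.1 * (p.2 * derivFst φ (p.1 * p.2, p.2)) +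
        φ (p.1 * p.2, p.2))) (I ×ˢ Ioi ε) := by
      refine integrableOn_mul_of_box (hE.comp measurable_fst) (fun p => hEC _) (by fun_prop) hmeas
        (R := max R (R / ε)) fun p hp hp' => ?_
      rw [(hbox' p hp hp').2.1, (hbox' p hp hp').1]; ring
    refine (h1.sub h2).congr_fun (fun p _ => ?_) hmeas
    simp only [B, Pi.sub_apply]
    ring
  have hA' := hA
  have hB' := hB
  rw [IntegrableOn, hprod] at hA' hB'
  have hstep : ∀ t ∈ Ioi ε,
      ∫ x in I, (E (x / t) * derivSnd φ (x, t) + Q (x / t) * derivFst φ (x, t)) =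
      ∫ ξ in I, (A (ξ, t) + B (ξ, t)) := by
    intro t ht
    have ht0 : 0 < t := hε.trans ht
    rw [hI.setIntegral_eq ht0]
    refine setIntegral_congr_fun hI.measurableSet fun ξ _ => ?_
    simp only [A, B, mul_div_cancel_right₀ ξ ht0.ne']
    ring
  have hAval : ∀ ξ, ∫ t in Ioi ε, A (ξ, t) = -(E ξ * (ε * φ (ξ * ε, ε))) := by
    intro ξ
    simp only [A]
    rw [integral_const_mul]
    have hd : ∀ t, HasDerivAt (fun t => t * φ (ξ * t, t)) (φ (ξ * t, t) +
        t * (ξ * derivFst φ (ξ * t, t) + derivSnd φ (ξ * t, t))) t := fun t =>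
      ((hasDerivAt_id t).fun_mul (hasDerivAt_ray hφ ξ t)).congr_deriv (by simp)
    have hzero : ∀ t, R < t → t * φ (ξ * t, t) = 0 := fun t ht => by
      rw [(hbox (ξ * t, t) (Or.inr (ht.trans_le (le_abs_self _)))).1, mul_zero]
    rw [integral_Ioi_of_hasDerivAt_of_tendsto (m := 0) (hd ε).continuousAt.continuousWithinAt
      (fun t _ => hd t)]
    · ring
    · refine IntegrableOn.of_forall_sdiff_eq_zero (s := Icc ε R) ?_ measurableSet_Ioi ?_
      · exact Continuous.integrableOn_Icc (by fun_prop)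
      · rintro t ⟨ht, ht'⟩
        have hRt : R < t := not_le.1 fun h => ht' ⟨(mem_Ioi.1 ht).le, h⟩
        obtain ⟨h1, h2, h3⟩ := hbox (ξ * t, t) (Or.inr (hRt.trans_le (le_abs_self _)))
        rw [h1, h2, h3]; ring
    · refine tendsto_const_nhds.congr' ?_
      filter_upwards [eventually_gt_atTop R] with t ht
      exact (hzero t ht).symm
  rw [hprod, integral_prod_symm _ (by
    rw [← hprod]; exact (integrable_weak hE hQ hEC hQC hφ hc).integrableOn)]
  rw [setIntegral_congr_fun measurableSet_Ioi hstep]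
  have hadd : ∀ᵐ t ∂(volume.restrict (Ioi ε)), ∫ ξ in I, (A (ξ, t) + B (ξ, t)) =
      (∫ ξ in I, A (ξ, t)) + ∫ ξ in I, B (ξ, t) := by
    filter_upwards [hA'.prod_left_ae, hB'.prod_left_ae] with t h1 h2
    exact integral_add h1 h2
  rw [integral_congr_ae hadd, integral_add hA'.integral_prod_right hB'.integral_prod_right]
  congr 1
  rw [← integral_integral_swap (f := fun ξ t => A (ξ, t)) hA']
  simp only [hAval]
  rw [integral_neg, hI.setIntegral_eq hε (fun x => E (x / ε) * φ (x, ε))]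
  congr 1
  refine setIntegral_congr_fun hI.measurableSet fun ξ _ => ?_
  simp only [mul_div_cancel_right₀ ξ hε.ne']
  ring

include hI hE hQ hEC hQC hφ hc in
-- In the boundary term of `integral_weak_eq` with ε = 1/(n+1), E is evaluated at x/ε, that is,
-- towards infinity; dominated convergence replaces it by its limit e, which plays the role of the
-- initial datum.
theorem tendsto_integral_rayBracket {e : ℝ}
    (he : ∀ᵐ x ∂(volume.restrict I), Tendsto (fun n : ℕ => E (x / (1 / (n + 1 : ℝ)))) atTop
      (𝓝 e)) :
    Tendsto (fun n : ℕ => ∫ t in Ioi (1 / (n + 1 : ℝ)), rayBracket I E Q φ t) atTop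
      (𝓝 ((∫ p in I ×ˢ Ioi (0 : ℝ),
        (E (p.1 / p.2) * derivSnd φ p + Q (p.1 / p.2) * derivFst φ p)) +
          ∫ x in I, e * φ (x, 0))) := by
  obtain ⟨R, hR, hbox⟩ := exists_box hφ hc
  have hpos : ∀ n : ℕ, (0 : ℝ) < 1 / (n + 1 : ℝ) := fun n => by positivity
  have hlim : Tendsto (fun n : ℕ => 1 / (n + 1 : ℝ)) atTop (𝓝 0) :=
    tendsto_one_div_add_atTop_nhds_zero_nat
  have hU : (⋃ n : ℕ, I ×ˢ Ioi (1 / (n + 1 : ℝ))) = I ×ˢ Ioi (0 : ℝ) := by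
    rw [← prod_iUnion]
    congr 1
    ext t
    simp only [mem_iUnion, mem_Ioi]
    constructor
    · rintro ⟨n, hn⟩
      exact (hpos n).trans hn
    · intro ht
      exact exists_nat_one_div_lt ht
  have h1 := tendsto_setIntegral_of_monotone (μ := (volume : Measure (ℝ × ℝ)))
    (f := fun p : ℝ × ℝ => E (p.1 / p.2) * derivSnd φ p + Q (p.1 / p.2) * derivFst φ p)
    (s := fun n : ℕ => I ×ˢ Ioi (1 / (n + 1 : ℝ)))
    (fun n => hI.measurableSet.prod measurableSet_Ioi)
    (fun m n hmn => prod_mono le_rfl (Ioi_subset_Ioi (one_div_le_one_div_of_le (by positivity)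
      (by have : (m : ℝ) ≤ n := by exact_mod_cast hmn
          linarith))))
    (integrable_weak hE hQ hEC hQC hφ hc).integrableOn
  rw [hU] at h1
  have h2 : Tendsto (fun n : ℕ => ∫ x in I, E (x / (1 / (n + 1 : ℝ))) * φ (x, 1 / (n + 1 : ℝ)))
      atTop (𝓝 (∫ x in I, e * φ (x, 0))) := by
    obtain ⟨M, hM⟩ := hc.exists_bound_of_continuous hφ.continuous
    refine tendsto_integral_of_dominated_convergence ((Icc (-R) R).indicator fun _ => C * M)
      (fun n => ?_) ?_ (fun n => ?_) ?_
    · have : Measurable fun x : ℝ => E (x / (1 / (n + 1 : ℝ))) :=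
        hE.comp (measurable_id.div_const _)
      exact (this.mul (hφ.continuous.comp (by fun_prop : Continuous fun x : ℝ =>
        (x, 1 / (n + 1 : ℝ)))).measurable).aestronglyMeasurable
    · refine Integrable.integrableOn ?_
      rw [integrable_indicator_iff measurableSet_Icc]
      exact integrableOn_const isCompact_Icc.measure_lt_top.ne
    · refine Eventually.of_forall fun x => ?_
      by_cases hx : x ∈ Icc (-R) R
      · rw [indicator_of_mem hx, norm_mul]
        exact mul_le_mul (hEC _) (hM _) (norm_nonneg _) ((abs_nonneg _).trans (hEC 0))
      · rw [indicator_of_notMem hx, (hbox (x, _) (Or.inl (not_le.1 fun h => hx (abs_le.1 h)))).1]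
        simp
    · filter_upwards [he] with x hx
      refine hx.mul ?_
      have : Continuous fun t => φ (x, t) := hφ.continuous.comp (by fun_prop)
      exact (this.tendsto 0).comp hlim
  refine (h1.add h2).congr fun n => ?_
  rw [integral_weak_eq hI hE hQ hEC hQC hφ hc (hpos n)]
  ring

end Weak

/-! ### Measurability and null sets in the variables x / t and (x, t) -/

theorem measurable_sign : Measurable Real.sign := by
  have : Real.sign = fun r : ℝ => if r < 0 then -1 else if 0 < r then 1 else 0 := rfl
  rw [this]
  exact Measurable.ite measurableSet_Iio measurable_const
    (Measurable.ite measurableSet_Ioi measurable_const measurable_const)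

theorem abs_sign_le (r : ℝ) : |Real.sign r| ≤ 1 := by
  rcases Real.sign_apply_eq r with h | h | h <;> rw [h] <;> norm_num

theorem abs_eq_sign_mul (r : ℝ) : |r| = Real.sign r * r := by
  rcases lt_trichotomy r 0 with h | rfl | h
  · rw [Real.sign_of_neg h, abs_of_neg h, neg_one_mul]
  · simp
  · rw [Real.sign_of_pos h, abs_of_pos h, one_mul]

theorem restrict_prod_Ioi (I : Set ℝ) : (volume : Measure (ℝ × ℝ)).restrict (I ×ˢ Ioi (0 : ℝ)) =
    (volume.restrict I).prod (volume.restrict (Ioi (0 : ℝ))) := by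
  rw [Measure.prod_restrict]; rfl

namespace IsCone

variable {I : Set ℝ}

theorem ae_scale (hI : IsCone I) {t : ℝ} (ht : 0 < t) {P : ℝ → Prop}
    (h : ∀ᵐ ξ ∂(volume.restrict I), P ξ) : ∀ᵐ x ∂(volume.restrict I), P (x * t) := by
  rw [ae_restrict_iff' hI.measurableSet] at h ⊢
  have h0 : volume ((· * t) ⁻¹' {ξ | ¬ (ξ ∈ I → P ξ)}) = 0 := by
    rw [Real.volume_preimage_mul_right ht.ne', ae_iff.1 h, mul_zero]
  rw [ae_iff]
  refine measure_mono_null (fun x hx => ?_) h0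
  simp only [mem_preimage, mem_ofPred_eq, hI.mul_mem_iff x t ht]
  exact hx

/-- A property of `x / t` holding for almost all values of `x / t` holds for almost all `(x, t)`. -/
theorem ae_prod_of_ae (hI : IsCone I) {P : ℝ → Prop} (h : ∀ᵐ ξ ∂(volume.restrict I), P ξ) :
    ∀ᵐ p ∂(volume.restrict (I ×ˢ Ioi (0 : ℝ))), P (p.1 / p.2) := by
  -- Fubini's criterion for null sets needs a measurable set.
  set N := toMeasurable (volume.restrict I) {ξ | ¬ P ξ} with hN
  have hN0 : volume.restrict I N = 0 := by rw [hN, measure_toMeasurable]; exact h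
  have hNm : MeasurableSet N := measurableSet_toMeasurable _ _
  have hm : MeasurableSet {p : ℝ × ℝ | p.2 / p.1 ∈ N} :=
    (measurable_snd.div measurable_fst) hNm
  have hkey : (volume.restrict (Ioi (0 : ℝ))).prod (volume.restrict I)
      {p : ℝ × ℝ | p.2 / p.1 ∈ N} = 0 := by
    rw [Measure.measure_prod_null hm]
    rw [EventuallyEq, ae_restrict_iff' measurableSet_Ioi]
    refine Eventually.of_forall fun t ht => ?_
    have := hI.ae_scale (inv_pos.2 ht) (P := fun ξ => ξ ∉ N) (measure_eq_zero_iff_ae_notMem.1 hN0)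
    refine measure_eq_zero_iff_ae_notMem.2 ?_
    filter_upwards [this] with x hx
    simpa [div_eq_mul_inv] using hx
  have h2 : ∀ᵐ p ∂((volume.restrict (Ioi (0 : ℝ))).prod (volume.restrict I)), p.2 / p.1 ∉ N :=
    measure_eq_zero_iff_ae_notMem.1 hkey
  rw [restrict_prod_Ioi]
  have h3 := (Measure.measurePreserving_swap (μ := volume.restrict I)
    (ν := volume.restrict (Ioi (0 : ℝ)))).quasiMeasurePreserving.ae h2
  filter_upwards [h3] with p hp
  by_contra hcon
  exact hp (subset_toMeasurable _ _ hcon)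

/-- Fubini gives one time t at which the property holds for almost all x; a dilation by t finishes.
-/
theorem ae_of_ae_prod (hI : IsCone I) {P : ℝ → Prop}
    (h : ∀ᵐ p ∂(volume.restrict (I ×ˢ Ioi (0 : ℝ))), P (p.1 / p.2)) :
    ∀ᵐ ξ ∂(volume.restrict I), P ξ := by
  rw [restrict_prod_Ioi] at h
  have h2 := (Measure.measurePreserving_swap (ν := volume.restrict I)
    (μ := volume.restrict (Ioi (0 : ℝ)))).quasiMeasurePreserving.ae h
  have h3 := (Measure.ae_ae_of_ae_prod h2).and (ae_restrict_mem measurableSet_Ioi)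
  have : (ae (volume.restrict (Ioi (0 : ℝ)))).NeBot := by
    rw [ae_neBot, Ne, Measure.restrict_eq_zero]
    simp
  obtain ⟨t, ht, ht0⟩ := h3.exists
  have ht0 : 0 < t := ht0
  have := hI.ae_scale ht0 ht
  filter_upwards [this] with ξ hξ
  simpa [mul_div_cancel_right₀ ξ ht0.ne'] using hξ

/-- Almost every time section is measurable; self-similarity carries one such section to time 1. -/
theorem aestronglyMeasurable_slice (hI : IsCone I) {u : ℝ → ℝ → ℝ}
    (hu : AEStronglyMeasurable (fun p : ℝ × ℝ => u p.1 p.2)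
      (volume.restrict (I ×ˢ Ioi (0 : ℝ))))
    (hs : ∀ x ∈ I, ∀ t > 0, ∀ c > 0, u (c * x) (c * t) = u x t) :
    AEStronglyMeasurable (I.indicator fun ξ => u ξ 1) volume := by
  rw [restrict_prod_Ioi] at hu
  have h3 := hu.prod_swap.prodMk_left.and (ae_restrict_mem measurableSet_Ioi)
  have : (ae (volume.restrict (Ioi (0 : ℝ)))).NeBot := by
    rw [ae_neBot, Ne, Measure.restrict_eq_zero]
    simp
  obtain ⟨t, ht, ht0⟩ := h3.exists
  have ht0 : 0 < t := ht0
  have hmul : Measurable fun x : ℝ => x * t := measurable_id.mul_const t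
  have hq : Measure.QuasiMeasurePreserving (fun x : ℝ => x * t) (volume.restrict I)
      (volume.restrict I) := by
    refine ⟨hmul, ?_⟩
    refine Measure.AbsolutelyContinuous.mk fun s hs hs0 => ?_
    rw [Measure.map_apply hmul hs]
    have := hI.ae_scale ht0 (P := fun ξ => ξ ∉ s) (measure_eq_zero_iff_ae_notMem.1 hs0)
    exact measure_eq_zero_iff_ae_notMem.2 this
  have h4 := ht.comp_quasiMeasurePreserving hq
  rw [aestronglyMeasurable_indicator_iff hI.measurableSet]
  refine h4.congr ?_
  rw [EventuallyEq, ae_restrict_iff' hI.measurableSet]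
  refine Eventually.of_forall fun ξ hξ => ?_
  have := hs ξ hξ 1 one_pos t ht0
  simp only [mul_one] at this
  simpa [mul_comm] using this

end IsCone

theorem exists_measurable_bounded {h : ℝ → ℝ} (hh : AEStronglyMeasurable h volume) {C : ℝ}
    (hC : 0 ≤ C) (hb : ∀ᵐ ξ, |h ξ| ≤ C) :
    ∃ g : ℝ → ℝ, Measurable g ∧ (∀ ξ, |g ξ| ≤ C) ∧ ∀ᵐ ξ, g ξ = h ξ := by
  refine ⟨fun ξ => max (-C) (min C (hh.mk h ξ)), ?_, fun ξ => ?_, ?_⟩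
  · exact measurable_const.max (measurable_const.min hh.stronglyMeasurable_mk.measurable)
  · exact abs_le.2 ⟨le_max_left _ _, max_le (by linarith) (min_le_left _ _)⟩
  · filter_upwards [hh.ae_eq_mk, hb] with ξ h1 h2
    rw [← h1, min_eq_right (abs_le.1 h2).2, max_eq_right (abs_le.1 h2).1]

/-- The product test function `α(x / t) β(t)`. -/
theorem exists_product_test {I : Set ℝ} (hI : IsCone I) {α : ℝ → ℝ} (hα : ContDiff ℝ 1 α)
    (hαc : HasCompactSupport α) (hαI : tsupport α ⊆ I) :
    ∃ φ : ℝ × ℝ → ℝ, ContDiff ℝ 1 φ ∧ HasCompactSupport φ ∧ tsupport φ ⊆ I ×ˢ Ioi (0 : ℝ) ∧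
      ((∀ x, 0 ≤ α x) → ∀ p, 0 ≤ φ p) ∧ ∃ κ > 0, ∀ E Q : ℝ → ℝ, Measurable E → Measurable Q →
        ∀ C, (∀ ξ, |E ξ| ≤ C) → (∀ ξ, |Q ξ| ≤ C) →
        ∫ p in I ×ˢ Ioi (0 : ℝ), (E (p.1 / p.2) * derivSnd φ p + Q (p.1 / p.2) * derivFst φ p) =
          κ * ∫ ξ in I, ((Q ξ - ξ * E ξ) * deriv α ξ - E ξ * α ξ) := by
  -- The support of β stays away from t = 0, where x / t is singular.
  let β : ContDiffBump (2 : ℝ) := ⟨1 / 2, 1, by norm_num, by norm_num⟩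
  have hβ0 : ∀ t, t ∉ Ioo (1 : ℝ) 3 → β t = 0 := by
    intro t ht
    by_contra hne
    have : t ∈ Function.support β := hne
    rw [β.support_eq, Real.ball_eq_Ioo] at this
    exact ht ⟨by have := this.1; simp only [β] at this; linarith,
      by have := this.2; simp only [β] at this; linarith⟩
  have hβ : ContDiff ℝ 1 β := β.contDiff
  let φ : ℝ × ℝ → ℝ := fun p => α (p.1 / p.2) * β p.2
  have hφ : ContDiff ℝ 1 φ := by
    rw [contDiff_iff_contDiffAt]
    intro p
    by_cases hp : p.2 < 1
    · have : φ =ᶠ[𝓝 p] fun _ => 0 := by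
        filter_upwards [continuous_snd.continuousAt.eventually (gt_mem_nhds hp)] with q hq
        simp only [φ, hβ0 q.2 (fun h => by linarith [h.1]), mul_zero]
      exact contDiffAt_const.congr_of_eventuallyEq this
    · have hp0 : p.2 ≠ 0 := by intro h; rw [h] at hp; norm_num at hp
      exact (hα.contDiffAt.comp p (contDiffAt_fst.div contDiffAt_snd hp0)).mul
        (hβ.contDiffAt.comp p contDiffAt_snd)
  have hsupp : Function.support φ ⊆ {p | p.2 ∈ Icc (1 : ℝ) 3} ∩ (fun p => p.1 / p.2) ⁻¹'
      (tsupport α) := by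
    intro p hp
    have h1 : α (p.1 / p.2) ≠ 0 := left_ne_zero_of_mul hp
    have h2 : β p.2 ≠ 0 := right_ne_zero_of_mul hp
    refine ⟨?_, subset_tsupport _ h1⟩
    by_contra hcon
    exact h2 (hβ0 _ fun h => hcon (Ioo_subset_Icc_self h))
  have hclosed : IsClosed ({p : ℝ × ℝ | p.2 ∈ Icc (1 : ℝ) 3} ∩ (fun p => p.1 / p.2) ⁻¹'
      (tsupport α)) := by
    refine ContinuousOn.preimage_isClosed_of_isClosed ?_ (isClosed_Icc.preimage continuous_snd)
      (isClosed_tsupport α)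
    refine continuousOn_fst.div continuousOn_snd fun p hp => ?_
    have : (1 : ℝ) ≤ p.2 := hp.1
    linarith
  have hts := closure_minimal hsupp hclosed
  obtain ⟨R, hR⟩ := hαc.isCompact.isBounded.subset_closedBall (0 : ℝ)
  have hφc : HasCompactSupport φ := by
    refine HasCompactSupport.of_support_subset_isCompact
      (isCompact_Icc.prod isCompact_Icc : IsCompact (Icc (-(3 * R)) (3 * R) ×ˢ Icc (1 : ℝ) 3)) ?_
    intro p hp
    obtain ⟨h1, h2⟩ := hsupp hp
    have h3 : (1 : ℝ) ≤ p.2 ∧ p.2 ≤ 3 := h1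
    have h4 := hR h2
    rw [mem_closedBall_zero_iff, Real.norm_eq_abs, abs_div, abs_of_pos (by linarith : 0 < p.2),
      div_le_iff₀ (by linarith)] at h4
    refine ⟨abs_le.1 (h4.trans ?_), h1⟩
    have : 0 ≤ R := by
      by_contra hneg
      nlinarith [abs_nonneg p.1]
    nlinarith
  refine ⟨φ, hφ, hφc, fun p hp => ?_, fun h0 p => mul_nonneg (h0 _) β.nonneg,
    ∫ t in Ioi (1 / 2 : ℝ), β t, ?_, ?_⟩
  · obtain ⟨h1, h2⟩ := hts hp
    have hp2 : 0 < p.2 := by linarith [(h1 : p.2 ∈ Icc (1 : ℝ) 3).1]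
    exact ⟨(hI.div_mem_iff hp2).1 (hαI h2), hp2⟩
  · have : ∫ t in Ioi (1 / 2 : ℝ), β t = ∫ t, β t := by
      refine setIntegral_eq_integral_of_forall_compl_eq_zero fun t ht => hβ0 t fun h => ht ?_
      simp only [mem_Ioi]; linarith [h.1]
    rw [this]
    exact β.integral_pos
  intro E Q hE hQ C hEC hQC
  have hzero : ∀ p : ℝ × ℝ, p.2 < 1 → φ p = 0 ∧ derivFst φ p = 0 ∧ derivSnd φ p = 0 := by
    intro p hp
    have hnot : p ∉ tsupport φ := fun h => by
      linarith [((hts h).1 : p.2 ∈ Icc (1 : ℝ) 3).1]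
    have hd : fderiv ℝ φ p = 0 := by
      by_contra hne
      exact hnot (support_fderiv_subset ℝ hne)
    exact ⟨image_eq_zero_of_notMem_tsupport hnot, by rw [derivFst_eq hφ, hd]; simp,
      by rw [derivSnd_eq hφ, hd]; simp⟩
  have h1 : ∫ p in I ×ˢ Ioi (0 : ℝ),
      (E (p.1 / p.2) * derivSnd φ p + Q (p.1 / p.2) * derivFst φ p) =
      ∫ p in I ×ˢ Ioi (1 / 2 : ℝ),
      (E (p.1 / p.2) * derivSnd φ p + Q (p.1 / p.2) * derivFst φ p) := by
    refine setIntegral_eq_of_subset_of_forall_sdiff_eq_zero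
      (hI.measurableSet.prod measurableSet_Ioi) (prod_mono le_rfl (Ioi_subset_Ioi (by norm_num)))
      fun p hp => ?_
    have hp2 : p.2 < 1 := by
      by_contra hcon
      exact hp.2 ⟨hp.1.1, by simp only [mem_Ioi]; linarith⟩
    rw [(hzero p hp2).2.1, (hzero p hp2).2.2]; ring
  -- The cutoff 1/2 lies below the support of φ in t, so there is no boundary term.
  rw [h1, integral_weak_eq hI hE hQ hEC hQC hφ hφc (by norm_num)]
  have h2 : ∀ x, E (x / (1 / 2)) * φ (x, 1 / 2) = 0 := fun x => by
    rw [(hzero (x, 1 / 2) (by norm_num)).1, mul_zero]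
  simp only [h2, integral_zero, neg_zero, zero_add]
  rw [← integral_mul_const]
  refine setIntegral_congr_fun measurableSet_Ioi fun t ht => ?_
  have ht0 : 0 < t := by have := mem_Ioi.1 ht; linarith
  simp only [rayBracket]
  rw [← integral_const_mul]
  refine integral_congr_ae (Eventually.of_forall fun ξ => ?_)
  have hd : t * derivFst φ (ξ * t, t) = deriv α ξ * β t := by
    have h3 := hasDerivAt_slice hφ ξ t
    have h4 : (fun ξ => φ (ξ * t, t)) = fun ξ => α ξ * β t := by
      funext ξ
      simp only [φ, mul_div_cancel_right₀ ξ ht0.ne']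
    rw [h4] at h3
    exact h3.unique ((hα.differentiable one_ne_zero ξ).hasDerivAt.mul_const _)
  simp only [hd]
  simp only [φ, mul_div_cancel_right₀ ξ ht0.ne']
  ring

/-! ### The graph of the discontinuous flux -/

namespace DiscFlux

variable (F : DiscFlux)

theorem continuousOn_f1 : ContinuousOn F.f1 (Icc 0 F.ustar) := F.f1_smooth.continuousOn

theorem strictMonoOn_f1 : StrictMonoOn F.f1 (Icc 0 F.ustar) :=
  strictMonoOn_of_deriv_pos (convex_Icc _ _) F.continuousOn_f1 fun x hx => by
    rw [interior_Icc] at hx; exact F.f1_deriv x hx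

theorem strictAntiOn_f2 : StrictAntiOn F.f2 (Icc F.ustar F.umax) :=
  strictAntiOn_of_deriv_neg (convex_Icc _ _) F.f2_cont fun x hx => by
    rw [interior_Icc] at hx; exact F.f2_deriv x hx

theorem zero_mem : (0 : ℝ) ∈ Icc 0 F.ustar := ⟨le_rfl, F.ustar_pos.le⟩

theorem ustar_mem_left : F.ustar ∈ Icc 0 F.ustar := ⟨F.ustar_pos.le, le_rfl⟩

theorem ustar_mem_right : F.ustar ∈ Icc F.ustar F.umax := ⟨le_rfl, F.ustar_lt.le⟩

theorem umax_mem : F.umax ∈ Icc F.ustar F.umax := ⟨F.ustar_lt.le, le_rfl⟩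

theorem f2_ustar_pos : 0 < F.f2 F.ustar := by
  have := F.strictAntiOn_f2 F.ustar_mem_right F.umax_mem F.ustar_lt
  rwa [F.f2_umax] at this

theorem f_of_le {u : ℝ} (h : u ≤ F.ustar) : F.f u = F.f1 u := if_pos h

theorem f_of_gt {u : ℝ} (h : F.ustar < u) : F.f u = F.f2 u := if_neg (not_le.2 h)

theorem mem_graph_of_lt {u v : ℝ} (h : u < F.ustar) :
    (u, v) ∈ F.graph ↔ 0 ≤ u ∧ v = F.f1 u := by
  simp only [graph, mem_ofPred_eq, mem_Icc, F.f_of_le h.le]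
  constructor
  · rintro ⟨h1, h2, -⟩
    exact ⟨h1.1, h2 h.ne⟩
  · rintro ⟨h1, h2⟩
    exact ⟨⟨h1, h.le.trans F.ustar_lt.le⟩, fun _ => h2, fun h' => absurd h' h.ne⟩

theorem mem_graph_of_gt {u v : ℝ} (h : F.ustar < u) :
    (u, v) ∈ F.graph ↔ u ≤ F.umax ∧ v = F.f2 u := by
  simp only [graph, mem_ofPred_eq, mem_Icc, F.f_of_gt h]
  constructor
  · rintro ⟨h1, h2, -⟩
    exact ⟨h1.2, h2 h.ne'⟩
  · rintro ⟨h1, h2⟩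
    exact ⟨⟨F.ustar_pos.le.trans h.le, h1⟩, fun _ => h2, fun h' => absurd h' h.ne'⟩

theorem mem_graph_ustar {v : ℝ} :
    (F.ustar, v) ∈ F.graph ↔ v ∈ Icc (F.f2 F.ustar) (F.f1 F.ustar) := by
  simp only [graph, mem_ofPred_eq]
  constructor
  · rintro ⟨-, -, h⟩
    exact h trivial
  · intro h
    exact ⟨⟨F.ustar_pos.le, F.ustar_lt.le⟩, fun h => absurd rfl h, fun _ => h⟩

/-- Three continuous images of compact intervals, for the sake of compactness; the closed right
branch fits because its left end lies on the vertical segment. -/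
theorem graph_eq : F.graph = (fun k => (k, F.f1 k)) '' Icc 0 F.ustar ∪
    (fun k => (k, F.f2 k)) '' Icc F.ustar F.umax ∪
    (fun v => (F.ustar, v)) '' Icc (F.f2 F.ustar) (F.f1 F.ustar) := by
  ext ⟨u, v⟩
  simp only [mem_union, mem_image, Prod.mk.injEq]
  rcases lt_trichotomy u F.ustar with h | rfl | h
  · rw [F.mem_graph_of_lt h]
    constructor
    · rintro ⟨h1, rfl⟩
      exact Or.inl (Or.inl ⟨u, ⟨h1, h.le⟩, rfl, rfl⟩)
    · rintro ((⟨k, hk, rfl, rfl⟩ | ⟨k, hk, rfl, rfl⟩) | ⟨k, hk, rfl, rfl⟩)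
      · exact ⟨hk.1, rfl⟩
      · exact absurd hk.1 (not_le.2 h)
      · exact absurd h (lt_irrefl _)
  · rw [F.mem_graph_ustar]
    constructor
    · intro h
      exact Or.inr ⟨v, h, rfl, rfl⟩
    · rintro ((⟨k, hk, rfl, rfl⟩ | ⟨k, hk, rfl, rfl⟩) | ⟨k, hk, -, rfl⟩)
      · exact ⟨F.jump.le, le_rfl⟩
      · exact ⟨le_rfl, F.jump.le⟩
      · exact hk
  · rw [F.mem_graph_of_gt h]
    constructor
    · rintro ⟨h1, rfl⟩
      exact Or.inl (Or.inr ⟨u, ⟨h.le, h1⟩, rfl, rfl⟩)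
    · rintro ((⟨k, hk, rfl, rfl⟩ | ⟨k, hk, rfl, rfl⟩) | ⟨k, hk, rfl, rfl⟩)
      · exact absurd hk.2 (not_le.2 h)
      · exact ⟨hk.2, rfl⟩
      · exact absurd h (lt_irrefl _)

theorem isCompact_graph : IsCompact F.graph := by
  rw [graph_eq]
  exact ((isCompact_Icc.image_of_continuousOn (continuousOn_id.prodMk F.continuousOn_f1)).union
    (isCompact_Icc.image_of_continuousOn (continuousOn_id.prodMk F.f2_cont))).union
    (isCompact_Icc.image (by fun_prop))

theorem tendsto_f_right : Tendsto F.f (𝓝[>] F.ustar) (𝓝 (F.f2 F.ustar)) := by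
  have h : Tendsto F.f2 (𝓝[>] F.ustar) (𝓝 (F.f2 F.ustar)) := by
    rw [← nhdsWithin_Ioc_eq_nhdsGT F.ustar_lt]
    exact (F.f2_cont F.ustar F.ustar_mem_right).mono_left (nhdsWithin_mono _ Ioc_subset_Icc_self)
  refine h.congr' ?_
  filter_upwards [self_mem_nhdsWithin] with k hk
  exact (F.f_of_gt hk).symm

theorem tendsto_f_left : Tendsto F.f (𝓝[<] F.ustar) (𝓝 (F.f1 F.ustar)) := by
  have h : Tendsto F.f1 (𝓝[<] F.ustar) (𝓝 (F.f1 F.ustar)) := by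
    rw [← nhdsWithin_Ico_eq_nhdsLT F.ustar_pos]
    exact (F.continuousOn_f1 F.ustar F.ustar_mem_left).mono_left
      (nhdsWithin_mono _ Ico_subset_Icc_self)
  refine h.congr' ?_
  filter_upwards [self_mem_nhdsWithin] with k hk
  exact (F.f_of_le (le_of_lt hk)).symm

theorem isJumpGraph : IsJumpGraph F.graph F.f F.ustar 0 F.umax where
  isCompact := F.isCompact_graph
  mem_Icc _ hp := hp.1
  eq_of_ne _ hp hc := hp.2.1 hc
  mem_of_ne _ hk hc := ⟨hk, fun _ => rfl, fun h => absurd h hc⟩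
  exists_right _ hp hc := ⟨_, (hp.2.2 hc).1, F.tendsto_f_right⟩
  exists_left _ hp hc := ⟨_, (hp.2.2 hc).2, F.tendsto_f_left⟩

theorem exists_bound : ∃ C, 0 ≤ C ∧ ∀ p ∈ F.graph, |p.1| ≤ C ∧ |p.2| ≤ C := by
  obtain ⟨C, hC⟩ := F.isCompact_graph.isBounded.subset_closedBall (0 : ℝ × ℝ)
  refine ⟨max C 0, le_max_right _ _, fun p hp => ?_⟩
  have := hC hp
  rw [mem_closedBall_zero_iff, Prod.norm_def, max_le_iff, Real.norm_eq_abs,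
    Real.norm_eq_abs] at this
  exact ⟨this.1.trans (le_max_left _ _), this.2.trans (le_max_left _ _)⟩

end DiscFlux

/-! ### One-dimensional form of the entropy inequality and the conservation law -/

theorem countable_not_continuousAt_of_bv {I : Set ℝ} (hI : IsOpen I) {h : ℝ → ℝ}
    (hb : BoundedVariationOn h I) : {ξ ∈ I | ¬ ContinuousAt h ξ}.Countable := by
  obtain ⟨p, q, hp, hq, rfl⟩ := hb.locallyBoundedVariationOn.exists_monotoneOn_sub_monotoneOn
  refine (hp.countable_not_continuousWithinAt.union hq.countable_not_continuousWithinAt).mono ?_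
  rintro ξ ⟨hξ, hc⟩
  by_contra hcon
  simp only [mem_union, mem_ofPred_eq, not_or, not_and, not_not] at hcon
  exact hc (((hcon.1 hξ).continuousAt (hI.mem_nhds hξ)).sub
    ((hcon.2 hξ).continuousAt (hI.mem_nhds hξ)))

theorem locallyIntegrable_of_bounded {h : ℝ → ℝ} (hm : AEStronglyMeasurable h volume) {C : ℝ}
    (hb : ∀ᵐ ξ, |h ξ| ≤ C) : LocallyIntegrable h volume := by
  have : LocallyIntegrable (fun _ : ℝ => C) volume := continuous_const.locallyIntegrable
  refine this.mono hm ?_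
  filter_upwards [hb] with ξ hξ
  exact hξ.trans (le_abs_self C)

theorem locallyIntegrable_id_mul {h : ℝ → ℝ} (hm : AEStronglyMeasurable h volume) {C : ℝ}
    (hb : ∀ᵐ ξ, |h ξ| ≤ C) : LocallyIntegrable (fun ξ => ξ * h ξ) volume := by
  have : LocallyIntegrable (fun ξ : ℝ => C * ξ) volume :=
    (continuous_const.mul continuous_id).locallyIntegrable
  refine this.mono (continuous_id.aestronglyMeasurable.mul hm) ?_
  filter_upwards [hb] with ξ hξ
  rw [norm_mul, norm_mul, mul_comm ‖C‖]
  exact mul_le_mul_of_nonneg_left (hξ.trans (le_abs_self C)) (norm_nonneg _)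

/-- A one-dimensional entropy inequality yields monotonicity on a set of full measure. -/
theorem exists_antitoneOn_of_entropy {I : Set ℝ} (hI : IsOpen I) (hIc : I.OrdConnected)
    {E Q : ℝ → ℝ} (hE : AEStronglyMeasurable E volume) (hQ : AEStronglyMeasurable Q volume) {C : ℝ}
    (hEC : ∀ᵐ ξ, |E ξ| ≤ C) (hQC : ∀ᵐ ξ, |Q ξ| ≤ C) (hE0 : ∀ ξ, 0 ≤ E ξ)
    (h : ∀ α : ℝ → ℝ, ContDiff ℝ 1 α → HasCompactSupport α → tsupport α ⊆ I → (∀ x, 0 ≤ α x) →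
      0 ≤ ∫ ξ in I, ((Q ξ - ξ * E ξ) * deriv α ξ - E ξ * α ξ)) :
    ∃ T ⊆ I, volume (I \ T) = 0 ∧ AntitoneOn (fun ξ => Q ξ - ξ * E ξ) T := by
  have hloc : LocallyIntegrable (fun ξ => Q ξ - ξ * E ξ) volume :=
    (locallyIntegrable_of_bounded hQ hQC).sub (locallyIntegrable_id_mul hE hEC)
  refine exists_antitoneOn_of_integral_nonneg hI hIc hloc fun α hα hαc hαI hα0 => ?_
  have h1 : Integrable fun ξ => (Q ξ - ξ * E ξ) * deriv α ξ :=
    hloc.integrable_smul_right_of_hasCompactSupport (hα.continuous_deriv le_rfl) hαc.deriv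
  have h2 : Integrable fun ξ => E ξ * α ξ :=
    (locallyIntegrable_of_bounded hE hEC).integrable_smul_right_of_hasCompactSupport
      hα.continuous hαc
  have h3 := h α hα hαc hαI hα0
  rw [integral_sub h1.integrableOn h2.integrableOn] at h3
  -- The zeroth-order term has a sign, so it can be dropped.
  have h4 : 0 ≤ ∫ ξ in I, E ξ * α ξ := integral_nonneg fun ξ => mul_nonneg (hE0 ξ) (hα0 ξ)
  have h5 : ∫ ξ in I, (Q ξ - ξ * E ξ) * deriv α ξ = ∫ ξ, (Q ξ - ξ * E ξ) * deriv α ξ := by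
    refine setIntegral_eq_integral_of_forall_compl_eq_zero fun ξ hξ => ?_
    have : deriv α ξ = 0 := by
      by_contra hne
      exact hξ (hαI (support_deriv_subset hne))
    rw [this, mul_zero]
  linarith

/-- A distributional solution of `W' = -U` equals an indefinite integral almost everywhere. -/
theorem exists_primitive {I : Set ℝ} (hI : IsOpen I) (hIc : I.OrdConnected) {U V : ℝ → ℝ}
    (hU : AEStronglyMeasurable U volume) (hV : AEStronglyMeasurable V volume) {C : ℝ}
    (hUC : ∀ᵐ ξ, |U ξ| ≤ C) (hVC : ∀ᵐ ξ, |V ξ| ≤ C)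
    (hN : {ξ ∈ I | ¬ ContinuousAt U ξ}.Countable)
    (h : ∀ α : ℝ → ℝ, ContDiff ℝ 1 α → HasCompactSupport α → tsupport α ⊆ I →
      ∫ ξ in I, ((V ξ - ξ * U ξ) * deriv α ξ - U ξ * α ξ) = 0) :
    ∃ c, ∃ T ⊆ I, volume (I \ T) = 0 ∧ ∀ ξ ∈ T, V ξ - ξ * U ξ = c - ∫ s in (0 : ℝ)..ξ, U s := by
  have hUloc := locallyIntegrable_of_bounded hU hUC
  have hUi : ∀ x y, IntervalIntegrable U volume x y := fun x y =>
    (hUloc.integrableOn_isCompact isCompact_uIcc).intervalIntegrable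
  set P : ℝ → ℝ := fun ξ => ∫ s in (0 : ℝ)..ξ, U s with hP
  have hPc : Continuous P := intervalIntegral.continuous_primitive hUi 0
  have hPd : ∀ ξ ∈ I, ContinuousAt U ξ → HasDerivAt P (U ξ) ξ := fun ξ _ hc =>
    intervalIntegral.integral_hasDerivAt_right (hUi _ _) hU.stronglyMeasurableAtFilter hc
  have hloc : LocallyIntegrable (fun ξ => V ξ - ξ * U ξ) volume :=
    (locallyIntegrable_of_bounded hV hVC).sub (locallyIntegrable_id_mul hU hUC)
  -- With P a primitive of U, the function V - ξU + P has zero distributional derivative. Applied to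
  -- it and to its negative, the monotonicity criterion makes it constant off a null set.
  have hzero : ∀ α : ℝ → ℝ, ContDiff ℝ 1 α → HasCompactSupport α → tsupport α ⊆ I →
      ∫ ξ, (V ξ - ξ * U ξ + P ξ) * deriv α ξ = 0 := by
    intro α hα hαc hαI
    have h1 : Integrable fun ξ => (V ξ - ξ * U ξ) * deriv α ξ :=
      hloc.integrable_smul_right_of_hasCompactSupport (hα.continuous_deriv le_rfl) hαc.deriv
    have h2 : Integrable fun ξ => U ξ * α ξ :=
      hUloc.integrable_smul_right_of_hasCompactSupport hα.continuous hαc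
    have h3 : Integrable fun ξ => P ξ * deriv α ξ :=
      hPc.locallyIntegrable.integrable_smul_right_of_hasCompactSupport
        (hα.continuous_deriv le_rfl) hαc.deriv
    have hout : ∀ ξ, ξ ∉ tsupport α → α ξ = 0 ∧ deriv α ξ = 0 := fun ξ hξ =>
      ⟨image_eq_zero_of_notMem_tsupport hξ, by
        by_contra hne
        exact hξ (support_deriv_subset hne)⟩
    have h4 := h α hα hαc hαI
    rw [setIntegral_eq_integral_of_forall_compl_eq_zero (fun ξ hξ => by
      obtain ⟨h5, h6⟩ := hout ξ fun h => hξ (hαI h)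
      rw [h5, h6]; ring), integral_sub h1 h2] at h4
    rcases (tsupport α).eq_empty_or_nonempty with he | hne
    · have : ∀ ξ, (V ξ - ξ * U ξ + P ξ) * deriv α ξ = 0 := fun ξ => by
        rw [(hout ξ (by rw [he]; exact notMem_empty ξ)).2, mul_zero]
      simp [this]
    obtain ⟨m, hm⟩ := hαc.isCompact.exists_isLeast hne
    obtain ⟨M, hM⟩ := hαc.isCompact.exists_isGreatest hne
    obtain ⟨r, hr, hmr⟩ := Metric.isOpen_iff.1 hI m (hαI hm.1)
    obtain ⟨r', hr', hMr⟩ := Metric.isOpen_iff.1 hI M (hαI hM.1)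
    -- An interval slightly larger than the support still lies in I, and α vanishes at its ends.
    have hmI : m - r / 2 ∈ I := hmr (by
      rw [Real.ball_eq_Ioo]; constructor <;> linarith)
    have hMI : M + r' / 2 ∈ I := hMr (by
      rw [Real.ball_eq_Ioo]; constructor <;> linarith)
    have hmM : m ≤ M := hm.2 hM.1
    have hle : m - r / 2 ≤ M + r' / 2 := by linarith
    have hsub : Icc (m - r / 2) (M + r' / 2) ⊆ I := hIc.out hmI hMI
    have h5 := integral_mul_deriv_sub (U := fun ξ => -U ξ) (W := P) (α := α) hN (x := m - r / 2)
      (y := M + r' / 2) hPc.continuousOn (fun s hs => by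
        rw [min_eq_left hle, max_eq_right hle] at hs
        have hsI := hsub (Ioo_subset_Icc_self hs.1)
        rw [neg_neg]
        refine hPd s hsI ?_
        by_contra hcon
        exact hs.2 ⟨hsI, hcon⟩) (hUi _ _).neg hα
    have hα1 : α (m - r / 2) = 0 := (hout _ fun h => by linarith [hm.2 h]).1
    have hα2 : α (M + r' / 2) = 0 := (hout _ fun h => by linarith [hM.2 h]).1
    rw [hα1, hα2, intervalIntegral.integral_of_le hle,
      setIntegral_eq_integral_of_forall_compl_eq_zero (fun ξ hξ => by
        obtain ⟨h5, h6⟩ := hout ξ fun h => hξ ⟨by linarith [hm.2 h], by linarith [hM.2 h]⟩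
        rw [h5, h6]; ring)] at h5
    have h6 : ∫ ξ, (P ξ * deriv α ξ - -U ξ * α ξ) = (∫ ξ, P ξ * deriv α ξ) + ∫ ξ, U ξ * α ξ := by
      rw [← integral_add h3 h2]
      exact integral_congr_ae (Eventually.of_forall fun ξ => by simp only; ring)
    have h7 : ∫ ξ, (V ξ - ξ * U ξ + P ξ) * deriv α ξ =
        (∫ ξ, (V ξ - ξ * U ξ) * deriv α ξ) + ∫ ξ, P ξ * deriv α ξ := by
      rw [← integral_add h1 h3]
      exact integral_congr_ae (Eventually.of_forall fun ξ => by simp only; ring)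
    linarith
  have hloc' : LocallyIntegrable (fun ξ => V ξ - ξ * U ξ + P ξ) volume :=
    hloc.add hPc.locallyIntegrable
  obtain ⟨T, hTI, hT, hTa⟩ := exists_antitoneOn_of_integral_nonneg hI hIc hloc'
    fun α h1 h2 h3 _ => (hzero α h1 h2 h3).ge
  obtain ⟨T', hTI', hT', hTa'⟩ := exists_antitoneOn_of_integral_nonneg hI hIc hloc'.neg
    fun α h1 h2 h3 _ => by
      have := hzero α h1 h2 h3
      simp only [Pi.neg_apply, neg_mul, integral_neg, this, neg_zero, le_refl]
  have hnull : volume (I \ (T ∩ T')) = 0 := by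
    rw [sdiff_inter]; exact measure_union_null hT hT'
  rcases (T ∩ T').eq_empty_or_nonempty with he | ⟨ξ₀, hξ₀⟩
  · exact ⟨0, T ∩ T', inter_subset_left.trans hTI, hnull, fun ξ hξ => by rw [he] at hξ; exact hξ.elim⟩
  · refine ⟨V ξ₀ - ξ₀ * U ξ₀ + P ξ₀, T ∩ T', inter_subset_left.trans hTI, hnull, fun ξ hξ => ?_⟩
    have hconst : ∀ x ∈ T ∩ T', ∀ y ∈ T ∩ T', x ≤ y →
        V x - x * U x + P x = V y - y * U y + P y := by
      intro x hx y hy hxy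
      have h1 := hTa hx.1 hy.1 hxy
      have h2 := hTa' hx.2 hy.2 hxy
      simp only [Pi.neg_apply] at h1 h2
      linarith
    rcases le_total ξ ξ₀ with h1 | h1
    · linarith [hconst ξ hξ ξ₀ hξ₀ h1]
    · linarith [hconst ξ₀ hξ₀ ξ hξ h1]

/-! ### From road solutions to profiles -/

namespace DiscFlux

variable {F : DiscFlux} {I : Set ℝ} {u v : ℝ → ℝ → ℝ}

theorem RoadAdmissible.eq_slice (h : F.RoadAdmissible I u v) (hI : IsCone I) {x t : ℝ}
    (hx : x ∈ I) (ht : 0 < t) : u x t = (I.indicator fun ξ => u ξ 1) (x / t) ∧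
      v x t = (I.indicator fun ξ => v ξ 1) (x / t) := by
  have hxt : x / t ∈ I := (hI.div_mem_iff ht).2 hx
  have := h.selfSimilar (x / t) hxt 1 one_pos t ht
  rw [mul_div_cancel₀ _ ht.ne', mul_one] at this
  rw [indicator_of_mem hxt, indicator_of_mem hxt]
  exact this

theorem RoadAdmissible.ae_mem (h : F.RoadAdmissible I u v) (hI : IsCone I) :
    ∀ᵐ ξ ∂(volume.restrict I), ((I.indicator fun ξ => u ξ 1) ξ, (I.indicator fun ξ => v ξ 1) ξ) ∈
      F.graph := by
  refine hI.ae_of_ae_prod (P := fun ξ => ((I.indicator fun ξ => u ξ 1) ξ,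
    (I.indicator fun ξ => v ξ 1) ξ) ∈ F.graph) ?_
  filter_upwards [h.selection, ae_restrict_mem (hI.measurableSet.prod measurableSet_Ioi)] with p hp
    hpI
  obtain ⟨h1, h2⟩ := h.eq_slice hI hpI.1 hpI.2
  rw [← h1, ← h2]
  exact hp

/-- Bounded Borel representatives of density and flux as functions of `x / t`. -/
theorem RoadAdmissible.exists_rep (h : F.RoadAdmissible I u v) (hI : IsCone I) :
    ∃ U V : ℝ → ℝ, Measurable U ∧ Measurable V ∧ (∃ C, 0 ≤ C ∧ ∀ ξ, |U ξ| ≤ C ∧ |V ξ| ≤ C) ∧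
      (∀ᵐ ξ, U ξ = (I.indicator fun ξ => u ξ 1) ξ) ∧
      (∀ᵐ ξ, V ξ = (I.indicator fun ξ => v ξ 1) ξ) ∧
      ∀ᵐ p ∂(volume.restrict (I ×ˢ Ioi (0 : ℝ))),
        u p.1 p.2 = U (p.1 / p.2) ∧ v p.1 p.2 = V (p.1 / p.2) := by
  obtain ⟨C, hC0, hC⟩ := F.exists_bound
  have hmem := h.ae_mem hI
  rw [ae_restrict_iff' hI.measurableSet] at hmem
  have hUm := hI.aestronglyMeasurable_slice h.u_meas fun x hx t ht c hc =>
    (h.selfSimilar x hx t ht c hc).1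
  have hVm := hI.aestronglyMeasurable_slice h.v_meas fun x hx t ht c hc =>
    (h.selfSimilar x hx t ht c hc).2
  obtain ⟨U, hU, hUC, hUe⟩ := exists_measurable_bounded hUm hC0 (by
    filter_upwards [hmem] with ξ hξ
    by_cases hξI : ξ ∈ I
    · exact (hC _ (hξ hξI)).1
    · rw [indicator_of_notMem hξI, abs_zero]; exact hC0)
  obtain ⟨V, hV, hVC, hVe⟩ := exists_measurable_bounded hVm hC0 (by
    filter_upwards [hmem] with ξ hξ
    by_cases hξI : ξ ∈ I
    · exact (hC _ (hξ hξI)).2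
    · rw [indicator_of_notMem hξI, abs_zero]; exact hC0)
  refine ⟨U, V, hU, hV, ⟨C, hC0, fun ξ => ⟨hUC ξ, hVC ξ⟩⟩, hUe, hVe, ?_⟩
  have h1 := hI.ae_prod_of_ae (ae_restrict_of_ae (hUe.and hVe))
  filter_upwards [h1, ae_restrict_mem (hI.measurableSet.prod measurableSet_Ioi)] with p hp hpI
  rw [hp.1, hp.2]
  exact h.eq_slice hI hpI.1 hpI.2

/-- The conservation law in the interior of a road. -/
def IsInteriorWeak (I : Set ℝ) (u v : ℝ → ℝ → ℝ) : Prop :=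
  ∀ φ : ℝ × ℝ → ℝ, ContDiff ℝ 1 φ → HasCompactSupport φ → tsupport φ ⊆ I ×ˢ Ioi (0 : ℝ) →
    ∫ p in I ×ˢ Ioi (0 : ℝ), (u p.1 p.2 * derivSnd φ p + v p.1 p.2 * derivFst φ p) = 0

theorem integral_eq_zero_of_isInteriorWeak (hI : IsCone I) (hw : IsInteriorWeak I u v)
    {U V : ℝ → ℝ} (hU : Measurable U) (hV : Measurable V) {C : ℝ}
    (hC : ∀ ξ, |U ξ| ≤ C ∧ |V ξ| ≤ C)
    (hp : ∀ᵐ p ∂(volume.restrict (I ×ˢ Ioi (0 : ℝ))),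
        u p.1 p.2 = U (p.1 / p.2) ∧ v p.1 p.2 = V (p.1 / p.2))
    {α : ℝ → ℝ} (hα : ContDiff ℝ 1 α) (hαc : HasCompactSupport α) (hαI : tsupport α ⊆ I) :
    ∫ ξ in I, ((V ξ - ξ * U ξ) * deriv α ξ - U ξ * α ξ) = 0 := by
  obtain ⟨φ, h1, h2, h3, -, κ, hκ, h4⟩ := exists_product_test hI hα hαc hαI
  have h5 := h4 U V hU hV C (fun ξ => (hC ξ).1) fun ξ => (hC ξ).2
  have h6 := hw φ h1 h2 h3
  rw [integral_congr_ae (g := fun p : ℝ × ℝ =>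
    U (p.1 / p.2) * derivSnd φ p + V (p.1 / p.2) * derivFst φ p)
    (by filter_upwards [hp] with p hp; rw [hp.1, hp.2])] at h6
  rw [h6] at h5
  exact (mul_eq_zero.1 h5.symm).resolve_left hκ.ne'

theorem RoadAdmissible.integral_entropy_nonneg (h : F.RoadAdmissible I u v) (hI : IsCone I)
    {U V : ℝ → ℝ} (hU : Measurable U) (hV : Measurable V) {C : ℝ}
    (hC : ∀ ξ, |U ξ| ≤ C ∧ |V ξ| ≤ C)
    (hp : ∀ᵐ p ∂(volume.restrict (I ×ˢ Ioi (0 : ℝ))),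
        u p.1 p.2 = U (p.1 / p.2) ∧ v p.1 p.2 = V (p.1 / p.2))
    {k : ℝ} (hk : k ∈ Icc 0 F.umax) (hkc : k ≠ F.ustar)
    {α : ℝ → ℝ} (hα : ContDiff ℝ 1 α) (hαc : HasCompactSupport α) (hαI : tsupport α ⊆ I)
    (hα0 : ∀ x, 0 ≤ α x) :
    0 ≤ ∫ ξ in I, ((Real.sign (U ξ - k) * (V ξ - F.f k) - ξ * |U ξ - k|) * deriv α ξ -
      |U ξ - k| * α ξ) := by
  obtain ⟨φ, h1, h2, h3, h0, κ, hκ, h4⟩ := exists_product_test hI hα hαc hαI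
  have h5 := h4 (fun ξ => |U ξ - k|) (fun ξ => Real.sign (U ξ - k) * (V ξ - F.f k))
    (continuous_abs.measurable.comp (hU.sub measurable_const))
    ((measurable_sign.comp (hU.sub measurable_const)).mul (hV.sub measurable_const))
    (C + |k| + |F.f k|) (fun ξ => by
      rw [abs_abs]
      linarith [abs_sub (U ξ) k, (hC ξ).1, abs_nonneg (F.f k)])
    (fun ξ => by
      rw [abs_mul]
      have := abs_sub (V ξ) (F.f k)
      nlinarith [abs_sign_le (U ξ - k), abs_nonneg (V ξ - F.f k), (hC ξ).2, abs_nonneg k,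
        abs_nonneg (Real.sign (U ξ - k))])
  have h6 := h.entropy k hk hkc φ h1 h2 h3 (h0 hα0)
  rw [integral_congr_ae (g := fun p : ℝ × ℝ => |U (p.1 / p.2) - k| * derivSnd φ p +
    (Real.sign (U (p.1 / p.2) - k) * (V (p.1 / p.2) - F.f k)) * derivFst φ p)
    (by filter_upwards [hp] with p hp; rw [hp.1, hp.2]; rfl), h5] at h6
  exact nonneg_of_mul_nonneg_right h6 hκ

theorem countable_not_continuousAt_indicator (hIo : IsOpen I) {g : ℝ → ℝ}
    (hb : BoundedVariationOn g I) : {ξ ∈ I | ¬ ContinuousAt (I.indicator g) ξ}.Countable := by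
  refine (countable_not_continuousAt_of_bv hIo hb).mono ?_
  rintro ξ ⟨hξ, hc⟩
  refine ⟨hξ, fun hg => hc (hg.congr ?_)⟩
  filter_upwards [hIo.mem_nhds hξ] with η hη
  exact (indicator_of_mem hη _).symm

theorem null_of_ae {P : ℝ → Prop} (hI : MeasurableSet I) (h : ∀ᵐ ξ ∂(volume.restrict I), P ξ) :
    volume (I \ {ξ | P ξ}) = 0 := by
  rw [ae_restrict_iff' hI, ae_iff] at h
  refine measure_mono_null (fun ξ hξ => ?_) h
  simp only [mem_ofPred_eq, Classical.not_imp]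
  exact hξ

/-- A self-similar entropy solution on a road gives a profile in the variable `x / t`. -/
theorem RoadAdmissible.exists_profile (h : F.RoadAdmissible I u v) (hI : IsCone I)
    (hIo : IsOpen I) (hIc : I.OrdConnected) (hw : IsInteriorWeak I u v) :
    ∃ S W, IsProfile F.graph F.f F.ustar 0 F.umax I S (I.indicator fun ξ => u ξ 1)
      (I.indicator fun ξ => v ξ 1) W := by
  obtain ⟨U, V, hU, hV, ⟨C, hC0, hC⟩, hUe, hVe, hp⟩ := h.exists_rep hI
  set U₀ := I.indicator fun ξ => u ξ 1 with hU₀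
  set V₀ := I.indicator fun ξ => v ξ 1 with hV₀
  have hN : {ξ ∈ I | ¬ ContinuousAt U₀ ξ}.Countable :=
    countable_not_continuousAt_indicator hIo (h.bv 1 one_pos)
  have hU₀m : AEStronglyMeasurable U₀ volume := hU.aestronglyMeasurable.congr hUe
  have hV₀m : AEStronglyMeasurable V₀ volume := hV.aestronglyMeasurable.congr hVe
  have hU₀C : ∀ᵐ ξ, |U₀ ξ| ≤ C := by filter_upwards [hUe] with ξ hξ; rw [← hξ]; exact (hC ξ).1
  have hV₀C : ∀ᵐ ξ, |V₀ ξ| ≤ C := by filter_upwards [hVe] with ξ hξ; rw [← hξ]; exact (hC ξ).2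
  have hUi : ∀ x y, IntervalIntegrable U₀ volume x y := fun x y =>
    ((locallyIntegrable_of_bounded hU₀m hU₀C).integrableOn_isCompact
      isCompact_uIcc).intervalIntegrable
  obtain ⟨c, T, hTI, hT, hTc⟩ := exists_primitive hIo hIc hU₀m hV₀m hU₀C hV₀C hN
    fun α h1 h2 h3 => by
      rw [← integral_eq_zero_of_isInteriorWeak hI hw hU hV hC hp h1 h2 h3]
      refine integral_congr_ae (ae_restrict_of_ae ?_)
      filter_upwards [hUe, hVe] with ξ h4 h5
      rw [h4, h5]
  -- The integral identities use the Borel representatives U, V, while continuity is available for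
  -- U₀; on S the representatives coincide with U₀, V₀.
  set S : Set ℝ := {ξ ∈ T | ContinuousAt U₀ ξ ∧ (U₀ ξ, V₀ ξ) ∈ F.graph ∧ U ξ = U₀ ξ ∧ V ξ = V₀ ξ}
    with hS
  have hSnull : volume (I \ S) = 0 := by
    have h1 := measure_union_null (measure_union_null hT (hN.measure_zero volume))
      (measure_union_null (null_of_ae hI.measurableSet (h.ae_mem hI))
      (null_of_ae hI.measurableSet (ae_restrict_of_ae (hUe.and hVe))))
    refine measure_mono_null (fun ξ hξ => ?_) h1
    by_contra hcon
    simp only [mem_union, Set.mem_sdiff, mem_ofPred_eq, not_or, not_and, not_not] at hcon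
    exact hξ.2 ⟨hcon.1.1 hξ.1, hcon.1.2 hξ.1, hcon.2.1 hξ.1, by simpa using hcon.2.2 hξ.1⟩
  refine ⟨S, fun ξ => c - ∫ s in (0 : ℝ)..ξ, U₀ s, ?_⟩
  refine ⟨F.isJumpGraph, hIo, hIc, fun ξ hξ => hTI hξ.1, hSnull, fun ξ hξ => hξ.2.1,
    fun _ _ _ _ => hUi _ _,
    (continuous_const.sub (intervalIntegral.continuous_primitive hUi 0)).continuousOn,
    fun ξ hξ => hξ.2.2.1, fun ξ hξ => hTc ξ hξ.1, fun ξ _ η _ => ?_, fun k hk hkc => ?_⟩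
  · have := intervalIntegral.integral_interval_sub_left (hUi 0 η) (hUi 0 ξ)
    linarith
  · obtain ⟨T', hT'I, hT', hA⟩ := exists_antitoneOn_of_entropy hIo hIc
      (E := fun ξ => |U ξ - k|) (Q := fun ξ => Real.sign (U ξ - k) * (V ξ - F.f k))
      (C := C + |k| + |F.f k|)
      (continuous_abs.measurable.comp (hU.sub measurable_const)).aestronglyMeasurable
      ((measurable_sign.comp (hU.sub measurable_const)).mul
        (hV.sub measurable_const)).aestronglyMeasurable
      (Eventually.of_forall fun ξ => by
        rw [abs_abs]
        linarith [abs_sub (U ξ) k, (hC ξ).1, abs_nonneg (F.f k)])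
      (Eventually.of_forall fun ξ => by
        rw [abs_mul]
        have := abs_sub (V ξ) (F.f k)
        nlinarith [abs_sign_le (U ξ - k), abs_nonneg (V ξ - F.f k), (hC ξ).2, abs_nonneg k,
          abs_nonneg (Real.sign (U ξ - k))])
      (fun ξ => abs_nonneg _)
      fun α h1 h2 h3 h4 => h.integral_entropy_nonneg hI hU hV hC hp hk hkc h1 h2 h3 h4
    refine ⟨T' ∩ S, inter_subset_right, ?_, fun ξ hξ η hη hle => ?_⟩
    · rw [sdiff_inter]
      exact measure_union_null hT' hSnull
    · have h1 := hA hξ.1 hη.1 hle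
      -- Writing |r| as sgn(r) r merges the density and flux terms into the signed gap.
      have key : ∀ s ∈ S, Real.sign (U s - k) * (V s - F.f k) - s * |U s - k| =
          Real.sign (U₀ s - k) * ((c - ∫ r in (0 : ℝ)..s, U₀ r) - (F.f k - s * k)) := by
        intro s hs
        rw [hs.2.2.2.1, hs.2.2.2.2, ← hTc s hs.1, abs_eq_sign_mul]
        ring
      simp only [key ξ hξ.2, key η hη.2] at h1
      exact h1

end DiscFlux

/-! ### Single roads: datum at infinity and end states of the wave -/

section Slice

variable {φ : ℝ × ℝ → ℝ}

theorem contDiff_slice (hφ : ContDiff ℝ 1 φ) (t : ℝ) : ContDiff ℝ 1 fun ξ : ℝ => φ (ξ * t, t) :=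
  hφ.comp (by fun_prop)

theorem deriv_slice (hφ : ContDiff ℝ 1 φ) (t ξ : ℝ) :
    deriv (fun ξ : ℝ => φ (ξ * t, t)) ξ = t * derivFst φ (ξ * t, t) := (hasDerivAt_slice hφ ξ t).deriv

theorem hasCompactSupport_slice (hφ : ContDiff ℝ 1 φ) (hc : HasCompactSupport φ) {t : ℝ}
    (ht : 0 < t) : HasCompactSupport fun ξ : ℝ => φ (ξ * t, t) := by
  obtain ⟨R, hR, hbox⟩ := exists_box hφ hc
  refine HasCompactSupport.of_support_subset_isCompact (K := Icc (-(R / t)) (R / t)) isCompact_Icc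
    fun ξ hξ => ?_
  by_contra hcon
  refine hξ (hbox _ (Or.inl ?_)).1
  have : R / t < |ξ| := not_le.1 fun h => hcon (abs_le.1 h)
  rw [div_lt_iff₀ ht] at this
  rwa [abs_mul, abs_of_pos ht]

theorem tsupport_slice_subset (t : ℝ) :
    tsupport (fun ξ : ℝ => φ (ξ * t, t)) ⊆ (fun ξ : ℝ => (ξ * t, t)) ⁻¹' tsupport φ :=
  tsupport_comp_subset_preimage φ (by fun_prop)

end Slice

/-- The weak formulation on a single road, for test functions vanishing near the junction. -/
def IsRoadWeak (I : Set ℝ) (u v : ℝ → ℝ → ℝ) (u0 : ℝ) : Prop :=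
  ∀ φ : ℝ × ℝ → ℝ, ContDiff ℝ 1 φ → HasCompactSupport φ → tsupport φ ⊆ I ×ˢ univ →
    roadWeakTerm I u v u0 φ = 0

theorem roadWeakTerm_zero (I : Set ℝ) (u v : ℝ → ℝ → ℝ) (u0 : ℝ) :
    roadWeakTerm I u v u0 (fun _ => 0) = 0 := by
  simp [roadWeakTerm]

/-- A test function supported off x = 0 matches the zero function on the other roads to first order,
so each road can be tested alone. -/
theorem eq_zero_near_junction {I : Set ℝ} (h0 : (0 : ℝ) ∉ I) {φ : ℝ × ℝ → ℝ}
    (hφ : ContDiff ℝ 1 φ) (h : tsupport φ ⊆ I ×ˢ univ) (t : ℝ) :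
    φ (0, t) = 0 ∧ deriv (fun x => φ (x, t)) 0 = 0 := by
  have hnot : ((0 : ℝ), t) ∉ tsupport φ := fun hp => h0 (h hp).1
  refine ⟨image_eq_zero_of_notMem_tsupport hnot, ?_⟩
  have hd : fderiv ℝ φ (0, t) = 0 := by
    by_contra hne
    exact hnot (support_fderiv_subset ℝ hne)
  have := derivFst_eq hφ (0, t)
  rw [hd] at this
  exact this

theorem IsWeakSolution.isRoadWeak_in {uin0 : Fin 2 → ℝ} {uout0 : ℝ} {w : NetworkFunction}
    (h : IsWeakSolution uin0 uout0 w) (i : Fin 2) :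
    IsRoadWeak (Iio 0) (w.uin i) (w.vin i) (uin0 i) := by
  intro φ hφ hc hs
  have hz := eq_zero_near_junction (by simp) hφ hs
  have h1 := h (fun j => if j = i then φ else fun _ => 0) (fun _ => 0) (fun j => by
      by_cases hj : j = i
      · simpa only [if_pos hj] using ⟨hφ, hc⟩
      · simpa only [if_neg hj] using ⟨contDiff_const, HasCompactSupport.zero⟩) contDiff_const HasCompactSupport.zero
    (fun j t => by
      by_cases hj : j = i
      · simpa [if_pos hj] using hz t
      · simp [if_neg hj])
  rw [roadWeakTerm_zero, add_zero, Finset.sum_eq_single i] at h1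
  · simpa using h1
  · intro j _ hj
    simp only [if_neg hj]
    exact roadWeakTerm_zero _ _ _ _
  · simp

theorem IsWeakSolution.isRoadWeak_out {uin0 : Fin 2 → ℝ} {uout0 : ℝ} {w : NetworkFunction}
    (h : IsWeakSolution uin0 uout0 w) : IsRoadWeak (Ioi 0) w.uout w.vout uout0 := by
  intro φ hφ hc hs
  have hz := eq_zero_near_junction (by simp) hφ hs
  have h1 := h (fun j => fun _ => 0) φ (fun j => ⟨contDiff_const, HasCompactSupport.zero⟩) hφ hc
    (fun j t => by simpa using ⟨(hz t).1.symm, (hz t).2.symm⟩)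
  simpa only [roadWeakTerm_zero, Finset.sum_const_zero, zero_add] using h1

theorem IsRoadWeak.isInteriorWeak {I : Set ℝ} {u v : ℝ → ℝ → ℝ} {u0 : ℝ}
    (h : IsRoadWeak I u v u0) : DiscFlux.IsInteriorWeak I u v := by
  intro φ hφ hc hs
  have h1 := h φ hφ hc (hs.trans (prod_mono le_rfl (subset_univ _)))
  have h2 : ∀ x, φ (x, 0) = 0 := fun x =>
    image_eq_zero_of_notMem_tsupport fun hp => lt_irrefl (0 : ℝ) (mem_Ioi.1 (hs hp).2)
  simp only [roadWeakTerm, h2, mul_zero, integral_zero, add_zero] at h1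
  exact h1

namespace DiscFlux

variable {F : DiscFlux} {I : Set ℝ} {u v : ℝ → ℝ → ℝ}

/-- The density at infinity of a self-similar solution is its initial datum. -/
theorem RoadAdmissible.limit_eq_datum (h : F.RoadAdmissible I u v) (hI : IsCone I)
    (hIo : IsOpen I) (hne : I.Nonempty) {u0 : ℝ} (hw : IsRoadWeak I u v u0) {e : ℝ}
    (he : ∀ x ∈ I, Tendsto (fun n : ℕ => u (x * (n + 1)) 1) atTop (𝓝 e)) : e = u0 := by
  obtain ⟨U, V, hU, hV, ⟨C, hC0, hC⟩, hUe, hVe, hp⟩ := h.exists_rep hI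
  obtain ⟨x₀, hx₀⟩ := hne
  obtain ⟨r, hr, hball⟩ := Metric.isOpen_iff.1 hIo x₀ hx₀
  -- A bump in x inside I times a bump in t equal to 1 at t = 0, so that φ(·, 0) has positive
  -- integral.
  let a : ContDiffBump x₀ := ⟨r / 4, r / 2, by positivity, by linarith⟩
  let b : ContDiffBump (0 : ℝ) := ⟨1, 2, by norm_num, by norm_num⟩
  let φ : ℝ × ℝ → ℝ := fun p => a p.1 * b p.2
  have hφ : ContDiff ℝ 1 φ := (a.contDiff.comp contDiff_fst).mul (b.contDiff.comp contDiff_snd)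
  have hsupp : Function.support φ ⊆ Metric.closedBall x₀ (r / 2) ×ˢ Metric.closedBall 0 2 := by
    intro p hp
    have h1 : p.1 ∈ Function.support a := left_ne_zero_of_mul hp
    have h2 : p.2 ∈ Function.support b := right_ne_zero_of_mul hp
    rw [a.support_eq] at h1
    rw [b.support_eq] at h2
    exact ⟨Metric.ball_subset_closedBall h1, Metric.ball_subset_closedBall h2⟩
  have hc : HasCompactSupport φ := HasCompactSupport.of_support_subset_isCompact
    ((isCompact_closedBall _ _).prod (isCompact_closedBall _ _)) hsupp
  have hts : tsupport φ ⊆ I ×ˢ univ := by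
    refine (closure_minimal hsupp (Metric.isClosed_closedBall.prod
      Metric.isClosed_closedBall)).trans (prod_mono (fun x hx => hball ?_) (subset_univ _))
    exact Metric.closedBall_subset_ball (by linarith) hx
  -- For fixed t the slice of φ is supported in I, so the conservation law in ξ annihilates the
  -- bracket. What remains is the initial term, once with e and once with u0.
  have hbr : ∀ t, 0 < t → rayBracket I U V φ t = 0 := by
    intro t ht
    have h1 := integral_eq_zero_of_isInteriorWeak hI hw.isInteriorWeak hU hV hC hp
      (contDiff_slice hφ t) (hasCompactSupport_slice hφ hc ht) fun ξ hξ => by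
        have := hts (tsupport_slice_subset t hξ)
        exact (hI.mul_mem_iff ξ t ht).1 this.1
    simp only [deriv_slice hφ] at h1
    exact h1
  have hlim := tendsto_integral_rayBracket hI hU hV (fun ξ => (hC ξ).1) (fun ξ => (hC ξ).2) hφ hc
    (e := e) (by
      have h1 : ∀ n : ℕ, ∀ᵐ x ∂(volume.restrict I),
          U (x * (n + 1)) = (I.indicator fun ξ => u ξ 1) (x * (n + 1)) := fun n =>
        hI.ae_scale (by positivity) (P := fun y => U y = (I.indicator fun ξ => u ξ 1) y)
          (ae_restrict_of_ae hUe)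
      filter_upwards [ae_all_iff.2 h1, ae_restrict_mem hI.measurableSet] with x hx hxI
      refine (he x hxI).congr fun n => ?_
      rw [div_div_eq_mul_div, div_one, hx n, indicator_of_mem]
      exact (hI.mul_mem_iff x _ (by positivity)).2 hxI)
  have hzero : ∀ n : ℕ, ∫ t in Ioi (1 / (n + 1 : ℝ)), rayBracket I U V φ t = 0 := by
    intro n
    refine setIntegral_eq_zero_of_forall_eq_zero fun t ht => hbr t ?_
    exact lt_trans (by positivity) (mem_Ioi.1 ht)
  simp only [hzero] at hlim
  have h0 := tendsto_nhds_unique tendsto_const_nhds hlim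
  have h1 := hw φ hφ hc hts
  simp only [roadWeakTerm] at h1
  rw [integral_congr_ae (g := fun p : ℝ × ℝ =>
    U (p.1 / p.2) * derivSnd φ p + V (p.1 / p.2) * derivFst φ p)
    (by filter_upwards [hp] with p hp; rw [hp.1, hp.2]; rfl)] at h1
  rw [integral_const_mul] at h0 h1
  have hpos : 0 < ∫ x in I, φ (x, 0) := by
    have h2 : ∀ x, φ (x, 0) = a x := fun x => by
      have : b (0 : ℝ) = 1 := b.one_of_mem_closedBall (Metric.mem_closedBall_self b.rIn_pos.le)
      simp only [φ, this, mul_one]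
    simp only [h2]
    rw [setIntegral_eq_integral_of_forall_compl_eq_zero]
    · exact a.integral_pos
    · intro x hx
      by_contra hne
      have : x ∈ Function.support a := hne
      rw [a.support_eq] at this
      exact hx (hball (Metric.ball_subset_ball (by simp only [a]; linarith) this))
  have h3 : (e - u0) * ∫ x in I, φ (x, 0) = 0 := by linarith
  linarith [(mul_eq_zero.1 h3).resolve_right hpos.ne']

end DiscFlux

theorem inf_principal_neBot_of_null {I S : Set ℝ} (hI : IsOpen I) (hS : volume (I \ S) = 0)
    {l : Filter ℝ} (h : ∀ N ∈ l, ∃ O ⊆ N, IsOpen O ∧ (O ∩ I).Nonempty) : (l ⊓ 𝓟 S).NeBot := by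
  rw [inf_principal_neBot_iff]
  intro N hN
  obtain ⟨O, hON, hO, hne⟩ := h N hN
  obtain ⟨s, hs, hsO⟩ := exists_mem_of_null hS hO hne hI
  exact ⟨s, hON hsO, hs⟩

/-- The flux need not converge where the density does; compactness of the graph provides an
ultrafilter along which both converge. -/
theorem exists_tendsto_prod {G : Set (ℝ × ℝ)} (hG : IsCompact G) {S : Set ℝ} {U V : ℝ → ℝ}
    (hmem : ∀ ξ ∈ S, (U ξ, V ξ) ∈ G) {l : Filter ℝ} [hl : l.NeBot] (hlS : l ≤ 𝓟 S) {e : ℝ}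
    (hU : Tendsto U l (𝓝 e)) :
    ∃ l' ≤ l, l'.NeBot ∧ ∃ v, Tendsto (fun η => (U η, V η)) l' (𝓝 (e, v)) := by
  let m : Ultrafilter ℝ := Ultrafilter.of l
  have hm : (m : Filter ℝ) ≤ l := Ultrafilter.of_le l
  have hmG : ((m.map fun η => (U η, V η) : Ultrafilter (ℝ × ℝ)) : Filter (ℝ × ℝ)) ≤ 𝓟 G := by
    rw [le_principal_iff, Ultrafilter.coe_map, mem_map]
    exact mem_of_superset (hm (hlS (mem_principal_self S))) fun ξ hξ => hmem ξ hξ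
  obtain ⟨p, hp, hmp⟩ := hG.ultrafilter_le_nhds _ hmG
  have hp' : Tendsto (fun η => (U η, V η)) (m : Filter ℝ) (𝓝 p) := hmp
  have : p.1 = e := tendsto_nhds_unique ((continuous_fst.tendsto _).comp hp') (hU.mono_left hm)
  refine ⟨m, hm, inferInstance, p.2, ?_⟩
  rw [← this]
  exact hp'

theorem tendsto_indicator_iff {I : Set ℝ} {l : Filter ℝ} (hI : I ∈ l) {g : ℝ → ℝ} {L : Filter ℝ} :
    Tendsto (I.indicator g) l L ↔ Tendsto g l L :=
  tendsto_congr' (eventually_of_mem hI fun _ hx => indicator_of_mem hx _)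

namespace DiscFlux

variable {F : DiscFlux} {u v : ℝ → ℝ → ℝ}

theorem RoadAdmissible.tendsto_of_tendsto_one {I : Set ℝ} (h : F.RoadAdmissible I u v)
    (hI : IsCone I) {L : Filter ℝ} (hu : Tendsto (fun x => u x 1) (𝓝[I] 0) L) {t : ℝ}
    (ht : 0 < t) : Tendsto (fun x => u x t) (𝓝[I] 0) L := by
  have h1 : Tendsto (fun x : ℝ => x / t) (𝓝[I] 0) (𝓝[I] 0) := by
    refine tendsto_nhdsWithin_iff.2 ⟨?_, ?_⟩
    · have : Continuous fun x : ℝ => x / t := continuous_id.div_const t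
      simpa using (this.tendsto 0).mono_left nhdsWithin_le_nhds
    · filter_upwards [self_mem_nhdsWithin] with x hx
      exact (hI.div_mem_iff ht).2 hx
  refine (hu.comp h1).congr' ?_
  filter_upwards [self_mem_nhdsWithin] with x hx
  have := (h.eq_slice hI hx ht).1
  rw [indicator_of_mem ((hI.div_mem_iff ht).2 hx)] at this
  exact this.symm

/-- The wave on an incoming road. -/
theorem RoadAdmissible.exists_wave_in (h : F.RoadAdmissible (Iio 0) u v) {u0 z : ℝ}
    (hw : IsRoadWeak (Iio 0) u v u0) (hz : Tendsto (fun x => v x 1) (𝓝[<] 0) (𝓝 z)) :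
    ∃ S W uJ v0, IsWave F.graph F.f F.ustar 0 F.umax (Iio 0) S ((Iio 0).indicator fun ξ => u ξ 1)
      ((Iio 0).indicator fun ξ => v ξ 1) W (u0, v0) (uJ, z) ∧
      (∀ t > 0, Tendsto (fun x => u x t) (𝓝[<] 0) (𝓝 uJ)) ∧ InState F.graph u0 (uJ, z) := by
  obtain ⟨S, W, hP⟩ := h.exists_profile isCone_Iio isOpen_Iio ordConnected_Iio hw.isInteriorWeak
  -- Bounded variation yields the limits of the density at the junction and at infinity; the latter
  -- is then identified with the datum.
  obtain ⟨uJ, hJ⟩ := (h.bv 1 one_pos).exists_tendsto_left 0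
  obtain ⟨e, he⟩ := (h.bv 1 one_pos).exists_tendsto_atBot
  rw [inter_self] at hJ
  rw [inf_eq_right.2 (le_principal_iff.2 (Iio_mem_atBot 0))] at he
  have he0 : e = u0 := by
    refine h.limit_eq_datum isCone_Iio isOpen_Iio ⟨-1, by simp⟩ hw fun x hx => he.comp ?_
    refine Tendsto.const_mul_atTop_of_neg hx ?_
    exact tendsto_natCast_atTop_atTop.atTop_add tendsto_const_nhds
  rw [he0] at he
  have hn1 : (atBot ⊓ 𝓟 S).NeBot := by
    refine inf_principal_neBot_of_null isOpen_Iio hP.null fun N hN => ?_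
    obtain ⟨M, hM⟩ := mem_atBot_sets.1 hN
    refine ⟨Iio M, fun x hx => hM x (le_of_lt hx), isOpen_Iio, min M 0 - 1, ?_, ?_⟩
    · simp only [mem_Iio]; linarith [min_le_left M 0]
    · simp only [mem_Iio]; linarith [min_le_right M 0]
  have hn2 : (𝓝[<] (0 : ℝ) ⊓ 𝓟 S).NeBot := by
    refine inf_principal_neBot_of_null isOpen_Iio hP.null fun N hN => ?_
    obtain ⟨M, hM, hMN⟩ := mem_nhdsLT_iff_exists_Ioo_subset.1 hN
    have hM : M < 0 := hM
    exact ⟨Ioo M 0, hMN, isOpen_Ioo, M / 2, ⟨by linarith, by linarith⟩, by simp only [mem_Iio]; linarith⟩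
  obtain ⟨l', hl', hl'n, v0, hv0⟩ := exists_tendsto_prod F.isCompact_graph hP.mem
    (l := atBot ⊓ 𝓟 S) inf_le_right
    (((tendsto_indicator_iff (Iio_mem_atBot 0)).2 he).mono_left inf_le_left)
  have hR : Tendsto (fun η => ((Iio 0).indicator (fun ξ => u ξ 1) η,
      (Iio 0).indicator (fun ξ => v ξ 1) η)) (𝓝[<] 0 ⊓ 𝓟 S) (𝓝 (uJ, z)) :=
    (((tendsto_indicator_iff self_mem_nhdsWithin).2 hJ).mono_left inf_le_left).prodMk_nhds
      (((tendsto_indicator_iff self_mem_nhdsWithin).2 hz).mono_left inf_le_left)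
  have hwave : IsWave F.graph F.f F.ustar 0 F.umax (Iio 0) S ((Iio 0).indicator fun ξ => u ξ 1)
      ((Iio 0).indicator fun ξ => v ξ 1) W (u0, v0) (uJ, z) := by
    refine ⟨hP, ⟨l', hl'n, hl'.trans inf_le_right, fun ξ hξ => ?_, hv0⟩,
      ⟨_, hn2, inf_le_right, fun ξ hξ => ?_, hR⟩⟩
    · exact hl' (mem_inf_of_left (Iio_mem_atBot ξ))
    · exact mem_inf_of_left (Ioo_mem_nhdsLT (hP.subset hξ : ξ < 0) |> fun h =>
        mem_of_superset h fun x hx => hx.1)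
  refine ⟨S, W, uJ, v0, hwave, fun t ht => h.tendsto_of_tendsto_one isCone_Iio hJ ht, ?_⟩
  exact hwave.inState (l := 𝓝[<] 0 ⊓ 𝓟 S) inf_le_right
    (inf_le_left.trans nhdsWithin_le_nhds) hR

/-- The wave on the outgoing road. -/
theorem RoadAdmissible.exists_wave_out (h : F.RoadAdmissible (Ioi 0) u v) {u0 y : ℝ}
    {s : TrafficState} (hw : IsRoadWeak (Ioi 0) u v u0)
    (hy : Tendsto (fun x => v x 1) (𝓝[>] 0) (𝓝 y))
    (hs : u0 = F.ustar → Tendsto (fun x => v x 1) atTop (𝓝 (F.critFlux s))) :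
    ∃ S W uJ, IsWave F.graph F.f F.ustar 0 F.umax (Ioi 0) S ((Ioi 0).indicator fun ξ => u ξ 1)
      ((Ioi 0).indicator fun ξ => v ξ 1) W (uJ, y) (u0, F.datumFlux s u0) ∧
      (∀ t > 0, Tendsto (fun x => u x t) (𝓝[>] 0) (𝓝 uJ)) ∧
      OutState F.graph (u0, F.datumFlux s u0) (uJ, y) := by
  obtain ⟨S, W, hP⟩ := h.exists_profile isCone_Ioi isOpen_Ioi ordConnected_Ioi hw.isInteriorWeak
  obtain ⟨uJ, hJ⟩ := (h.bv 1 one_pos).exists_tendsto_right 0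
  obtain ⟨e, he⟩ := (h.bv 1 one_pos).exists_tendsto_atTop
  rw [inter_self] at hJ
  rw [inf_eq_right.2 (le_principal_iff.2 (Ioi_mem_atTop 0))] at he
  have he0 : e = u0 := by
    refine h.limit_eq_datum isCone_Ioi isOpen_Ioi ⟨1, by simp⟩ hw fun x hx => he.comp ?_
    refine Tendsto.const_mul_atTop hx ?_
    exact tendsto_natCast_atTop_atTop.atTop_add tendsto_const_nhds
  rw [he0] at he
  have hn1 : (atTop ⊓ 𝓟 S).NeBot := by
    refine inf_principal_neBot_of_null isOpen_Ioi hP.null fun N hN => ?_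
    obtain ⟨M, hM⟩ := mem_atTop_sets.1 hN
    refine ⟨Ioi M, fun x hx => hM x (le_of_lt hx), isOpen_Ioi, max M 0 + 1, ?_, ?_⟩
    · simp only [mem_Ioi]; linarith [le_max_left M 0]
    · simp only [mem_Ioi]; linarith [le_max_right M 0]
  have hn2 : (𝓝[>] (0 : ℝ) ⊓ 𝓟 S).NeBot := by
    refine inf_principal_neBot_of_null isOpen_Ioi hP.null fun N hN => ?_
    obtain ⟨M, hM, hMN⟩ := mem_nhdsGT_iff_exists_Ioo_subset.1 hN
    have hM : 0 < M := hM
    exact ⟨Ioo 0 M, hMN, isOpen_Ioo, M / 2, ⟨by linarith, by linarith⟩, by simp only [mem_Ioi]; linarith⟩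
  obtain ⟨l', hl', hl'n, v1, hv1⟩ := exists_tendsto_prod F.isCompact_graph hP.mem
    (l := atTop ⊓ 𝓟 S) inf_le_right
    (((tendsto_indicator_iff (Ioi_mem_atTop 0)).2 he).mono_left inf_le_left)
  have hv1G : (u0, v1) ∈ F.graph := F.isCompact_graph.isClosed.mem_of_tendsto hv1
    (eventually_of_mem (hl' (mem_inf_of_right (mem_principal_self S))) fun η hη => hP.mem η hη)
  -- Over ustar the graph leaves the flux open, and the prescribed traffic ahead decides; elsewhere
  -- the graph does.
  have hv1e : v1 = F.datumFlux s u0 := by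
    unfold datumFlux
    split_ifs with h0
    · have h1 : Tendsto ((Ioi 0).indicator fun ξ => v ξ 1) l' (𝓝 (F.critFlux s)) :=
        ((tendsto_indicator_iff (Ioi_mem_atTop 0)).2 (hs h0)).mono_left (hl'.trans inf_le_left)
      exact tendsto_nhds_unique ((continuous_snd.tendsto _).comp hv1) h1
    · exact hv1G.2.1 h0
  rw [hv1e] at hv1
  have hR : Tendsto (fun η => ((Ioi 0).indicator (fun ξ => u ξ 1) η,
      (Ioi 0).indicator (fun ξ => v ξ 1) η)) (𝓝[>] 0 ⊓ 𝓟 S) (𝓝 (uJ, y)) :=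
    (((tendsto_indicator_iff self_mem_nhdsWithin).2 hJ).mono_left inf_le_left).prodMk_nhds
      (((tendsto_indicator_iff self_mem_nhdsWithin).2 hy).mono_left inf_le_left)
  have hwave : IsWave F.graph F.f F.ustar 0 F.umax (Ioi 0) S ((Ioi 0).indicator fun ξ => u ξ 1)
      ((Ioi 0).indicator fun ξ => v ξ 1) W (uJ, y) (u0, F.datumFlux s u0) := by
    refine ⟨hP, ⟨_, hn2, inf_le_right, fun ξ hξ => ?_, hR⟩,
      ⟨l', hl'n, hl'.trans inf_le_right, fun ξ hξ => ?_, hv1⟩⟩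
    · exact mem_inf_of_left (Ioo_mem_nhdsGT (hP.subset hξ : 0 < ξ) |> fun h =>
        mem_of_superset h fun x hx => hx.2)
    · exact hl' (mem_inf_of_left (Ioi_mem_atTop ξ))
  refine ⟨S, W, uJ, hwave, fun t ht => h.tendsto_of_tendsto_one isCone_Ioi hJ ht, ?_⟩
  exact hwave.outState (l := 𝓝[>] 0 ⊓ 𝓟 S) inf_le_right
    (inf_le_left.trans nhdsWithin_le_nhds) hR

end DiscFlux

/-! ### Waves by minimization over compact sets -/

/-- `(U ξ, V ξ)` minimizes `v - ξ u` over `K`, for every slope `ξ`. -/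
structure IsMinSelection (K : Set (ℝ × ℝ)) (U V : ℝ → ℝ) : Prop where
  isCompact : IsCompact K
  mem : ∀ ξ, (U ξ, V ξ) ∈ K
  le : ∀ ξ, ∀ p ∈ K, V ξ - ξ * U ξ ≤ p.2 - ξ * p.1

theorem exists_isMinSelection {K : Set (ℝ × ℝ)} (hK : IsCompact K) (hne : K.Nonempty) :
    ∃ U V, IsMinSelection K U V := by
  have h : ∀ ξ : ℝ, ∃ p ∈ K, ∀ p' ∈ K, p.2 - ξ * p.1 ≤ p'.2 - ξ * p'.1 := fun ξ =>
    hK.exists_isMinOn hne (f := fun p => p.2 - ξ * p.1) (by fun_prop)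
  choose P hP hmin using h
  exact ⟨fun ξ => (P ξ).1, fun ξ => (P ξ).2, hK, hP, hmin⟩

namespace IsMinSelection

variable {K : Set (ℝ × ℝ)} {U V : ℝ → ℝ} (h : IsMinSelection K U V)
include h

/-- Test minimality at ξ with the point at η and conversely; the sum of the two inequalities is (η -
ξ)(U η - U ξ) ≥ 0. -/
theorem monotone : Monotone U := by
  intro ξ η hle
  rcases eq_or_lt_of_le hle with rfl | hlt
  · exact le_rfl
  have h1 := h.le ξ _ (h.mem η)
  have h2 := h.le η _ (h.mem ξ)
  simp only at h1 h2
  by_contra hcon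
  nlinarith [mul_pos (sub_pos.2 hlt) (sub_pos.2 (not_le.1 hcon))]

theorem exists_bound : ∃ C, 0 ≤ C ∧ ∀ p ∈ K, |p.1| ≤ C ∧ |p.2| ≤ C := by
  obtain ⟨C, hC⟩ := h.isCompact.isBounded.subset_closedBall (0 : ℝ × ℝ)
  refine ⟨max C 0, le_max_right _ _, fun p hp => ?_⟩
  have := hC hp
  rw [mem_closedBall_zero_iff, Prod.norm_def, max_le_iff, Real.norm_eq_abs,
    Real.norm_eq_abs] at this
  exact ⟨this.1.trans (le_max_left _ _), this.2.trans (le_max_left _ _)⟩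

theorem sub_le (ξ η : ℝ) :
    (V η - η * U η) - (V ξ - ξ * U ξ) ≤ -(η - ξ) * U ξ := by
  have := h.le η _ (h.mem ξ)
  simp only at this
  linarith

/-- A minimum of affine functions of ξ with bounded slopes is Lipschitz. -/
theorem continuous : Continuous fun ξ => V ξ - ξ * U ξ := by
  obtain ⟨C, hC0, hC⟩ := h.exists_bound
  refine (LipschitzWith.of_dist_le_mul (K := C.toNNReal) fun ξ η => ?_).continuous
  rw [Real.dist_eq, Real.dist_eq, Real.coe_toNNReal C hC0]
  have hb : ∀ ξ η, (V ξ - ξ * U ξ) - (V η - η * U η) ≤ C * |ξ - η| := by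
    intro ξ η
    refine (h.sub_le η ξ).trans ((le_abs_self _).trans ?_)
    rw [abs_mul, abs_neg, mul_comm]
    exact mul_le_mul_of_nonneg_right (hC _ (h.mem η)).1 (abs_nonneg _)
  rw [abs_le]
  constructor
  · have := hb η ξ
    rw [abs_sub_comm] at this
    linarith
  · exact hb ξ η

/-- Two uses of `sub_le` place the increment from ξ to η between -(η - ξ) U η and -(η - ξ) U ξ. -/
theorem hasDerivAt {ξ : ℝ} (hc : ContinuousAt U ξ) :
    HasDerivAt (fun ξ => V ξ - ξ * U ξ) (-U ξ) ξ := by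
  rw [hasDerivAt_iff_isLittleO, Asymptotics.isLittleO_iff]
  intro ε hε
  filter_upwards [Metric.tendsto_nhds.1 hc ε hε] with η hη
  rw [Real.dist_eq] at hη
  have h1 := h.sub_le ξ η
  have h2 := h.sub_le η ξ
  rw [Real.norm_eq_abs, Real.norm_eq_abs, smul_eq_mul]
  have h3 : |(η - ξ) * (U η - U ξ)| ≤ ε * |η - ξ| := by
    rw [abs_mul, mul_comm]
    exact mul_le_mul_of_nonneg_right hη.le (abs_nonneg _)
  have h4 := abs_le.1 h3
  rw [abs_le]
  constructor <;> nlinarith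

theorem intervalIntegrable (x y : ℝ) : IntervalIntegrable U volume x y :=
  h.monotone.intervalIntegrable

theorem integral_test (k g : ℝ) {α : ℝ → ℝ} (hα : ContDiff ℝ 1 α) (x y : ℝ) :
    ∫ s in x..y, ((V s - s * U s - (g - s * k)) * deriv α s - (U s - k) * α s) =
      (V y - y * U y - (g - y * k)) * α y - (V x - x * U x - (g - x * k)) * α x := by
  refine integral_mul_deriv_sub (N := {s | ¬ ContinuousAt U s})
    h.monotone.countable_not_continuousAt
    (h.continuous.sub (by fun_prop)).continuousOn (fun s hs => ?_)
    ((h.intervalIntegrable x y).sub intervalIntegrable_const) hα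
  have h1 := h.hasDerivAt (not_not.1 hs.2)
  have h2 : HasDerivAt (fun s => g - s * k) (-k) s := by
    simpa using ((hasDerivAt_id s).mul_const k).const_sub g
  exact (h1.fun_sub h2).congr_deriv (by ring)

theorem intervalIntegrable_test (k g : ℝ) {α : ℝ → ℝ} (hα : ContDiff ℝ 1 α) (x y : ℝ) :
    IntervalIntegrable
      (fun s => (V s - s * U s - (g - s * k)) * deriv α s - (U s - k) * α s) volume x y := by
  refine IntervalIntegrable.sub ?_ ?_
  · exact ((h.continuous.sub (by fun_prop)).mul
      (hα.continuous_deriv le_rfl)).intervalIntegrable _ _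
  · exact ((h.intervalIntegrable x y).sub intervalIntegrable_const).mul_continuousOn
      hα.continuous.continuousOn

/-- The entropy inequality of a minimizing selection. -/
theorem entropy {k g : ℝ} (hkg : ∀ p ∈ K, p.1 = k → p.2 = g)
    (hk : (k, g) ∈ K ∨ (∀ p ∈ K, p.1 ≤ k) ∨ ∀ p ∈ K, k ≤ p.1) {α : ℝ → ℝ} (hα : ContDiff ℝ 1 α)
    (hαc : HasCompactSupport α) (hα0 : ∀ x, 0 ≤ α x) :
    0 ≤ ∫ ξ, ((Real.sign (U ξ - k) * (V ξ - g) - ξ * |U ξ - k|) * deriv α ξ - |U ξ - k| * α ξ) := by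
  set A : ℝ → ℝ := fun s => (V s - s * U s - (g - s * k)) * deriv α s - (U s - k) * α s with hA
  set B : ℝ → ℝ := fun ξ =>
    (Real.sign (U ξ - k) * (V ξ - g) - ξ * |U ξ - k|) * deriv α ξ - |U ξ - k| * α ξ with hB
  have hBA : ∀ ξ, B ξ = Real.sign (U ξ - k) * A ξ := by
    intro ξ
    simp only [hA, hB, abs_eq_sign_mul (U ξ - k)]
    ring
  have hA0 : ∀ ξ, U ξ = k → A ξ = 0 := by
    intro ξ hξ
    have : V ξ = g := hkg _ (h.mem ξ) hξ
    simp [hA, hξ, this]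
  have hle : ∀ ξ, U ξ ≤ k → B ξ = -A ξ := by
    intro ξ hξ
    rcases eq_or_lt_of_le hξ with h0 | h0
    · rw [hBA, hA0 ξ h0]; simp
    · rw [hBA, Real.sign_of_neg (by linarith)]; ring
  have hge : ∀ ξ, k ≤ U ξ → B ξ = A ξ := by
    intro ξ hξ
    rcases eq_or_lt_of_le hξ with h0 | h0
    · rw [hBA, hA0 ξ h0.symm]; simp
    · rw [hBA, Real.sign_of_pos (by linarith)]; ring
  obtain ⟨R, hR⟩ := hαc.isCompact.isBounded.subset_closedBall (0 : ℝ)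
  have hout : ∀ x, R < |x| → α x = 0 ∧ deriv α x = 0 := by
    intro x hx
    have hn : x ∉ tsupport α := fun hx' => by
      have := hR hx'
      rw [mem_closedBall_zero_iff, Real.norm_eq_abs] at this
      linarith
    refine ⟨image_eq_zero_of_notMem_tsupport hn, ?_⟩
    by_contra hne
    exact hn (support_deriv_subset hne)
  have hint : ∀ M, R < M → ∫ ξ, B ξ = ∫ ξ in (-M)..M, B ξ := by
    intro M hM
    symm
    refine intervalIntegral.integral_eq_integral_of_support_subset fun x hx => ?_
    by_contra hcon
    refine hx ?_
    have : R < |x| := by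
      by_contra hle
      have := abs_le.1 (not_lt.1 hle)
      exact hcon ⟨by linarith, by linarith⟩
    simp [hB, hout x this]
  have hα1 : ∀ M, R < M → α M = 0 := fun M hM => (hout M (hM.trans_le (le_abs_self M))).1
  have hα2 : ∀ M, R < M → α (-M) = 0 := fun M hM =>
    (hout (-M) (hM.trans_le (by rw [abs_neg]; exact le_abs_self M))).1
  -- As long as U does not cross k, the integrand is A or -A throughout and integrates to zero.
  by_cases h1 : ∀ ξ, U ξ ≤ k
  · rw [hint (R + 1) (by linarith),
      intervalIntegral.integral_congr (g := fun ξ => -A ξ) fun ξ _ => hle ξ (h1 ξ),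
      intervalIntegral.integral_neg, h.integral_test k g hα, hα1 _ (by linarith),
      hα2 _ (by linarith)]
    simp
  by_cases h2 : ∀ ξ, k ≤ U ξ
  · rw [hint (R + 1) (by linarith),
      intervalIntegral.integral_congr (g := A) fun ξ _ => hge ξ (h2 ξ),
      h.integral_test k g hα, hα1 _ (by linarith), hα2 _ (by linarith)]
    simp
  push Not at h1 h2
  obtain ⟨ξ₁, h1⟩ := h1
  obtain ⟨ξ₀, h2⟩ := h2
  have hmem : (k, g) ∈ K := by
    rcases hk with hk | hk | hk
    · exact hk
    · exact absurd (hk _ (h.mem ξ₁)) (not_le.2 h1)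
    · exact absurd (hk _ (h.mem ξ₀)) (not_le.2 h2)
  -- b is the speed at which U crosses k. Integration by parts on both sides leaves -2 α(b) times
  -- the gap at b, and that gap is nonpositive because (k, g) competes in the minimum.
  set b := sSup {ξ | U ξ < k} with hb
  have hbdd : BddAbove {ξ | U ξ < k} := by
    refine ⟨ξ₁, fun ξ hξ => ?_⟩
    by_contra hcon
    have := h.monotone (not_le.1 hcon).le
    exact absurd hξ (not_lt.2 (h1.le.trans this))
  have hlt : ∀ ξ < b, U ξ ≤ k := by
    intro ξ hξ
    obtain ⟨η, hη, hlt⟩ := exists_lt_of_lt_csSup ⟨ξ₀, h2⟩ hξ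
    exact (h.monotone hlt.le).trans (le_of_lt hη)
  have hgt : ∀ ξ, b < ξ → k ≤ U ξ := by
    intro ξ hξ
    by_contra hcon
    exact absurd (le_csSup hbdd (not_le.1 hcon)) (not_le.2 hξ)
  obtain ⟨M, hM1, hM2⟩ : ∃ M, R < M ∧ |b| < M :=
    ⟨max R |b| + 1, by linarith [le_max_left R |b|], by linarith [le_max_right R |b|]⟩
  have hbM := abs_lt.1 hM2
  have hc1 : ∀ ξ ∈ Ioo (-M) b, -A ξ = B ξ := fun ξ hξ => (hle ξ (hlt ξ hξ.2)).symm
  have hc2 : ∀ ξ ∈ Ioo b M, A ξ = B ξ := fun ξ hξ => (hge ξ (hgt ξ hξ.1)).symm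
  have he1 : ∫ ξ in (-M)..b, B ξ = -∫ ξ in (-M)..b, A ξ := by
    rw [← intervalIntegral.integral_neg, intervalIntegral.integral_of_le hbM.1.le,
      intervalIntegral.integral_of_le hbM.1.le, integral_Ioc_eq_integral_Ioo,
      integral_Ioc_eq_integral_Ioo]
    exact setIntegral_congr_fun measurableSet_Ioo fun ξ hξ => (hc1 ξ hξ).symm
  have he2 : ∫ ξ in b..M, B ξ = ∫ ξ in b..M, A ξ := by
    rw [intervalIntegral.integral_of_le hbM.2.le,
      intervalIntegral.integral_of_le hbM.2.le, integral_Ioc_eq_integral_Ioo,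
      integral_Ioc_eq_integral_Ioo]
    exact setIntegral_congr_fun measurableSet_Ioo fun ξ hξ => (hc2 ξ hξ).symm
  have hi1 : IntervalIntegrable B volume (-M) b := by
    refine ((h.intervalIntegrable_test k g hα (-M) b).neg).congr_ae ?_
    rw [uIoc_of_le hbM.1.le, ← restrict_Ioo_eq_restrict_Ioc]
    filter_upwards [ae_restrict_mem measurableSet_Ioo] with ξ hξ using hc1 ξ hξ
  have hi2 : IntervalIntegrable B volume b M := by
    refine (h.intervalIntegrable_test k g hα b M).congr_ae ?_
    rw [uIoc_of_le hbM.2.le, ← restrict_Ioo_eq_restrict_Ioc]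
    filter_upwards [ae_restrict_mem measurableSet_Ioo] with ξ hξ using hc2 ξ hξ
  rw [hint M hM1, ← intervalIntegral.integral_add_adjacent_intervals hi1 hi2, he1, he2,
    h.integral_test k g hα, h.integral_test k g hα, hα1 M hM1, hα2 M hM1]
  have h3 := h.le b _ hmem
  simp only at h3
  nlinarith [hα0 b]

/-- Only the boundary term at ξ = 0 survives, where V - ξU is V. -/
theorem integral_Iio {α : ℝ → ℝ} (hα : ContDiff ℝ 1 α) (hαc : HasCompactSupport α) :
    ∫ ξ in Iio 0, ((V ξ - ξ * U ξ) * deriv α ξ - U ξ * α ξ) = V 0 * α 0 := by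
  obtain ⟨R, hR⟩ := hαc.isCompact.isBounded.subset_closedBall (0 : ℝ)
  have hR' : ∀ x ∈ tsupport α, -|R| ≤ x := fun x hx => by
    have := hR hx
    rw [mem_closedBall_zero_iff, Real.norm_eq_abs] at this
    linarith [(abs_le.1 this).1, le_abs_self R]
  have hz : ∀ x ≤ -(|R| + 1), α x = 0 ∧ deriv α x = 0 := by
    intro x hx
    have hn : x ∉ tsupport α := fun hx' => by linarith [hR' x hx']
    refine ⟨image_eq_zero_of_notMem_tsupport hn, ?_⟩
    by_contra hne
    exact hn (support_deriv_subset hne)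
  have h1 := h.integral_test 0 0 hα (-(|R| + 1)) 0
  rw [(hz _ le_rfl).1, intervalIntegral.integral_of_le (by linarith [abs_nonneg R]),
    integral_Ioc_eq_integral_Ioo] at h1
  rw [setIntegral_eq_of_subset_of_forall_sdiff_eq_zero measurableSet_Iio Ioo_subset_Iio_self
    fun x hx => ?_]
  · simpa using h1
  · have hx2 := hz x (not_lt.1 fun h => hx.2 ⟨by linarith, hx.1⟩)
    simp [hx2]

theorem integral_Ioi {α : ℝ → ℝ} (hα : ContDiff ℝ 1 α) (hαc : HasCompactSupport α) :
    ∫ ξ in Ioi 0, ((V ξ - ξ * U ξ) * deriv α ξ - U ξ * α ξ) = -(V 0 * α 0) := by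
  obtain ⟨R, hR⟩ := hαc.isCompact.isBounded.subset_closedBall (0 : ℝ)
  have hR' : ∀ x ∈ tsupport α, x ≤ |R| := fun x hx => by
    have := hR hx
    rw [mem_closedBall_zero_iff, Real.norm_eq_abs] at this
    linarith [(abs_le.1 this).2, le_abs_self R]
  have hz : ∀ x, |R| + 1 ≤ x → α x = 0 ∧ deriv α x = 0 := by
    intro x hx
    have hn : x ∉ tsupport α := fun hx' => by linarith [hR' x hx']
    refine ⟨image_eq_zero_of_notMem_tsupport hn, ?_⟩
    by_contra hne
    exact hn (support_deriv_subset hne)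
  have h1 := h.integral_test 0 0 hα 0 (|R| + 1)
  rw [(hz _ le_rfl).1, intervalIntegral.integral_of_le (by linarith [abs_nonneg R]),
    integral_Ioc_eq_integral_Ioo] at h1
  rw [setIntegral_eq_of_subset_of_forall_sdiff_eq_zero measurableSet_Ioi Ioo_subset_Ioi_self
    fun x hx => ?_]
  · simpa using h1
  · have hx2 := hz x (not_lt.1 fun h => hx.2 ⟨hx.1, h⟩)
    simp [hx2]

/-- A selection converges to a unique minimizer. -/
theorem tendsto_zero {J : ℝ × ℝ} (hJ : J ∈ K) (hu : ∀ p ∈ K, p.2 ≤ J.2 → p = J) :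
    Tendsto (fun ξ => (U ξ, V ξ)) (𝓝 0) (𝓝 J) := by
  obtain ⟨C, hC0, hC⟩ := h.exists_bound
  refine h.isCompact.tendsto_nhds_of_unique_mapClusterPt (Eventually.of_forall h.mem)
    fun p hp hcl => hu p hp ?_
  by_contra hcon
  have hgap := not_le.1 hcon
  have hlim : Tendsto (fun ξ : ℝ => J.2 + 2 * C * |ξ|) (𝓝 0) (𝓝 J.2) := by
    have : Continuous fun ξ : ℝ => J.2 + 2 * C * |ξ| := by fun_prop
    simpa using this.tendsto 0
  have hle : ∀ ξ, V ξ ≤ J.2 + 2 * C * |ξ| := by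
    intro ξ
    have h1 := h.le ξ J hJ
    have h2 : |ξ * (U ξ - J.1)| ≤ |ξ| * (2 * C) := by
      rw [abs_mul]
      refine mul_le_mul_of_nonneg_left ?_ (abs_nonneg _)
      have h3 := abs_sub (U ξ) J.1
      linarith [(hC _ (h.mem ξ)).1, (hC _ hJ).1]
    linarith [le_abs_self (ξ * (U ξ - J.1))]
  have hev : ∀ᶠ ξ in 𝓝 (0 : ℝ), V ξ < (J.2 + p.2) / 2 := by
    filter_upwards [hlim.eventually (gt_mem_nhds (show J.2 < (J.2 + p.2) / 2 by linarith))]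
      with ξ hξ using (hle ξ).trans_lt hξ
  have hfr := hcl.frequently (p := fun p' : ℝ × ℝ => (J.2 + p.2) / 2 < p'.2)
    ((continuous_snd.tendsto p).eventually (lt_mem_nhds (by linarith)))
  obtain ⟨ξ, h3, h4⟩ := (hfr.and_eventually hev).exists
  exact absurd h3 (not_lt.2 h4.le)

theorem eq_zero {J : ℝ × ℝ} (hJ : J ∈ K) (hu : ∀ p ∈ K, p.2 ≤ J.2 → p = J) :
    (U 0, V 0) = J := by
  refine hu _ (h.mem 0) ?_
  have := h.le 0 J hJ
  simpa using this

/-- Comparison with R costs at most 2C in flux, so U exceeds the least density R.1 by at most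
2C/(-ξ). -/
theorem tendsto_atBot {R : ℝ × ℝ} (hR : R ∈ K) (hu : ∀ p ∈ K, R.1 ≤ p.1) :
    Tendsto U atBot (𝓝 R.1) := by
  obtain ⟨C, hC0, hC⟩ := h.exists_bound
  have hlim : Tendsto (fun ξ : ℝ => R.1 + 2 * C / (-ξ)) atBot (𝓝 R.1) := by
    simpa using (tendsto_neg_atBot_atTop.const_div_atTop (2 * C)).const_add R.1
  refine tendsto_of_tendsto_of_tendsto_of_le_of_le' tendsto_const_nhds hlim
    (Eventually.of_forall fun ξ => hu _ (h.mem ξ)) ?_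
  filter_upwards [Iio_mem_atBot 0] with ξ hξ
  have hξ' : 0 < -ξ := neg_pos.2 hξ
  have h1 := h.le ξ R hR
  have h2 := abs_le.1 (hC _ (h.mem ξ)).2
  have h3 := abs_le.1 (hC _ hR).2
  rw [← sub_le_iff_le_add', le_div_iff₀ hξ']
  simp only at h2
  nlinarith

theorem tendsto_atTop {R : ℝ × ℝ} (hR : R ∈ K) (hu : ∀ p ∈ K, p.1 ≤ R.1) :
    Tendsto U atTop (𝓝 R.1) := by
  obtain ⟨C, hC0, hC⟩ := h.exists_bound
  have hlim : Tendsto (fun ξ : ℝ => R.1 - 2 * C / ξ) atTop (𝓝 R.1) := by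
    simpa using (tendsto_id.const_div_atTop (2 * C)).const_sub R.1
  refine tendsto_of_tendsto_of_tendsto_of_le_of_le' hlim tendsto_const_nhds ?_
    (Eventually.of_forall fun ξ => hu _ (h.mem ξ))
  filter_upwards [Ioi_mem_atTop 0] with ξ hξ
  have hξ' : 0 < ξ := hξ
  have h1 := h.le ξ R hR
  have h2 := abs_le.1 (hC _ (h.mem ξ)).2
  have h3 := abs_le.1 (hC _ hR).2
  rw [sub_le_comm, le_div_iff₀ hξ']
  simp only at h2
  nlinarith

/-- For ξ > 0 comparison with R gives V ≤ R.2. Every cluster point of (U, V) therefore lies over R.1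
with flux at most R.2, and `hv` leaves only R. -/
theorem tendsto_snd_atTop {R : ℝ × ℝ} (hR : R ∈ K) (hu : ∀ p ∈ K, p.1 ≤ R.1)
    (hv : ∀ p ∈ K, p.1 = R.1 → R.2 ≤ p.2) : Tendsto V atTop (𝓝 R.2) := by
  have hle : ∀ᶠ ξ in atTop, V ξ ≤ R.2 := by
    filter_upwards [Ioi_mem_atTop 0] with ξ hξ
    have h1 := h.le ξ R hR
    have h2 : U ξ ≤ R.1 := hu _ (h.mem ξ)
    have hξ' : 0 < ξ := hξ
    nlinarith
  have hU := h.tendsto_atTop hR hu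
  have hcpt : IsCompact (K ∩ {p | p.2 ≤ R.2}) :=
    h.isCompact.inter_right (isClosed_le continuous_snd continuous_const)
  have hlim : Tendsto (fun ξ => (U ξ, V ξ)) atTop (𝓝 R) := by
    refine hcpt.tendsto_nhds_of_unique_mapClusterPt
      (hle.mono fun ξ hξ => ⟨h.mem ξ, hξ⟩) fun p hp hcl => ?_
    have h1 : MapClusterPt p.1 atTop U := hcl.continuousAt_comp (f := Prod.fst) continuous_fst.continuousAt
    have h2 : p.1 = R.1 := by
      have : (𝓝 p.1 ⊓ 𝓝 R.1).NeBot := (h1.clusterPt.mono hU)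
      exact eq_of_nhds_neBot inferInstance
    exact Prod.ext h2 (le_antisymm hp.2 (hv p hp.1 h2))
  exact (continuous_snd.tendsto R).comp hlim

end IsMinSelection

namespace IsMinSelection

variable {K : Set (ℝ × ℝ)} {U V : ℝ → ℝ} (h : IsMinSelection K U V)
include h

theorem measurable_fst : Measurable U := h.monotone.measurable

theorem measurable_snd : Measurable V := by
  have := h.continuous.measurable.add (measurable_id.mul h.measurable_fst)
  simpa [Pi.add_def, Pi.mul_def] using this

variable {F : DiscFlux} {I : Set ℝ} {σ : ℝ} (hσ : σ = 1 ∨ σ = -1)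
  (hK : ∀ p ∈ K, (σ * p.1, σ * p.2) ∈ F.graph) {e : ℝ}
  (he : ∀ x ∈ I, Tendsto (fun n : ℕ => U (x * (n + 1))) atTop (𝓝 e)) (hI : IsCone I)
include hσ hK he hI

/-- A minimizing selection is an admissible self-similar road profile, and so is its negative. -/
theorem roadAdmissible (hent : ∀ k ∈ Icc 0 F.umax, k ≠ F.ustar → (σ * k, σ * F.f k) ∈ K ∨
      (∀ p ∈ K, p.1 ≤ σ * k) ∨ ∀ p ∈ K, σ * k ≤ p.1) :
    F.RoadAdmissible I (fun x t => σ * U (x / t)) fun x t => σ * V (x / t) where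
  u_meas := ((h.measurable_fst.comp (_root_.measurable_fst.div _root_.measurable_snd)).const_mul
    σ).aestronglyMeasurable
  v_meas := ((h.measurable_snd.comp (_root_.measurable_fst.div _root_.measurable_snd)).const_mul
    σ).aestronglyMeasurable
  selfSimilar x _ t _ c hc := by
    rw [mul_div_mul_left x t hc.ne']
    exact ⟨rfl, rfl⟩
  bv t ht := by
    obtain ⟨C, hC0, hC⟩ := h.exists_bound
    have hm : MonotoneOn (fun x => U (x / t)) I := fun x _ y _ hxy =>
      h.monotone (div_le_div_of_nonneg_right hxy ht.le)
    have hb : BoundedVariationOn (fun x => U (x / t)) I :=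
      hm.boundedVariationOn fun x _ => (hC _ (h.mem (x / t))).1
    have hl : LipschitzWith 1 fun y : ℝ => σ * y := by
      refine LipschitzWith.of_dist_le_mul fun x y => ?_
      rw [Real.dist_eq, Real.dist_eq, ← mul_sub, abs_mul]
      rcases hσ with rfl | rfl <;> simp
    exact hl.comp_boundedVariationOn hb
  selection := Eventually.of_forall fun p => hK _ (h.mem _)
  entropy k hk hkc φ hφ hc hs h0 := by
    obtain ⟨C, hC0, hC⟩ := h.exists_bound
    set E : ℝ → ℝ := fun ξ => |σ * U ξ - k| with hE
    set Q : ℝ → ℝ := fun ξ => Real.sign (σ * U ξ - k) * (σ * V ξ - F.f k) with hQ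
    have hσσ : σ * σ = 1 := by rcases hσ with rfl | rfl <;> norm_num
    have hσa : |σ| = 1 := by rcases hσ with rfl | rfl <;> norm_num
    have hE' : ∀ ξ, E ξ = |U ξ - σ * k| := by
      intro ξ
      simp only [hE]
      rw [show σ * U ξ - k = σ * (U ξ - σ * k) by linear_combination k * hσσ, abs_mul, hσa, one_mul]
    have hQ' : ∀ ξ, Q ξ = Real.sign (U ξ - σ * k) * (V ξ - σ * F.f k) := by
      intro ξ
      simp only [hQ]
      rcases hσ with rfl | rfl
      · simp
      · rw [show -1 * U ξ - k = -(U ξ - -1 * k) by ring, Real.sign_neg]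
        ring
    have hEm : Measurable E := (((h.measurable_fst.const_mul σ).sub_const k)).abs
    have hQm : Measurable Q := (measurable_sign.comp ((h.measurable_fst.const_mul σ).sub_const k)).mul
      ((h.measurable_snd.const_mul σ).sub_const _)
    have hEC : ∀ ξ, |E ξ| ≤ C + |k| + |F.f k| := by
      intro ξ
      simp only [hE, abs_abs]
      have := abs_sub (σ * U ξ) k
      rw [abs_mul, hσa, one_mul] at this
      linarith [(hC _ (h.mem ξ)).1, abs_nonneg (F.f k)]
    have hQC : ∀ ξ, |Q ξ| ≤ C + |k| + |F.f k| := by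
      intro ξ
      simp only [hQ, abs_mul]
      have h1 := abs_sub (σ * V ξ) (F.f k)
      rw [abs_mul, hσa, one_mul] at h1
      have h2 := mul_le_mul_of_nonneg_right (abs_sign_le (σ * U ξ - k))
        (abs_nonneg (σ * V ξ - F.f k))
      linarith [(hC _ (h.mem ξ)).2, abs_nonneg k]
    have hlim := tendsto_integral_rayBracket hI hEm hQm hEC hQC hφ hc (e := |σ * e - k|) (by
      filter_upwards [ae_restrict_mem hI.measurableSet] with x hx
      have h1 := (((he x hx).const_mul σ).sub_const k).abs
      refine h1.congr fun n => ?_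
      rw [div_div_eq_mul_div, div_one])
    have hz : ∀ x, φ (x, 0) = 0 := fun x =>
      image_eq_zero_of_notMem_tsupport fun hp => lt_irrefl (0 : ℝ) (mem_Ioi.1 (hs hp).2)
    -- Entropy test functions vanish at t = 0, so the datum drops out and it suffices to treat the
    -- bracket at each time.
    simp only [hz, mul_zero, integral_zero, add_zero] at hlim
    refine ge_of_tendsto' hlim fun n => setIntegral_nonneg measurableSet_Ioi fun t ht => ?_
    have ht : 0 < t := lt_trans (by positivity) (mem_Ioi.1 ht)
    have hb : rayBracket I E Q φ t =
        ∫ ξ, ((Q ξ - ξ * E ξ) * deriv (fun ξ => φ (ξ * t, t)) ξ - E ξ * φ (ξ * t, t)) := by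
      simp only [deriv_slice hφ]
      refine setIntegral_eq_integral_of_forall_compl_eq_zero fun ξ hξ => ?_
      have hn : (ξ * t, t) ∉ tsupport φ := fun hp =>
        hξ ((hI.mul_mem_iff ξ t ht).1 (hs hp).1)
      have h1 : φ (ξ * t, t) = 0 := image_eq_zero_of_notMem_tsupport hn
      have h2 : derivFst φ (ξ * t, t) = 0 := by
        rw [derivFst_eq hφ]
        have : fderiv ℝ φ (ξ * t, t) = 0 := by
          by_contra hne
          exact hn (support_fderiv_subset ℝ hne)
        rw [this]; rfl
      rw [h1, h2]; ring
    rw [hb]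
    simp only [hE', hQ']
    refine h.entropy (fun p hp hpk => ?_) (hent k hk hkc) (contDiff_slice hφ t)
      (hasCompactSupport_slice hφ hc ht) fun ξ => h0 _
    have h1 := (hK p hp).2.1
    simp only [hpk] at h1
    rw [← mul_assoc, hσσ, one_mul] at h1
    have h2 := h1 hkc
    linear_combination -(p.2) * hσσ + σ * h2

/-- The limit over time cutoffs is kept, so that the boundary terms of the three roads can later be
cancelled for each n. -/
theorem tendsto_weak {φ : ℝ × ℝ → ℝ} (hφ : ContDiff ℝ 1 φ) (hc : HasCompactSupport φ) :
    Tendsto (fun n : ℕ => ∫ t in Ioi (1 / (n + 1 : ℝ)), σ * ∫ ξ in I,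
      ((V ξ - ξ * U ξ) * deriv (fun ξ => φ (ξ * t, t)) ξ - U ξ * φ (ξ * t, t))) atTop
      (𝓝 (roadWeakTerm I (fun x t => σ * U (x / t)) (fun x t => σ * V (x / t)) (σ * e) φ)) := by
  obtain ⟨C, hC0, hC⟩ := h.exists_bound
  have hσa : |σ| = 1 := by rcases hσ with rfl | rfl <;> norm_num
  have hlim := tendsto_integral_rayBracket hI (h.measurable_fst.const_mul σ)
    (h.measurable_snd.const_mul σ) (C := C)
    (fun ξ => by rw [abs_mul, hσa, one_mul]; exact (hC _ (h.mem ξ)).1)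
    (fun ξ => by rw [abs_mul, hσa, one_mul]; exact (hC _ (h.mem ξ)).2) hφ hc (e := σ * e) (by
      filter_upwards [ae_restrict_mem hI.measurableSet] with x hx
      refine ((he x hx).const_mul σ).congr fun n => ?_
      rw [div_div_eq_mul_div, div_one])
  refine hlim.congr fun n => ?_
  congr 1
  funext t
  simp only [deriv_slice hφ, rayBracket]
  rw [← integral_const_mul]
  congr 1
  funext ξ
  ring

end IsMinSelection

/-! ### Existence of road solutions -/

/-- An admissible road profile with datum `u0` whose weak formulation has the boundary term
`∫ r φ(0, t) dt`; `r` is the flux at the junction, oriented out of the road. -/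
structure IsRoadSolution (F : DiscFlux) (I : Set ℝ) (u0 r : ℝ) (u v : ℝ → ℝ → ℝ) : Prop where
  admissible : F.RoadAdmissible I u v
  tendsto_weak : ∀ φ : ℝ × ℝ → ℝ, ContDiff ℝ 1 φ → HasCompactSupport φ →
    Tendsto (fun n : ℕ => ∫ t in Ioi (1 / (n + 1 : ℝ)), r * φ (0, t)) atTop
      (𝓝 (roadWeakTerm I u v u0 φ))

section

variable {F : DiscFlux} {K : Set (ℝ × ℝ)} {σ : ℝ}

theorem tendsto_div_nhdsWithin {t : ℝ} : Tendsto (fun x : ℝ => x / t) (𝓝 0) (𝓝 0) := by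
  have : Continuous fun x : ℝ => x / t := continuous_id.div_const t
  simpa using this.tendsto 0

/-- J is the unique minimizer of v, hence the value at ξ = 0 and the source of the boundary flux; R
minimizes u, hence its density is the limit as ξ → -∞. The sign σ = -1, with K reflected, yields the
waves on the upper hull. -/
theorem exists_incoming_of_compact (hσ : σ = 1 ∨ σ = -1) (hKc : IsCompact K)
    (hK : ∀ p ∈ K, (σ * p.1, σ * p.2) ∈ F.graph) {J R : ℝ × ℝ} (hJ : J ∈ K)
    (hu : ∀ p ∈ K, p.2 ≤ J.2 → p = J) (hR : R ∈ K) (hRu : ∀ p ∈ K, R.1 ≤ p.1)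
    (hent : ∀ k ∈ Icc 0 F.umax, k ≠ F.ustar → (σ * k, σ * F.f k) ∈ K ∨
      (∀ p ∈ K, p.1 ≤ σ * k) ∨ ∀ p ∈ K, σ * k ≤ p.1) :
    ∃ u v, IsRoadSolution F (Iio 0) (σ * R.1) (σ * J.2) u v ∧
      ∀ t > 0, Tendsto (fun x => v x t) (𝓝[<] 0) (𝓝 (σ * J.2)) := by
  obtain ⟨U, V, h⟩ := exists_isMinSelection hKc ⟨J, hJ⟩
  have he : ∀ x ∈ Iio (0 : ℝ), Tendsto (fun n : ℕ => U (x * (n + 1))) atTop (𝓝 R.1) := by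
    intro x hx
    refine (h.tendsto_atBot hR hRu).comp (Tendsto.const_mul_atTop_of_neg hx ?_)
    exact tendsto_natCast_atTop_atTop.atTop_add tendsto_const_nhds
  refine ⟨_, _, ⟨h.roadAdmissible hσ hK he isCone_Iio hent, fun φ hφ hc => ?_⟩, fun t _ => ?_⟩
  · refine (h.tendsto_weak hσ hK he isCone_Iio hφ hc).congr fun n => ?_
    refine setIntegral_congr_fun measurableSet_Ioi fun t ht => ?_
    have ht : 0 < t := lt_trans (by positivity) (mem_Ioi.1 ht)
    have h0 := h.eq_zero hJ hu
    simp only [h.integral_Iio (contDiff_slice hφ t) (hasCompactSupport_slice hφ hc ht), ← h0,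
      zero_mul, mul_assoc]
  · have h1 := (continuous_snd.tendsto J).comp (h.tendsto_zero hJ hu)
    exact ((h1.comp tendsto_div_nhdsWithin).const_mul σ).mono_left nhdsWithin_le_nhds

theorem exists_outgoing_of_compact (hσ : σ = 1 ∨ σ = -1) (hKc : IsCompact K)
    (hK : ∀ p ∈ K, (σ * p.1, σ * p.2) ∈ F.graph) {J R : ℝ × ℝ} (hJ : J ∈ K)
    (hu : ∀ p ∈ K, p.2 ≤ J.2 → p = J) (hR : R ∈ K) (hRu : ∀ p ∈ K, p.1 ≤ R.1)
    (hRv : ∀ p ∈ K, p.1 = R.1 → R.2 ≤ p.2)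
    (hent : ∀ k ∈ Icc 0 F.umax, k ≠ F.ustar → (σ * k, σ * F.f k) ∈ K ∨
      (∀ p ∈ K, p.1 ≤ σ * k) ∨ ∀ p ∈ K, σ * k ≤ p.1) :
    ∃ u v, IsRoadSolution F (Ioi 0) (σ * R.1) (-(σ * J.2)) u v ∧
      (∀ t > 0, Tendsto (fun x => v x t) (𝓝[>] 0) (𝓝 (σ * J.2))) ∧
      ∀ t > 0, Tendsto (fun x => v x t) atTop (𝓝 (σ * R.2)) := by
  obtain ⟨U, V, h⟩ := exists_isMinSelection hKc ⟨J, hJ⟩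
  have he : ∀ x ∈ Ioi (0 : ℝ), Tendsto (fun n : ℕ => U (x * (n + 1))) atTop (𝓝 R.1) := by
    intro x hx
    refine (h.tendsto_atTop hR hRu).comp (Tendsto.const_mul_atTop hx ?_)
    exact tendsto_natCast_atTop_atTop.atTop_add tendsto_const_nhds
  refine ⟨_, _, ⟨h.roadAdmissible hσ hK he isCone_Ioi hent, fun φ hφ hc => ?_⟩, fun t _ => ?_,
    fun t ht => ?_⟩
  · refine (h.tendsto_weak hσ hK he isCone_Ioi hφ hc).congr fun n => ?_
    refine setIntegral_congr_fun measurableSet_Ioi fun t ht => ?_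
    have ht : 0 < t := lt_trans (by positivity) (mem_Ioi.1 ht)
    have h0 := h.eq_zero hJ hu
    simp only [h.integral_Ioi (contDiff_slice hφ t) (hasCompactSupport_slice hφ hc ht), ← h0,
      zero_mul]
    ring
  · have h1 := (continuous_snd.tendsto J).comp (h.tendsto_zero hJ hu)
    exact ((h1.comp tendsto_div_nhdsWithin).const_mul σ).mono_left nhdsWithin_le_nhds
  · exact ((h.tendsto_snd_atTop hR hRu hRv).comp (tendsto_id.atTop_div_const ht)).const_mul σ

end

theorem isCompact_neg_preimage {A : Set (ℝ × ℝ)} (hA : IsCompact A) :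
    IsCompact {p : ℝ × ℝ | -p ∈ A} := hA.neg

/-- Every incoming junction state is attained by a road solution. -/
theorem InState.exists_solution {F : DiscFlux} {u0 : ℝ} {J : ℝ × ℝ} (hu0 : u0 ∈ Icc 0 F.umax)
    (h : InState F.graph u0 J) :
    ∃ u v, IsRoadSolution F (Iio 0) u0 J.2 u v ∧
      ∀ t > 0, Tendsto (fun x => v x t) (𝓝[<] 0) (𝓝 J.2) := by
  obtain ⟨hJ, h⟩ := h
  -- For u0 ≠ J.1 any flux over u0 would do, since only the limit density matters.
  have hex : ∃ v0, (u0, v0) ∈ F.graph ∧ (u0 = J.1 → v0 = J.2) := by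
    by_cases hc : u0 = J.1
    · exact ⟨J.2, by rw [hc]; exact hJ, fun _ => rfl⟩
    · by_cases hs : u0 = F.ustar
      · exact ⟨F.f1 F.ustar, by rw [hs, F.mem_graph_ustar]; exact ⟨F.jump.le, le_rfl⟩,
          fun h => absurd h hc⟩
      · exact ⟨F.f u0, F.isJumpGraph.mem_of_ne _ hu0 hs, fun h => absurd h hc⟩
  obtain ⟨v0, hv0, hv0J⟩ := hex
  rcases h with ⟨hle, hlt⟩ | ⟨hle, hlt⟩
  · have hJle : J.2 ≤ v0 := by
      rcases eq_or_lt_of_le hle with he | hlt'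
      · exact (hv0J he).ge
      · exact (hlt _ hv0 le_rfl hlt').le
    -- The condition J.2 ≤ p.2 removes the part of the vertical segment below J, so that J becomes
    -- the only minimum of v on K.
    have := exists_incoming_of_compact (F := F) (σ := 1)
      (K := F.graph ∩ ({p | u0 ≤ p.1} ∩ {p | p.1 ≤ J.1} ∩ {p | J.2 ≤ p.2})) (Or.inl rfl)
      (F.isCompact_graph.inter_right (((isClosed_le continuous_const continuous_fst).inter
        (isClosed_le continuous_fst continuous_const)).inter
        (isClosed_le continuous_const continuous_snd)))
      (fun p hp => by simpa using hp.1) (J := J) (R := (u0, v0)) ⟨hJ, ⟨hle, le_refl J.1⟩, le_refl J.2⟩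
      (fun p hp hpJ => ?_) ⟨hv0, ⟨le_refl u0, hle⟩, hJle⟩ (fun p hp => hp.2.1.1)
      (fun k hk hkc => ?_)
    · simpa using this
    · by_contra hne
      rcases eq_or_lt_of_le (show p.1 ≤ J.1 from hp.2.1.2) with he | hlt'
      · exact hne (Prod.ext he (le_antisymm hpJ hp.2.2))
      · exact absurd hpJ (not_le.2 (hlt p hp.1 hp.2.1.1 hlt'))
    · simp only [one_mul]
      rcases lt_or_ge k u0 with h1 | h1
      · exact Or.inr (Or.inr fun p hp => h1.le.trans hp.2.1.1)
      rcases le_or_gt J.1 k with h2 | h2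
      · exact Or.inr (Or.inl fun p hp => hp.2.1.2.trans h2)
      have hmem := F.isJumpGraph.mem_of_ne k hk hkc
      exact Or.inl ⟨hmem, ⟨h1, h2.le⟩, (hlt _ hmem h1 h2).le⟩
  · have hJle : v0 ≤ J.2 := by
      rcases eq_or_lt_of_le hle with he | hlt'
      · exact (hv0J he.symm).le
      · exact (hlt _ hv0 le_rfl hlt').le
    have := exists_incoming_of_compact (F := F) (σ := -1)
      (K := {p | -p ∈ F.graph ∩ ({p | p.1 ≤ u0} ∩ {p | J.1 ≤ p.1} ∩ {p | p.2 ≤ J.2})}) (Or.inr rfl)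
      (isCompact_neg_preimage (F.isCompact_graph.inter_right
        (((isClosed_le continuous_fst continuous_const).inter
        (isClosed_le continuous_const continuous_fst)).inter
        (isClosed_le continuous_snd continuous_const))))
      (fun p hp => by
        have := hp.1
        rwa [neg_one_mul, neg_one_mul]) (J := -J) (R := -(u0, v0))
      (by simpa using ⟨hJ, hle⟩)
      (fun p hp hpJ => ?_) (by simpa using ⟨hv0, hle, hJle⟩)
      (fun p hp => by
        have := hp.2.1.1
        simp only [mem_ofPred_eq, Prod.fst_neg] at this ⊢
        linarith)
      (fun k hk hkc => ?_)
    · simpa using this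
    · have h1 : -p.1 ≤ u0 := hp.2.1.1
      have h2 : J.1 ≤ -p.1 := hp.2.1.2
      have h3 : -p.2 ≤ J.2 := hp.2.2
      have h4 : p.2 ≤ -J.2 := hpJ
      by_contra hne
      rcases eq_or_lt_of_le h2 with he | hlt'
      · exact hne (Prod.ext (by simp; linarith) (by simp; linarith))
      · have h5 : -p.2 < J.2 := hlt (-p) hp.1 h1 hlt'
        linarith
    · rcases lt_or_ge u0 k with h1 | h1
      · refine Or.inr (Or.inr fun p hp => ?_)
        have : -p.1 ≤ u0 := hp.2.1.1
        linarith
      rcases le_or_gt k J.1 with h2 | h2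
      · refine Or.inr (Or.inl fun p hp => ?_)
        have : J.1 ≤ -p.1 := hp.2.1.2
        linarith
      have hmem := F.isJumpGraph.mem_of_ne k hk hkc
      exact Or.inl (by simpa using ⟨hmem, ⟨h1, h2.le⟩, (hlt _ hmem h1 h2).le⟩)

/-! ### Shape of the graph, demand and supply -/

namespace DiscFlux

variable {F : DiscFlux}

theorem left_mono {p p' : ℝ × ℝ} (hp : p ∈ F.graph) (hp' : p' ∈ F.graph) (h : p.1 < p'.1)
    (hc : p'.1 < F.ustar) : p.2 < p'.2 := by
  have h1 := (F.mem_graph_of_lt (h.trans hc)).1 hp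
  have h2 := (F.mem_graph_of_lt hc).1 hp'
  rw [h1.2, h2.2]
  exact F.strictMonoOn_f1 ⟨h1.1, (h.trans hc).le⟩ ⟨h2.1, hc.le⟩ h

/-- The vertical segment is included: over ustar all fluxes are at least `f2 ustar`, which exceeds
every flux further right. -/
theorem right_anti {p p' : ℝ × ℝ} (hp : p ∈ F.graph) (hp' : p' ∈ F.graph) (hc : F.ustar ≤ p.1)
    (h : p.1 < p'.1) : p'.2 < p.2 := by
  obtain ⟨u, v⟩ := p
  have h2 := (F.mem_graph_of_gt (hc.trans_lt h)).1 hp'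
  have hm : p'.1 ∈ Icc F.ustar F.umax := ⟨(hc.trans_lt h).le, h2.1⟩
  rw [h2.2]
  rcases eq_or_lt_of_le hc with he | hlt
  · simp only at he h
    subst he
    exact (F.strictAntiOn_f2 F.ustar_mem_right hm h).trans_le (F.mem_graph_ustar.1 hp).1
  · have h1 := (F.mem_graph_of_gt hlt).1 hp
    simp only at h1 h hlt
    rw [h1.2]
    exact F.strictAntiOn_f2 ⟨hlt.le, h1.1⟩ hm h

theorem f1_nonneg {u : ℝ} (hu : u ∈ Icc 0 F.ustar) : 0 ≤ F.f1 u := by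
  rw [← F.f1_zero]
  exact F.strictMonoOn_f1.monotoneOn F.zero_mem hu hu.1

theorem f1_le {u : ℝ} (hu : u ∈ Icc 0 F.ustar) : F.f1 u ≤ F.f1 F.ustar :=
  F.strictMonoOn_f1.monotoneOn hu F.ustar_mem_left hu.2

theorem f2_nonneg {u : ℝ} (hu : u ∈ Icc F.ustar F.umax) : 0 ≤ F.f2 u := by
  rw [← F.f2_umax]
  exact F.strictAntiOn_f2.antitoneOn hu F.umax_mem hu.2

theorem f2_le {u : ℝ} (hu : u ∈ Icc F.ustar F.umax) : F.f2 u ≤ F.f2 F.ustar :=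
  F.strictAntiOn_f2.antitoneOn F.ustar_mem_right hu hu.1

theorem snd_mem {p : ℝ × ℝ} (hp : p ∈ F.graph) : p.2 ∈ Icc 0 (F.f1 F.ustar) := by
  obtain ⟨u, v⟩ := p
  rcases lt_trichotomy u F.ustar with h | rfl | h
  · have h1 := (F.mem_graph_of_lt h).1 hp
    exact ⟨h1.2 ▸ f1_nonneg ⟨h1.1, h.le⟩, h1.2 ▸ f1_le ⟨h1.1, h.le⟩⟩
  · have h1 := F.mem_graph_ustar.1 hp
    exact ⟨F.f2_ustar_pos.le.trans h1.1, h1.2⟩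
  · have h1 := (F.mem_graph_of_gt h).1 hp
    exact ⟨h1.2 ▸ f2_nonneg ⟨h.le, h1.1⟩, h1.2 ▸ (f2_le ⟨h.le, h1.1⟩).trans F.jump.le⟩

theorem f1_mem_graph {u : ℝ} (hu : u ∈ Icc 0 F.ustar) : (u, F.f1 u) ∈ F.graph := by
  rcases eq_or_lt_of_le hu.2 with rfl | h
  · exact F.mem_graph_ustar.2 ⟨F.jump.le, le_rfl⟩
  · exact (F.mem_graph_of_lt h).2 ⟨hu.1, rfl⟩

theorem f2_mem_graph {u : ℝ} (hu : u ∈ Icc F.ustar F.umax) : (u, F.f2 u) ∈ F.graph := by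
  rcases eq_or_lt_of_le hu.1 with rfl | h
  · exact F.mem_graph_ustar.2 ⟨le_rfl, F.jump.le⟩
  · exact (F.mem_graph_of_gt h).2 ⟨hu.2, rfl⟩

theorem exists_f1_eq {z : ℝ} (hz : z ∈ Icc 0 (F.f1 F.ustar)) : ∃ u ∈ Icc 0 F.ustar, F.f1 u = z := by
  have h := intermediate_value_Icc F.ustar_pos.le F.continuousOn_f1
  rw [F.f1_zero] at h
  exact h hz

theorem exists_f2_eq {z : ℝ} (hz : z ∈ Icc 0 (F.f2 F.ustar)) :
    ∃ u ∈ Icc F.ustar F.umax, F.f2 u = z := by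
  have h := intermediate_value_Icc' F.ustar_lt.le F.f2_cont
  rw [F.f2_umax] at h
  exact h hz

theorem exists_mem_graph_right {z : ℝ} (hz : z ∈ Icc 0 (F.f1 F.ustar)) :
    ∃ u ∈ Icc F.ustar F.umax, (u, z) ∈ F.graph := by
  rcases le_or_gt (F.f2 F.ustar) z with h | h
  · exact ⟨F.ustar, F.ustar_mem_right, F.mem_graph_ustar.2 ⟨h, hz.2⟩⟩
  · obtain ⟨u, hu, rfl⟩ := exists_f2_eq ⟨hz.1, h.le⟩
    exact ⟨u, hu, f2_mem_graph hu⟩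

theorem low_spec : F.low ∈ Icc 0 F.ustar ∧ F.f1 F.low = F.f2 F.ustar := by
  have h : ∃ u ∈ Icc 0 F.ustar, F.f1 u = F.f2 F.ustar :=
    exists_f1_eq ⟨F.f2_ustar_pos.le, F.jump.le⟩
  exact ⟨Function.invFunOn_mem h, Function.invFunOn_eq h⟩

theorem low_lt : F.low < F.ustar := by
  refine lt_of_le_of_ne (low_spec).1.2 fun h => ?_
  have := (low_spec (F := F)).2
  rw [h] at this
  exact F.jump.ne' this

theorem eta_left {u : ℝ} (h0 : 0 ≤ u) (hu : u ≤ F.low) :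
    F.eta u ∈ Icc F.ustar F.umax ∧ F.f2 (F.eta u) = F.f1 u := by
  have hm : u ∈ Icc 0 F.ustar := ⟨h0, hu.trans low_spec.1.2⟩
  have h : ∃ k ∈ Icc F.ustar F.umax, F.f2 k = F.f1 u := by
    refine exists_f2_eq ⟨f1_nonneg hm, ?_⟩
    rw [← low_spec.2]
    exact F.strictMonoOn_f1.monotoneOn hm low_spec.1 hu
  rw [eta, if_pos hu]
  exact ⟨Function.invFunOn_mem h, Function.invFunOn_eq h⟩

theorem eta_right {u : ℝ} (hu : u ∈ Icc F.ustar F.umax) :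
    F.eta u ∈ Icc 0 F.ustar ∧ F.f1 (F.eta u) = F.f2 u := by
  have h : ∃ k ∈ Icc 0 F.ustar, F.f1 k = F.f2 u :=
    exists_f1_eq ⟨f2_nonneg hu, (f2_le hu).trans F.jump.le⟩
  rw [eta, if_neg (not_le.2 (low_lt.trans_le hu.1)), if_neg (not_lt.2 hu.1)]
  exact ⟨Function.invFunOn_mem h, Function.invFunOn_eq h⟩

theorem demand_of_lt {u : ℝ} (h : u < F.ustar) : F.demand u = F.f1 u := by
  rw [demand, if_pos h, F.f_of_le h.le]

theorem demand_of_ge {u : ℝ} (h : F.ustar ≤ u) : F.demand u = F.f1 F.ustar := if_neg (not_lt.2 h)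

theorem demand_nonneg {u : ℝ} (h : 0 ≤ u) : 0 ≤ F.demand u := by
  rcases lt_or_ge u F.ustar with h1 | h1
  · rw [demand_of_lt h1]; exact f1_nonneg ⟨h, h1.le⟩
  · rw [demand_of_ge h1]; exact f1_nonneg F.ustar_mem_left

theorem supply_of_lt {s : TrafficState} {u : ℝ} (h : u < F.ustar) : F.supply s u = F.f1 F.ustar :=
  if_pos h

theorem supply_of_ge {s : TrafficState} {u : ℝ} (h : F.ustar ≤ u) :
    F.supply s u = F.datumFlux s u := by
  rw [supply, if_neg (not_lt.2 h), datumFlux]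

theorem datumFlux_mem (s : TrafficState) {u : ℝ} (hu : u ∈ Icc 0 F.umax) :
    (u, F.datumFlux s u) ∈ F.graph := by
  unfold datumFlux
  split_ifs with h
  · rw [h, F.mem_graph_ustar]
    cases s
    · exact ⟨F.jump.le, le_rfl⟩
    · exact ⟨le_rfl, F.jump.le⟩
  · exact F.isJumpGraph.mem_of_ne _ hu h

theorem supply_mem (s : TrafficState) {u : ℝ} (hu : u ∈ Icc 0 F.umax) :
    F.supply s u ∈ Icc 0 (F.f1 F.ustar) := by
  rcases lt_or_ge u F.ustar with h | h
  · rw [supply_of_lt h]; exact ⟨f1_nonneg F.ustar_mem_left, le_rfl⟩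
  · rw [supply_of_ge h]; exact snd_mem (datumFlux_mem s hu)

end DiscFlux

open DiscFlux

/-! ### Incoming junction states -/

section In

variable {F : DiscFlux} {u0 u z : ℝ}

/-- For u0 < ustar and u ≠ u0, comparing J with the graph point over u0 contradicts the increase of
the left branch unless u ≥ ustar. For u0 ≥ ustar, a density below ustar would need a flux above the
maximum `f1 ustar`. -/
theorem InState.cases (h : InState F.graph u0 (u, z)) (hu0 : u0 ∈ Icc 0 F.umax) :
    (u0 < F.ustar ∧ u = u0 ∧ z = F.f1 u0) ∨
      (u ∈ Icc F.ustar F.umax ∧ (u0 < F.ustar → z < F.f1 u0)) := by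
  obtain ⟨hJ, h⟩ := h
  simp only at h
  rcases lt_or_ge u0 F.ustar with hc | hc
  · have hm := F.f1_mem_graph ⟨hu0.1, hc.le⟩
    rcases h with ⟨hle, hlt⟩ | ⟨hle, hlt⟩
    · rcases eq_or_lt_of_le hle with rfl | hlt'
      · exact Or.inl ⟨hc, rfl, ((F.mem_graph_of_lt hc).1 hJ).2⟩
      · have h1 : z < F.f1 u0 := hlt _ hm le_rfl hlt'
        refine Or.inr ⟨⟨?_, hJ.1.2⟩, fun _ => h1⟩
        by_contra hcon
        have := left_mono hm hJ hlt' (not_le.1 hcon)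
        exact absurd this (not_lt.2 h1.le)
    · rcases eq_or_lt_of_le hle with rfl | hlt'
      · exact Or.inl ⟨hc, rfl, ((F.mem_graph_of_lt hc).1 hJ).2⟩
      · have h1 : F.f1 u0 < z := hlt _ hm le_rfl hlt'
        have := left_mono hJ hm hlt' hc
        exact absurd this (not_lt.2 h1.le)
  · refine Or.inr ⟨⟨?_, hJ.1.2⟩, fun h => absurd h (not_lt.2 hc)⟩
    by_contra hcon
    rcases h with ⟨hle, hlt⟩ | ⟨hle, hlt⟩
    · exact hcon (hc.trans hle)
    · have h1 : F.f1 F.ustar < z := hlt _ (f1_mem_graph F.ustar_mem_left) hc (not_le.1 hcon)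
      exact absurd (snd_mem hJ).2 (not_le.2 h1)

/-- For u0 ≤ `low` the flux must be strictly below f1(u0) = f2(η(u0)), and the right part of the
graph decreases, so u > η(u0). -/
theorem InState.mem_inSet (h : InState F.graph u0 (u, z)) (hu0 : u0 ∈ Icc 0 F.umax) :
    u ∈ F.inSet u0 := by
  unfold inSet
  rcases h.cases hu0 with ⟨hc, rfl, -⟩ | ⟨hu, hz⟩
  · split_ifs
    · exact Or.inl rfl
    · exact Or.inl rfl
  · split_ifs with h1 h2
    · have hlt := hz (h1.trans_lt low_lt)
      have he := eta_left hu0.1 h1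
      refine Or.inr ⟨?_, hu.2⟩
      by_contra hcon
      rcases eq_or_lt_of_le (not_lt.1 hcon) with h3 | h3
      · rcases eq_or_lt_of_le hu.1 with h4 | h4
        · rw [← h4] at h
          have h5 := (F.mem_graph_ustar.1 h.1).1
          rw [← he.2, ← h3, ← h4] at hlt
          linarith
        · have h5 := ((F.mem_graph_of_gt h4).1 h.1).2
          rw [← he.2, ← h3] at hlt
          linarith
      · have := right_anti h.1 (f2_mem_graph he.1) hu.1 h3
        rw [← he.2] at hlt
        exact absurd this (not_lt.2 hlt.le)
    · exact Or.inr hu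
    · exact hu

theorem InState.flux_mem (h : InState F.graph u0 (u, z)) (hu0 : u0 ∈ Icc 0 F.umax) :
    z ∈ Icc 0 (F.demand u0) := by
  refine ⟨(snd_mem h.1).1, ?_⟩
  rcases lt_or_ge u0 F.ustar with hc | hc
  · rw [demand_of_lt hc]
    rcases h.cases hu0 with ⟨-, -, hz⟩ | ⟨-, hz⟩
    · exact hz.le
    · exact (hz hc).le
  · rw [demand_of_ge hc]
    exact (snd_mem h.1).2

/-- The strict inequality in `InState.cases` separates the two alternatives, and from ustar on the
flux determines the density. -/
theorem InState.fst_eq {u' : ℝ} (h : InState F.graph u0 (u, z)) (h' : InState F.graph u0 (u', z))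
    (hu0 : u0 ∈ Icc 0 F.umax) : u = u' := by
  rcases h.cases hu0 with ⟨hc, hu, hz⟩ | ⟨hu, hz⟩ <;>
    rcases h'.cases hu0 with ⟨hc', hu', hz'⟩ | ⟨hu', hz'⟩
  · rw [hu, hu']
  · exact absurd hz (hz' hc).ne
  · exact absurd hz' (hz hc').ne
  · rcases lt_trichotomy u u' with h1 | h1 | h1
    · exact absurd (right_anti h.1 h'.1 hu.1 h1) (lt_irrefl _)
    · exact h1
    · exact absurd (right_anti h'.1 h.1 hu'.1 h1) (lt_irrefl _)

/-- A free datum whose flux is exactly z needs no wave; every other flux is reached on the vertical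
segment or the right branch. -/
theorem exists_inState (hu0 : u0 ∈ Icc 0 F.umax) (hz : z ∈ Icc 0 (F.demand u0)) :
    ∃ u, InState F.graph u0 (u, z) := by
  rcases lt_or_ge u0 F.ustar with hc | hc
  · rw [demand_of_lt hc] at hz
    have hm : u0 ∈ Icc 0 F.ustar := ⟨hu0.1, hc.le⟩
    rcases eq_or_lt_of_le hz.2 with rfl | hlt
    · exact ⟨u0, f1_mem_graph hm, Or.inl ⟨le_rfl, fun p _ h1 h2 => absurd h2 (not_lt.2 h1)⟩⟩
    · obtain ⟨u, hu, hG⟩ := exists_mem_graph_right ⟨hz.1, hz.2.trans (f1_le hm)⟩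
      refine ⟨u, hG, Or.inl ⟨hc.le.trans hu.1, fun p hp h1 h2 => ?_⟩⟩
      rcases lt_or_ge p.1 F.ustar with h3 | h3
      · rcases eq_or_lt_of_le h1 with h4 | h4
        · have := (F.mem_graph_of_lt h3).1 hp
          rw [this.2, ← h4]; exact hlt
        · exact hlt.trans (left_mono (f1_mem_graph hm) hp h4 h3)
      · exact right_anti hp hG h3 h2
  · rw [demand_of_ge hc] at hz
    obtain ⟨u, hu, hG⟩ := exists_mem_graph_right hz
    refine ⟨u, hG, ?_⟩
    rcases le_total u0 u with h | h
    · exact Or.inl ⟨h, fun p hp h1 h2 => right_anti hp hG (hc.trans h1) h2⟩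
    · exact Or.inr ⟨h, fun p hp h1 h2 => right_anti hG hp hu.1 h2⟩

end In

/-! ### Outgoing junction states -/

section Out

variable {F : DiscFlux} {s : TrafficState} {u0 u y : ℝ}

theorem OutState.le_max (h : OutState F.graph (u0, F.datumFlux s u0) (u, y)) :
    u ≤ max F.ustar u0 := by
  obtain ⟨hJ, hR, -, h⟩ := h
  simp only at h
  by_contra hcon
  have hcon := not_le.1 hcon
  have h1 : u0 < u := (le_max_right _ _).trans_lt hcon
  have h2 : F.ustar < u := (le_max_left _ _).trans_lt hcon
  rcases h with ⟨hle, -⟩ | ⟨-, hlt⟩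
  · exact absurd hle (not_le.2 h1)
  -- A density between the bound and u lies on the decreasing branch, so its flux exceeds y,
  -- although y must exceed it.
  · set k := (max F.ustar u0 + u) / 2 with hk
    have hk1 : max F.ustar u0 < k := by rw [hk]; linarith
    have hk2 : k < u := by rw [hk]; linarith
    have hkc : F.ustar < k := (le_max_left _ _).trans_lt hk1
    have hm := f2_mem_graph (F := F) ⟨hkc.le, hk2.le.trans hJ.1.2⟩
    have h3 := hlt _ hm hk2 (Or.inl ((le_max_right _ _).trans_lt hk1))
    have h4 := right_anti hm hJ hkc.le hk2
    exact absurd h3 (not_lt.2 h4.le)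

/-- If u0 ≥ ustar and u ≠ u0, the datum state itself must lie above J. This excludes the decreasing
branch and gives the strict bound by the supply. -/
theorem OutState.cases (h : OutState F.graph (u0, F.datumFlux s u0) (u, y)) :
    (u ∈ Icc 0 F.ustar ∧ y = F.f1 u ∧ (F.ustar ≤ u0 → u < F.ustar ∧ y < F.supply s u0)) ∨
      (F.ustar ≤ u0 ∧ u = u0 ∧ y = F.supply s u0) := by
  have hmax := h.le_max
  obtain ⟨hJ, hR, he, h⟩ := h
  simp only at h he
  rcases lt_or_ge u0 F.ustar with hc | hc
  · rw [max_eq_left hc.le] at hmax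
    refine Or.inl ⟨⟨hJ.1.1, hmax⟩, ?_, fun h => absurd h (not_le.2 hc)⟩
    rcases eq_or_lt_of_le hmax with rfl | hlt
    · refine le_antisymm (snd_mem hJ).2 ?_
      by_contra hcon
      rcases h with ⟨hle, -⟩ | ⟨-, hall⟩
      · exact absurd hle (not_le.2 hc)
      -- Points of the left branch near ustar have fluxes close to `f1 ustar` and must lie below y,
      -- so y is the top of the vertical segment.
      · obtain ⟨k, hk, hk1, hk2⟩ := ((F.tendsto_f_left.eventually
          (lt_mem_nhds (not_le.1 hcon))).and ((Ioo_mem_nhdsLT hc))).exists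
        rw [F.f_of_le hk2.le] at hk
        have hm := f1_mem_graph (F := F) ⟨hR.1.1.trans hk1.le, hk2.le⟩
        exact absurd (hall _ hm hk2 (Or.inl hk1)) (not_lt.2 hk.le)
    · exact ((F.mem_graph_of_lt hlt).1 hJ).2
  · rw [max_eq_right hc] at hmax
    rw [supply_of_ge hc]
    rcases eq_or_lt_of_le hmax with h0 | hlt
    · exact Or.inr ⟨hc, h0, (Prod.mk.inj (he h0)).2⟩
    · rcases h with ⟨-, hall⟩ | ⟨hle, -⟩
      · have h1 : y < F.datumFlux s u0 := hall _ hR hlt (Or.inr rfl)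
        have h2 : u < F.ustar := by
          by_contra hcon
          exact absurd (right_anti hJ hR (not_lt.1 hcon) hlt) (not_lt.2 h1.le)
        exact Or.inl ⟨⟨hJ.1.1, h2.le⟩, ((F.mem_graph_of_lt h2).1 hJ).2, fun _ => ⟨h2, h1⟩⟩
      · exact absurd hle (not_le.2 hlt)

theorem OutState.mem_outSet (h : OutState F.graph (u0, F.datumFlux s u0) (u, y)) :
    u ∈ F.outSet s u0 := by
  unfold outSet
  rcases h.cases with ⟨hu, hy, hlt⟩ | ⟨hc, rfl, -⟩
  · split_ifs with h1 h2
    · exact hu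
    · have h3 := hlt h2.ge
      cases s
      · exact hu
      · refine Or.inr ⟨hu.1, ?_⟩
        have h4 := h3.2
        rw [supply_of_ge h2.ge, datumFlux, if_pos h2, hy, critFlux, ← low_spec.2] at h4
        exact (F.strictMonoOn_f1.lt_iff_lt hu low_spec.1).1 h4
    · have hgt : F.ustar < u0 := lt_of_le_of_ne (not_lt.1 h1) (Ne.symm h2)
      have he := eta_right (F := F) ⟨hgt.le, h.2.1.1.2⟩
      have h4 := (hlt hgt.le).2
      rw [supply_of_ge hgt.le, datumFlux, if_neg h2, hy, F.f_of_gt hgt, ← he.2] at h4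
      exact Or.inr ⟨hu.1, (F.strictMonoOn_f1.lt_iff_lt hu he.1).1 h4⟩
  · rw [if_neg (not_lt.2 hc)]
    split_ifs with h2
    · cases s
      · rw [h2]; exact F.ustar_mem_left
      · exact Or.inl h2
    · exact Or.inl rfl

theorem OutState.flux_le (h : OutState F.graph (u0, F.datumFlux s u0) (u, y)) :
    y ≤ F.supply s u0 := by
  rcases h.cases with ⟨hu, hy, hlt⟩ | ⟨-, -, hy⟩
  · rcases lt_or_ge u0 F.ustar with hc | hc
    · rw [supply_of_lt hc, hy]; exact f1_le hu
    · exact (hlt hc).2.le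
  · exact hy.le

theorem OutState.fst_eq {u' : ℝ} (h : OutState F.graph (u0, F.datumFlux s u0) (u, y))
    (h' : OutState F.graph (u0, F.datumFlux s u0) (u', y)) : u = u' := by
  rcases h.cases with ⟨hu, hy, hlt⟩ | ⟨hc, hu, hy⟩ <;>
    rcases h'.cases with ⟨hu', hy', hlt'⟩ | ⟨hc', hu', hy'⟩
  · exact F.strictMonoOn_f1.injOn hu hu' (hy.symm.trans hy')
  · exact absurd hy' (hlt hc').2.ne
  · exact absurd hy (hlt' hc).2.ne
  · rw [hu, hu']

theorem exists_outState (hu0 : u0 ∈ Icc 0 F.umax) (hy : y ∈ Icc 0 (F.supply s u0)) :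
    ∃ u, OutState F.graph (u0, F.datumFlux s u0) (u, y) := by
  have hR := F.datumFlux_mem s hu0
  rcases lt_or_ge u0 F.ustar with hc | hc
  · rw [supply_of_lt hc] at hy
    obtain ⟨u, hu, rfl⟩ := exists_f1_eq hy
    have hJ := f1_mem_graph hu
    refine ⟨u, hJ, hR, fun h => ?_, ?_⟩
    · have h : u = u0 := h
      rw [h, datumFlux, if_neg hc.ne, F.f_of_le hc.le]
    · rcases le_or_gt u u0 with h | h
      · refine Or.inl ⟨h, fun p hp h1 h2 => left_mono hJ hp h1 ?_⟩
        rcases h2 with h2 | rfl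
        · exact h2.trans hc
        · exact hc
      · refine Or.inr ⟨h.le, fun p hp h1 _ => ?_⟩
        have h1 : p.1 < u := h1
        have h3 := (F.mem_graph_of_lt (h1.trans_le hu.2)).1 hp
        rw [h3.2]
        exact F.strictMonoOn_f1 ⟨h3.1, (h1.trans_le hu.2).le⟩ hu h1
  · have hsup := supply_mem s hu0
    rw [supply_of_ge hc] at hy hsup
    rcases eq_or_lt_of_le hy.2 with rfl | hlt
    · exact ⟨u0, hR, hR, fun _ => rfl, Or.inl ⟨le_rfl, fun p hp h1 h2 => by
        rcases h2 with h2 | rfl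
        · exact absurd h2 (not_lt.2 h1.le)
        · exact absurd h1 (lt_irrefl _)⟩⟩
    · obtain ⟨u, hu, rfl⟩ := exists_f1_eq ⟨hy.1, hy.2.trans hsup.2⟩
      have hJ := f1_mem_graph hu
      have huc : u < F.ustar := by
        refine lt_of_le_of_ne hu.2 fun h => ?_
        rw [h] at hlt
        exact absurd hsup.2 (not_le.2 hlt)
      refine ⟨u, hJ, hR, fun h => absurd h (huc.trans_le hc).ne,
        Or.inl ⟨(huc.trans_le hc).le, fun p hp h1 h2 => ?_⟩⟩
      rcases lt_or_ge p.1 F.ustar with h3 | h3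
      · exact left_mono hJ hp h1 h3
      · rcases h2 with h2 | rfl
        · exact hlt.trans (right_anti hp hR h3 h2)
        · exact hlt

/-- Every outgoing junction state is attained by a road solution. -/
theorem OutState.exists_solution {J : ℝ × ℝ}
    (h : OutState F.graph (u0, F.datumFlux s u0) J) :
    ∃ u v, IsRoadSolution F (Ioi 0) u0 (-J.2) u v ∧
      (∀ t > 0, Tendsto (fun x => v x t) (𝓝[>] 0) (𝓝 J.2)) ∧
      ∀ t > 0, Tendsto (fun x => v x t) atTop (𝓝 (F.datumFlux s u0)) := by
  have hmax := OutState.le_max (u := J.1) (y := J.2) h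
  obtain ⟨hJ, hR, he, h⟩ := h
  set v1 := F.datumFlux s u0 with hv1
  by_cases heq : J.1 = u0
  · have hJR := he heq
    have := exists_outgoing_of_compact (F := F) (σ := 1) (K := {J}) (Or.inl rfl)
      isCompact_singleton (fun p hp => by simpa [mem_singleton_iff.1 hp] using hJ) (J := J)
      (R := J) rfl (fun p hp _ => hp) rfl (fun p hp => by rw [mem_singleton_iff.1 hp])
      (fun p hp _ => by rw [mem_singleton_iff.1 hp]) (fun k _ _ => by
        rcases le_total J.1 (1 * k) with h | h
        · exact Or.inr (Or.inl fun p hp => by rw [mem_singleton_iff.1 hp]; exact h)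
        · exact Or.inr (Or.inr fun p hp => by rw [mem_singleton_iff.1 hp]; exact h))
    rw [hJR] at this ⊢
    simpa using this
  simp only at h
  rcases h with ⟨hle, hlt⟩ | ⟨hle, hlt⟩
  · have hlt' : J.1 < u0 := lt_of_le_of_ne hle heq
    have hJv : J.2 < v1 := hlt _ hR hlt' (Or.inr rfl)
    -- With the whole vertical segment in K, minimization at large ξ could select a flux below v1.
    -- For u0 = ustar, K therefore consists of the closed left branch from J.1 and the single point
    -- (u0, v1).
    by_cases hc : u0 = F.ustar
    · have hJc : J.1 < F.ustar := hc ▸ hlt'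
      have hJ2 := (F.mem_graph_of_lt hJc).1 hJ
      have hsub : Icc J.1 F.ustar ⊆ Icc 0 F.ustar := Icc_subset_Icc_left hJ.1.1
      have hv1m : v1 ≤ F.f1 F.ustar := (snd_mem hR).2
      have := exists_outgoing_of_compact (F := F) (σ := 1)
        (K := (fun k => (k, F.f1 k)) '' Icc J.1 F.ustar ∪ {(u0, v1)}) (Or.inl rfl)
        ((isCompact_Icc.image_of_continuousOn
          (continuousOn_id.prodMk (F.continuousOn_f1.mono hsub))).union isCompact_singleton)
        ?_ (J := J) (R := (u0, v1)) (Or.inl ⟨J.1, ⟨le_rfl, hJc.le⟩, Prod.ext rfl hJ2.2.symm⟩)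
        ?_ (Or.inr rfl) ?_ ?_ ?_
      · simpa using this
      · rintro p (⟨k, hk, rfl⟩ | rfl)
        · simpa using f1_mem_graph (hsub hk)
        · simpa using hR
      · rintro p (⟨k, hk, rfl⟩ | rfl) hp
        · have h1 : F.f1 k ≤ F.f1 J.1 := by rw [← hJ2.2]; exact hp
          have h2 := (F.strictMonoOn_f1.le_iff_le (hsub hk) (hsub ⟨le_rfl, hJc.le⟩)).1 h1
          have h3 : k = J.1 := le_antisymm h2 hk.1
          exact Prod.ext h3 (by rw [hJ2.2]; simp only [h3])
        · exact absurd hp (not_le.2 hJv)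
      · rintro p (⟨k, hk, rfl⟩ | rfl)
        · exact hc ▸ hk.2
        · exact le_rfl
      · rintro p (⟨k, hk, rfl⟩ | rfl) hp
        · have : k = F.ustar := by rw [← hc]; exact hp
          simpa [this] using hv1m
        · exact le_rfl
      · intro k hk hkc
        simp only [one_mul]
        rcases lt_or_ge k J.1 with h1 | h1
        · refine Or.inr (Or.inr ?_)
          rintro p (⟨k', hk', rfl⟩ | rfl)
          · exact h1.le.trans hk'.1
          · exact (h1.trans hlt').le
        rcases lt_or_ge k F.ustar with h2 | h2
        · exact Or.inl (Or.inl ⟨k, ⟨h1, h2.le⟩, by simp only [F.f_of_le h2.le]⟩)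
        · refine Or.inr (Or.inl ?_)
          rintro p (⟨k', hk', rfl⟩ | rfl)
          · exact hk'.2.trans h2
          · exact hc.le.trans h2
    · have hRe : ∀ p ∈ F.graph, p.1 = u0 → p = (u0, v1) := fun p hp hpu => by
        refine Prod.ext hpu ?_
        rw [hp.2.1 (by rw [hpu]; exact hc), hR.2.1 hc, hpu]
      have := exists_outgoing_of_compact (F := F) (σ := 1)
        (K := F.graph ∩ ({p | J.1 ≤ p.1} ∩ {p | p.1 ≤ u0} ∩ {p | J.2 ≤ p.2})) (Or.inl rfl)
        (F.isCompact_graph.inter_right (((isClosed_le continuous_const continuous_fst).inter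
          (isClosed_le continuous_fst continuous_const)).inter
          (isClosed_le continuous_const continuous_snd)))
        (fun p hp => by simpa using hp.1) (J := J) (R := (u0, v1))
        ⟨hJ, ⟨le_refl J.1, hle⟩, le_refl J.2⟩ (fun p hp hpJ => ?_)
        ⟨hR, ⟨hle, le_refl u0⟩, hJv.le⟩ (fun p hp => hp.2.1.2)
        (fun p hp hpu => by rw [hRe p hp.1 hpu]) (fun k hk hkc => ?_)
      · simpa using this
      · by_contra hne
        rcases eq_or_lt_of_le (show J.1 ≤ p.1 from hp.2.1.1) with h1 | h1
        · exact hne (Prod.ext h1.symm (le_antisymm hpJ hp.2.2))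
        · refine absurd hpJ (not_le.2 (hlt p hp.1 h1 ?_))
          rcases eq_or_lt_of_le (show p.1 ≤ u0 from hp.2.1.2) with h2 | h2
          · exact Or.inr (hRe p hp.1 h2)
          · exact Or.inl h2
      · simp only [one_mul]
        rcases le_or_gt k J.1 with h1 | h1
        · exact Or.inr (Or.inr fun p hp => h1.trans hp.2.1.1)
        rcases le_or_gt u0 k with h2 | h2
        · exact Or.inr (Or.inl fun p hp => le_trans hp.2.1.2 h2)
        have hmem := F.isJumpGraph.mem_of_ne k hk hkc
        exact Or.inl ⟨hmem, ⟨h1.le, h2.le⟩, (hlt _ hmem h1 (Or.inl h2)).le⟩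
  · have hlt' : u0 < J.1 := lt_of_le_of_ne hle (Ne.symm heq)
    have hJv : v1 < J.2 := hlt _ hR hlt' (Or.inr rfl)
    -- By `OutState.le_max` a falling wave has its datum on the left branch, where the graph is
    -- single-valued.
    have hc : u0 < F.ustar := by
      by_contra hcon
      rw [max_eq_right (not_lt.1 hcon)] at hmax
      exact absurd hmax (not_le.2 hlt')
    have hRe : ∀ p ∈ F.graph, p.1 = u0 → p = (u0, v1) := fun p hp hpu => by
      refine Prod.ext hpu ?_
      rw [hp.2.1 (by rw [hpu]; exact hc.ne), hR.2.1 hc.ne, hpu]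
    have := exists_outgoing_of_compact (F := F) (σ := -1)
      (K := {p | -p ∈ F.graph ∩ ({p | p.1 ≤ J.1} ∩ {p | u0 ≤ p.1} ∩ {p | p.2 ≤ J.2})}) (Or.inr rfl)
      (isCompact_neg_preimage (F.isCompact_graph.inter_right
        (((isClosed_le continuous_fst continuous_const).inter
        (isClosed_le continuous_const continuous_fst)).inter
        (isClosed_le continuous_snd continuous_const))))
      (fun p hp => by
        have := hp.1
        rwa [neg_one_mul, neg_one_mul]) (J := -J) (R := -(u0, v1))
      (by simpa using ⟨hJ, hle⟩) (fun p hp hpJ => ?_)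
      (by simpa using ⟨hR, hle, hJv.le⟩)
      (fun p hp => by
        have : u0 ≤ -p.1 := hp.2.1.2
        simp only [Prod.fst_neg]
        linarith)
      (fun p hp hpu => by
        have h1 := hRe _ hp.1 (by simp [hpu])
        have h2 : -p.2 = v1 := congrArg Prod.snd h1
        simp only [Prod.snd_neg]
        linarith)
      (fun k hk hkc => ?_)
    · simpa using this
    · have h1 : -p.1 ≤ J.1 := hp.2.1.1
      have h2 : u0 ≤ -p.1 := hp.2.1.2
      have h3 : -p.2 ≤ J.2 := hp.2.2
      have h4 : p.2 ≤ -J.2 := hpJ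
      by_contra hne
      rcases eq_or_lt_of_le h1 with h5 | h5
      · exact hne (Prod.ext (by simp; linarith) (by simp; linarith))
      · have h6 : -p.2 < J.2 := by
          refine hlt (-p) hp.1 h5 ?_
          rcases eq_or_lt_of_le h2 with h6 | h6
          · exact Or.inr (hRe _ hp.1 h6.symm)
          · exact Or.inl h6
        linarith
    · rcases le_or_gt J.1 k with h1 | h1
      · refine Or.inr (Or.inr fun p hp => ?_)
        have : -p.1 ≤ J.1 := hp.2.1.1
        linarith
      rcases le_or_gt k u0 with h2 | h2
      · refine Or.inr (Or.inl fun p hp => ?_)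
        have : u0 ≤ -p.1 := hp.2.1.2
        linarith
      have hmem := F.isJumpGraph.mem_of_ne k hk hkc
      exact Or.inl (by simpa using ⟨hmem, ⟨h1.le, h2.le⟩, (hlt _ hmem h1 (Or.inl h2)).le⟩)

end Out

/-! ### Solutions on the network -/

section Network

variable {F : DiscFlux} {uin0 : Fin 2 → ℝ} {uout0 : ℝ} {s : TrafficState} {w w' : NetworkFunction}
  {z : Fin 2 → ℝ}

theorem HasInflow.unique {z' : Fin 2 → ℝ} (h : HasInflow w z) (h' : HasInflow w z') : z = z' :=
  funext fun i => tendsto_nhds_unique (h i 1 one_pos) (h' i 1 one_pos)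

namespace IsJunctionSolution

variable (h : IsJunctionSolution F uin0 uout0 s w)
include h

theorem exists_wave_in (hz : HasInflow w z) (i : Fin 2) :
    ∃ S W uJ v0, IsWave F.graph F.f F.ustar 0 F.umax (Iio 0) S
      ((Iio 0).indicator fun ξ => w.uin i ξ 1) ((Iio 0).indicator fun ξ => w.vin i ξ 1) W
      (uin0 i, v0) (uJ, z i) ∧
      (∀ t > 0, Tendsto (fun x => w.uin i x t) (𝓝[<] 0) (𝓝 uJ)) ∧
      InState F.graph (uin0 i) (uJ, z i) :=
  (h.incoming i).exists_wave_in (h.weak.isRoadWeak_in i) (hz i 1 one_pos)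

theorem hasOutflow (hz : HasInflow w z) : HasOutflow w (∑ i, z i) := by
  obtain ⟨z', hz', hy⟩ := h.balance
  rwa [hz.unique hz']

theorem exists_wave_out (hz : HasInflow w z) :
    ∃ S W uJ, IsWave F.graph F.f F.ustar 0 F.umax (Ioi 0) S
      ((Ioi 0).indicator fun ξ => w.uout ξ 1) ((Ioi 0).indicator fun ξ => w.vout ξ 1) W
      (uJ, ∑ i, z i) (uout0, F.datumFlux s uout0) ∧
      (∀ t > 0, Tendsto (fun x => w.uout x t) (𝓝[>] 0) (𝓝 uJ)) ∧
      OutState F.graph (uout0, F.datumFlux s uout0) (uJ, ∑ i, z i) :=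
  h.outgoing.exists_wave_out h.weak.isRoadWeak_out (h.hasOutflow hz 1 one_pos)
    fun h0 => h.ahead h0 1 one_pos

theorem inflow_mem_feasible (huin0 : ∀ i, uin0 i ∈ Icc 0 F.umax) (hz : HasInflow w z) :
    z ∈ feasible F uin0 uout0 s := by
  have hin : ∀ i, z i ∈ Icc 0 (F.demand (uin0 i)) := fun i => by
    obtain ⟨_, _, _, _, -, -, hs⟩ := h.exists_wave_in hz i
    exact hs.flux_mem (huin0 i)
  obtain ⟨_, _, _, -, -, hs⟩ := h.exists_wave_out hz
  exact ⟨hin, le_min (Finset.sum_le_sum fun i _ => (hin i).2) hs.flux_le⟩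

end IsJunctionSolution

/-- The roads are solved independently; the junction couples them only through the fluxes, whose
balance is built into the choice of the outflow. -/
theorem exists_junctionSolution (huin0 : ∀ i, uin0 i ∈ Icc 0 F.umax)
    (huout0 : uout0 ∈ Icc 0 F.umax) (hz : z ∈ feasible F uin0 uout0 s) :
    ∃ w, IsJunctionSolution F uin0 uout0 s w ∧ HasInflow w z := by
  have hin : ∀ i, ∃ u v, IsRoadSolution F (Iio 0) (uin0 i) (z i) u v ∧
      ∀ t > 0, Tendsto (fun x => v x t) (𝓝[<] 0) (𝓝 (z i)) := fun i => by
    obtain ⟨u, hu⟩ := exists_inState (huin0 i) (hz.1 i)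
    exact hu.exists_solution (huin0 i)
  choose u v huv hv using hin
  obtain ⟨k, hk⟩ := exists_outState (F := F) (s := s) huout0 (y := ∑ i, z i)
    ⟨Finset.sum_nonneg fun i _ => (hz.1 i).1, hz.2.trans (min_le_right _ _)⟩
  obtain ⟨uo, vo, ho, hvo, hinf⟩ := hk.exists_solution
  refine ⟨⟨u, v, uo, vo⟩, ⟨fun i => (huv i).admissible, ho.admissible, ?_, ?_, z, hv, hvo⟩, hv⟩
  · intro φ ψ hφ hψ hψc hm
    have h1 := tendsto_finsetSum Finset.univ fun i _ =>
      (huv i).tendsto_weak (φ i) (hφ i).1 (hφ i).2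
    have h2 := h1.add (ho.tendsto_weak ψ hψ hψc)
    -- For every time cutoff the boundary terms cancel, as the test functions agree at x = 0.
    refine tendsto_nhds_unique h2 (tendsto_const_nhds.congr fun n => ?_)
    simp only [(hm _ _).1, integral_const_mul]
    rw [← Finset.sum_mul]
    ring
  · intro h0 t ht
    have := hinf t ht
    rwa [datumFlux, if_pos h0] at this

theorem ae_eq_road {I S S' : Set ℝ} {u v u' v' : ℝ → ℝ → ℝ} (hI : IsCone I)
    (h : F.RoadAdmissible I u v) (h' : F.RoadAdmissible I u' v') (hS : volume (I \ (S ∩ S')) = 0)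
    (he : ∀ ξ ∈ S ∩ S', I.indicator (fun ξ => u ξ 1) ξ = I.indicator (fun ξ => u' ξ 1) ξ ∧
      I.indicator (fun ξ => v ξ 1) ξ = I.indicator (fun ξ => v' ξ 1) ξ) :
    ∀ᵐ p ∂(volume.restrict (I ×ˢ Ioi (0 : ℝ))), u p.1 p.2 = u' p.1 p.2 ∧ v p.1 p.2 = v' p.1 p.2 := by
  have h1 : ∀ᵐ ξ ∂(volume.restrict I),
      I.indicator (fun ξ => u ξ 1) ξ = I.indicator (fun ξ => u' ξ 1) ξ ∧
      I.indicator (fun ξ => v ξ 1) ξ = I.indicator (fun ξ => v' ξ 1) ξ := by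
    rw [ae_restrict_iff' hI.measurableSet, ae_iff]
    refine measure_mono_null (fun ξ hξ => ?_) hS
    simp only [mem_ofPred_eq, Classical.not_imp] at hξ
    exact ⟨hξ.1, fun hm => hξ.2 (he ξ hm)⟩
  filter_upwards [hI.ae_prod_of_ae h1, ae_restrict_mem (hI.measurableSet.prod measurableSet_Ioi)]
    with p hp hpI
  obtain ⟨h2, h3⟩ := h.eq_slice hI hpI.1 hpI.2
  obtain ⟨h4, h5⟩ := h'.eq_slice hI hpI.1 hpI.2
  rw [h2, h3, h4, h5]
  exact hp

theorem ae_isHullValue {I S : Set ℝ} {u v : ℝ → ℝ → ℝ} {L R : ℝ × ℝ} (hI : IsCone I)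
    (h : F.RoadAdmissible I u v) (hS : volume (I \ S) = 0)
    (he : ∀ ξ ∈ S, IsHullPoint F.graph L R ξ (I.indicator (fun ξ => u ξ 1) ξ,
      I.indicator (fun ξ => v ξ 1) ξ)) :
    ∀ᵐ p ∂(volume.restrict (I ×ˢ Ioi (0 : ℝ))),
      F.IsHullValue L R (p.1 / p.2) (u p.1 p.2, v p.1 p.2) := by
  have h1 : ∀ᵐ ξ ∂(volume.restrict I),
      IsHullPoint F.graph L R ξ (I.indicator (fun ξ => u ξ 1) ξ,
        I.indicator (fun ξ => v ξ 1) ξ) := by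
    rw [ae_restrict_iff' hI.measurableSet, ae_iff]
    refine measure_mono_null (fun ξ hξ => ?_) hS
    simp only [mem_ofPred_eq, Classical.not_imp] at hξ
    exact ⟨hξ.1, fun hm => hξ.2 (he ξ hm)⟩
  filter_upwards [hI.ae_prod_of_ae h1, ae_restrict_mem (hI.measurableSet.prod measurableSet_Ioi)]
    with p hp hpI
  obtain ⟨h2, h3⟩ := h.eq_slice hI hpI.1 hpI.2
  rw [h2, h3]
  exact hp

/-- A junction solution is determined by its inflows. -/
theorem IsJunctionSolution.aeEqual (h : IsJunctionSolution F uin0 uout0 s w)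
    (h' : IsJunctionSolution F uin0 uout0 s w') (huin0 : ∀ i, uin0 i ∈ Icc 0 F.umax)
    (hz : HasInflow w z) (hz' : HasInflow w' z) : AEEqual w w' := by
  refine ⟨fun i => ?_, ?_⟩
  · obtain ⟨S, W, uJ, v0, hw, -, hs⟩ := h.exists_wave_in hz i
    obtain ⟨S', W', uJ', v0', hw', -, hs'⟩ := h'.exists_wave_in hz' i
    -- Equal junction fluxes give equal junction densities. The fluxes v0 and v0' at infinity may
    -- differ a priori, which `IsWave.unique` tolerates.
    obtain rfl := hs.fst_eq hs' (huin0 i)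
    exact ae_eq_road isCone_Iio (h.incoming i) (h'.incoming i) (hw.null_inter hw') fun ξ hξ =>
      hw.unique hw' rfl hξ
  · obtain ⟨S, W, uJ, hw, -, hs⟩ := h.exists_wave_out hz
    obtain ⟨S', W', uJ', hw', -, hs'⟩ := h'.exists_wave_out hz'
    obtain rfl := hs.fst_eq hs'
    exact ae_eq_road isCone_Ioi h.outgoing h'.outgoing (hw.null_inter hw') fun ξ hξ =>
      hw.unique hw' rfl hξ

theorem IsJunctionSolution.exists_incomingWave (h : IsJunctionSolution F uin0 uout0 s w)
    (huin0 : ∀ i, uin0 i ∈ Icc 0 F.umax) (hz : HasInflow w z) (i : Fin 2) :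
    ∃ uJ ∈ F.inSet (uin0 i), IncomingWave F (uin0 i) (uJ, z i) (w.uin i) (w.vin i) := by
  obtain ⟨S, W, uJ, v0, hw, hu, hs⟩ := h.exists_wave_in hz i
  exact ⟨uJ, hs.mem_inSet (huin0 i), hu, v0, hw.left_mem,
    ae_isHullValue isCone_Iio (h.incoming i) hw.null fun ξ hξ => hw.isHullPoint hξ,
    fun ξ hξ p => InState.isHullPoint_iff (L := (uin0 i, v0)) hs (fun he => hw.eq_of_fst_eq he) hξ p⟩

theorem IsJunctionSolution.exists_outgoingWave (h : IsJunctionSolution F uin0 uout0 s w)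
    (hz : HasInflow w z) :
    ∃ uJ ∈ F.outSet s uout0, OutgoingWave F s uout0 (uJ, ∑ i, z i) w.uout w.vout := by
  obtain ⟨S, W, uJ, hw, hu, hs⟩ := h.exists_wave_out hz
  exact ⟨uJ, hs.mem_outSet, hu,
    ae_isHullValue isCone_Ioi h.outgoing hw.null fun ξ hξ => hw.isHullPoint hξ,
    fun ξ hξ p => hs.isHullPoint_iff hξ p⟩

end Network

/-! ### The priority rule -/

section Priority

/-- The clamp is the projection of p onto the interval; `eq_clamp` says that no other point is as
close. -/
theorem abs_clamp_sub_le {a b p x : ℝ} (hx : x ∈ Icc a b) :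
    |max a (min b p) - p| ≤ |x - p| := by
  obtain ⟨h1, h2⟩ := hx
  rcases le_total p b with hb | hb
  · rw [min_eq_right hb]
    rcases le_total a p with ha | ha
    · rw [max_eq_right ha]; simp
    · rw [max_eq_left ha, abs_of_nonneg (by linarith), abs_of_nonneg (by linarith)]; linarith
  · rw [min_eq_left hb, max_eq_right (h1.trans h2), abs_of_nonpos (by linarith),
      abs_of_nonpos (by linarith)]
    linarith

theorem eq_clamp {a b p x : ℝ} (hx : x ∈ Icc a b) (h : |x - p| ≤ |max a (min b p) - p|) :
    x = max a (min b p) := by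
  obtain ⟨h1, h2⟩ := hx
  rcases le_total p b with hb | hb
  · rw [min_eq_right hb] at h ⊢
    rcases le_total a p with ha | ha
    · rw [max_eq_right ha] at h ⊢
      simp only [sub_self, abs_zero] at h
      linarith [abs_eq_zero.1 (le_antisymm h (abs_nonneg _))]
    · rw [max_eq_left ha] at h ⊢
      rw [abs_of_nonneg (by linarith), abs_of_nonneg (by linarith)] at h
      linarith
  · rw [min_eq_left hb, max_eq_right (h1.trans h2)] at h ⊢
    rw [abs_of_nonpos (by linarith), abs_of_nonpos (by linarith)] at h
    linarith

/-- Since (1 - q) z₀ - q z₁ = z₀ - q (z₀ + z₁), on a line of fixed total the distance depends on the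
first inflow alone. -/
theorem priorityDist_of_sum {q m : ℝ} {z : Fin 2 → ℝ} (h : ∑ i, z i = m) :
    priorityDist q z = |z 0 - q * m| / √(q ^ 2 + (1 - q) ^ 2) := by
  rw [Fin.sum_univ_two] at h
  rw [priorityDist, ← h]
  congr 2
  ring

variable (F : DiscFlux) (q : ℝ) (uin0 : Fin 2 → ℝ) (uout0 : ℝ) (s : TrafficState)

/-- The inflows selected by the priority rule. -/
def priorityInflow : Fin 2 → ℝ :=
  let m := maxFlux F uin0 uout0 s
  let c := max (max 0 (m - F.demand (uin0 1))) (min (min (F.demand (uin0 0)) m) (q * m))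
  ![c, m - c]

variable {F q uin0 uout0 s}

theorem sum_priorityInflow :
    ∑ i, priorityInflow F q uin0 uout0 s i = maxFlux F uin0 uout0 s := by
  simp [priorityInflow, Fin.sum_univ_two]

theorem maxFlux_nonneg (huin0 : ∀ i, uin0 i ∈ Icc 0 F.umax) (huout0 : uout0 ∈ Icc 0 F.umax) :
    0 ≤ maxFlux F uin0 uout0 s :=
  le_min (Finset.sum_nonneg fun i _ => demand_nonneg (huin0 i).1) (supply_mem s huout0).1

/-- With the total fixed, the bounds on the second inflow become bounds on the first. This is the
interval to which `priorityInflow` clamps. -/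
theorem fst_mem_of_feasible {z : Fin 2 → ℝ} (hz : z ∈ feasible F uin0 uout0 s)
    (hs : ∑ i, z i = maxFlux F uin0 uout0 s) :
    z 0 ∈ Icc (max 0 (maxFlux F uin0 uout0 s - F.demand (uin0 1)))
      (min (F.demand (uin0 0)) (maxFlux F uin0 uout0 s)) := by
  rw [Fin.sum_univ_two] at hs
  have h0 := hz.1 0
  have h1 := hz.1 1
  exact ⟨max_le h0.1 (by linarith [h1.2]), le_min h0.2 (by linarith [h1.1])⟩

theorem priorityInflow_mem (huin0 : ∀ i, uin0 i ∈ Icc 0 F.umax) (huout0 : uout0 ∈ Icc 0 F.umax) :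
    priorityInflow F q uin0 uout0 s ∈ feasible F uin0 uout0 s := by
  refine ⟨?_, sum_priorityInflow.le⟩
  have hm := maxFlux_nonneg (s := s) huin0 huout0
  have hD : maxFlux F uin0 uout0 s ≤ F.demand (uin0 0) + F.demand (uin0 1) := by
    rw [← Fin.sum_univ_two fun i => F.demand (uin0 i)]
    exact min_le_left _ _
  have h0 := demand_nonneg (F := F) (huin0 0).1
  have h1 := demand_nonneg (F := F) (huin0 1).1
  set m := maxFlux F uin0 uout0 s with hmdef
  set c := max (max 0 (m - F.demand (uin0 1))) (min (min (F.demand (uin0 0)) m) (q * m)) with hc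
  have hc1 : 0 ≤ c := (le_max_left _ _).trans (le_max_left _ _)
  have hc2 : m - F.demand (uin0 1) ≤ c := (le_max_right _ _).trans (le_max_left _ _)
  have hc3 : c ≤ min (F.demand (uin0 0)) m :=
    max_le (max_le (le_min h0 hm) (le_min (by linarith) (by linarith))) (min_le_left _ _)
  have hc4 : c ≤ F.demand (uin0 0) := hc3.trans (min_le_left _ _)
  have hc5 : c ≤ m := hc3.trans (min_le_right _ _)
  have he : priorityInflow F q uin0 uout0 s = ![c, m - c] := rfl
  rw [he]
  intro i
  fin_cases i
  · exact ⟨hc1, hc4⟩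
  · exact ⟨sub_nonneg.2 hc5, by simp only [Matrix.cons_val_one, Fin.mk_one, Matrix.cons_val_fin_one]; linarith⟩

theorem sqrt_pos_of_priority (q : ℝ) : 0 < √(q ^ 2 + (1 - q) ^ 2) :=
  Real.sqrt_pos.2 (by nlinarith [sq_nonneg (q - (1 - q))])

theorem priorityDist_priorityInflow_le {z : Fin 2 → ℝ} (hz : z ∈ feasible F uin0 uout0 s)
    (hs : ∑ i, z i = maxFlux F uin0 uout0 s) :
    priorityDist q (priorityInflow F q uin0 uout0 s) ≤ priorityDist q z := by
  rw [priorityDist_of_sum hs, priorityDist_of_sum sum_priorityInflow]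
  exact div_le_div_of_nonneg_right (abs_clamp_sub_le (fst_mem_of_feasible hz hs))
    (sqrt_pos_of_priority q).le

theorem eq_priorityInflow {z : Fin 2 → ℝ} (hz : z ∈ feasible F uin0 uout0 s)
    (hs : ∑ i, z i = maxFlux F uin0 uout0 s)
    (h : priorityDist q z ≤ priorityDist q (priorityInflow F q uin0 uout0 s)) :
    z = priorityInflow F q uin0 uout0 s := by
  rw [priorityDist_of_sum hs, priorityDist_of_sum sum_priorityInflow,
    div_le_div_iff_of_pos_right (sqrt_pos_of_priority q)] at h
  have h0 : z 0 = priorityInflow F q uin0 uout0 s 0 := eq_clamp (fst_mem_of_feasible hz hs) h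
  have h1 := hs.trans (sum_priorityInflow (F := F) (q := q) (uin0 := uin0) (uout0 := uout0)
    (s := s)).symm
  rw [Fin.sum_univ_two, Fin.sum_univ_two] at h1
  funext i
  fin_cases i
  · exact h0
  · simp only [Fin.mk_one]; linarith

theorem isPriorityInflow_priorityInflow (huin0 : ∀ i, uin0 i ∈ Icc 0 F.umax)
    (huout0 : uout0 ∈ Icc 0 F.umax) :
    IsPriorityInflow F q uin0 uout0 s (priorityInflow F q uin0 uout0 s) := by
  refine ⟨fun hP => ?_, fun _ => ⟨priorityInflow_mem huin0 huout0, sum_priorityInflow,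
    fun z hz hs => priorityDist_priorityInflow_le hz hs⟩⟩
  have hs : ∑ i, priorityPoint F q uin0 uout0 s i = maxFlux F uin0 uout0 s := by
    rw [Fin.sum_univ_two]
    simp only [priorityPoint, Matrix.cons_val_zero, Matrix.cons_val_one, Matrix.cons_val_fin_one]
    ring
  -- A feasible priority point has distance zero, so it is the unique minimizer.
  refine (eq_priorityInflow hP hs ?_).symm
  rw [priorityDist_of_sum hs]
  simp only [priorityPoint, Matrix.cons_val_zero, sub_self, abs_zero, zero_div]
  exact div_nonneg (abs_nonneg _) (Real.sqrt_nonneg _)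

/-- Admissible solutions are the junction solutions whose inflows obey the priority rule. -/
theorem isAdmissible_iff (huin0 : ∀ i, uin0 i ∈ Icc 0 F.umax) (huout0 : uout0 ∈ Icc 0 F.umax)
    {w : NetworkFunction} : IsAdmissible F q uin0 uout0 s w ↔
      IsJunctionSolution F uin0 uout0 s w ∧ HasInflow w (priorityInflow F q uin0 uout0 s) := by
  constructor
  · rintro ⟨h, z, hz, hmax⟩
    -- Comparison with a solution that attains the priority inflows forces the total to be `maxFlux`
    -- and the distance to be minimal.
    obtain ⟨w', hw', hz'⟩ := exists_junctionSolution huin0 huout0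
      (priorityInflow_mem (q := q) (s := s) huin0 huout0)
    have hf := h.inflow_mem_feasible huin0 hz
    obtain ⟨h1, h2⟩ := hmax w' _ hw' hz'
    rw [sum_priorityInflow] at h1 h2
    have hs := le_antisymm hf.2 h1
    rw [← eq_priorityInflow hf hs (h2 hs.symm)]
    exact ⟨h, hz⟩
  · rintro ⟨h, hz⟩
    refine ⟨h, _, hz, fun w' z' hw' hz' => ?_⟩
    have hf := hw'.inflow_mem_feasible huin0 hz'
    rw [sum_priorityInflow]
    exact ⟨hf.2, fun hs => priorityDist_priorityInflow_le hf hs⟩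

end Priority

end JunctionFlux

end

/-! ### Conclusion: existence, uniqueness and structure -/

theorem theorem3p2 (F : JunctionFlux.DiscFlux) (q : ℝ) (hq0 : 0 < q) (hq1 : q < 1)
    (uin0 : Fin 2 → ℝ) (huin0 : ∀ i, uin0 i ∈ Icc 0 F.umax)
    (uout0 : ℝ) (huout0 : uout0 ∈ Icc 0 F.umax) (s : JunctionFlux.TrafficState) :
    (∃ w, JunctionFlux.IsAdmissible F q uin0 uout0 s w) ∧
    (∀ w w', JunctionFlux.IsAdmissible F q uin0 uout0 s w →
      JunctionFlux.IsAdmissible F q uin0 uout0 s w' → JunctionFlux.AEEqual w w') ∧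
    (∀ w, JunctionFlux.IsAdmissible F q uin0 uout0 s w →
      ∃ (z : Fin 2 → ℝ) (uin : Fin 2 → ℝ) (uout : ℝ),
        JunctionFlux.HasInflow w z ∧ JunctionFlux.HasOutflow w (∑ i, z i) ∧
        ∑ i, z i = JunctionFlux.maxFlux F uin0 uout0 s ∧
        JunctionFlux.IsPriorityInflow F q uin0 uout0 s z ∧
        (∀ i, uin i ∈ F.inSet (uin0 i) ∧
          JunctionFlux.IncomingWave F (uin0 i) (uin i, z i) (w.uin i) (w.vin i)) ∧
        uout ∈ F.outSet s uout0 ∧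
        JunctionFlux.OutgoingWave F s uout0 (uout, ∑ i, z i) w.uout w.vout) := by
  simp only [JunctionFlux.isAdmissible_iff huin0 huout0]
  refine ⟨JunctionFlux.exists_junctionSolution huin0 huout0
    (JunctionFlux.priorityInflow_mem huin0 huout0), fun w w' h h' =>
    h.1.aeEqual h'.1 huin0 h.2 h'.2, fun w h => ?_⟩
  choose uin huin hwave using h.1.exists_incomingWave huin0 h.2
  obtain ⟨uout, huout, hout⟩ := h.1.exists_outgoingWave h.2
  exact ⟨_, uin, uout, h.2, h.1.hasOutflow h.2, JunctionFlux.sum_priorityInflow,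
    JunctionFlux.isPriorityInflow_priorityInflow huin0 huout0,
    fun i => ⟨huin i, hwave i⟩, huout, hout⟩
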